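/- Let $(\Omega,\mathcal A,\mathbb P)$ be a probability space, let $Y_1,Y_2,\dots$ be i.i.d. real random variables with distribution $F$ and finite mean, and let $0=T_0<T_1<T_2<\cdots$ be random times such that the differences $T_n-T_{n-1}>0$ are i.i.d. with finite mean; the sequences $(Y_n)$ and $(T_n)$ are independent. Put $N_t=\#\{n\ge 1: T_n\le t\}$ for $0\le t\le\infty$ (so $N_\infty=\infty$), and for a real constant $c$ let $$X_t=\sum_{i=1}^{N_t}Y_i+ct\quad(0\le t<\infty),\qquad M_t=\sup\{X_u:\ 0\le u\le t,\ u<\infty\}\quad(0\le t\le\infty).$$ Assume $\mathbb E(cT_1+Y_1)=-a<0$, and write $\overline F(x)=F(x,\infty)$. Let $\mathcal T$ be the set of all random times $\tau:\Omega\to[0,\infty]$ such that for every $n\ge 1$ the $\sigma$-algebras $$\sigma\{X_s,\ s<T_n,\ \mathbb I\{\tau<T_n\}\}\quad\text{and}\quad \sigma\{X_s-X_{T_n-0},\ s\ge T_n\}$$ are independent. Here $\sigma\{X_s,\ s<T_n,\ \mathbb I\{\tau<T_n\}\}$ is generated by the event $\{\tau<T_n\}$ and the events $\{s<T_n,\ X_s\in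 B\}$ ($s\ge0$, $B$ Borel), and $\sigma\{X_s-X_{T_n-0},\ s\ge T_n\}$ is generated by the random variables $X_{T_n+u}-X_{T_n-0}$, $u\ge 0$. The distribution $F$ is called long-tailed if $\overline F>0$ everywhere and $\overline F(x+1)/\overline F(x)\to1$ as $x\to\infty$. It is called strong subexponential if it has finite mean, $\overline F>0$ everywhere, and $$\int_0^x\overline F(x-y)\overline F(y)\,dy\sim 2\,\overline F(x)\int_0^\infty\overline F(y)\,dy\qquad\text{as }x\to\infty.$$ (i) Suppose that either $c\le 0$, or $c>0$ and $\mathbb P\{cT_1>x\}=o(\overline F(x))$ as $x\to\infty$. If $F$ is strong subexponential, then, as $x\to\infty$, $$\mathbb P\{M_\tau>x\}=\frac{1+o(1)}{a}\,\mathbb E\int_x^{x+aN_\tau}\overline F(y)\,dy+o(\overline F(x))\qquad\text{uniformly over }\tau\in\mathcal T;$$ that is, for every $\varepsilon>0$ there is $x_0$ such that for all $x\ge x_0$ and all $\tau\in\mathcal T$, $$\Bigl|\mathbb P\{M_\tau>x\}-\frac1a\,\mathbb E\int_x^{x+aN_\tau}\overline F(y)\,dy\Bigr|\le\frac{\varepsilon}{a}\,\mathbb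 E\int_x^{x+aN_\tau}\overline F(y)\,dy+\varepsilon\,\overline F(x).$$ (ii) If $F$ is long-tailed (with no further condition on $c$ or $T_1$), then, as $x\to\infty$, $$\mathbb P\{M_\tau>x\}\ge\frac{1+o(1)}{a}\,\mathbb E\int_x^{x+aN_\tau}\overline F(y)\,dy+o(\overline F(x))\qquad\text{uniformly over }\tau\in\mathcal T;$$ that is, for every $\varepsilon>0$ there is $x_0$ such that for all $x\ge x_0$ and all $\tau\in\mathcal T$ the left side is at least $\frac{1-\varepsilon}{a}\,\mathbb E\int_x^{x+aN_\tau}\overline F(y)\,dy-\varepsilon\,\overline F(x)$. -/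

import Mathlib

open MeasureTheory ProbabilityTheory Filter Topology Asymptotics
open scoped ENNReal

noncomputable section

/-- The right tail `x ↦ F (x, ∞)` of a distribution on the line. -/
def distTail (F : Measure ℝ) (x : ℝ) : ℝ := F.real (Set.Ioi x)

/-- Long-tailed distributions: the tail is (eventually, hence everywhere) positive and
`F (x + 1, ∞) ∼ F (x, ∞)` as `x → ∞`. -/
def IsLongTailed (F : Measure ℝ) : Prop :=
  (∀ x, 0 < distTail F x) ∧
    Tendsto (fun x => distTail F (x + 1) / distTail F x) atTop (𝓝 1)

/-- Strong subexponential distributions (the class `S*`): finite mean, positive tail, and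
`∫₀ˣ F (x - y, ∞) F (y, ∞) dy ∼ 2 a⁺ F (x, ∞)` with `a⁺ = ∫₀^∞ F (y, ∞) dy`. -/
def IsStrongSubexponential (F : Measure ℝ) : Prop :=
  Integrable (fun y : ℝ => y) F ∧ (∀ x, 0 < distTail F x) ∧
    Tendsto (fun x => (∫ y in (0 : ℝ)..x, distTail F (x - y) * distTail F y) /
      (2 * (∫ y in Set.Ioi (0 : ℝ), distTail F y) * distTail F x)) atTop (𝓝 1)

section Processes

variable {Ω : Type*}

/-- The renewal epochs `T 0 = 0`, `T n = ξ 0 + ⋯ + ξ (n - 1)`; thus `T 1 = ξ 0`. -/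
def renewalEpoch (ξ : ℕ → Ω → ℝ) (n : ℕ) (ω : Ω) : ℝ := ∑ i ∈ Finset.range n, ξ i ω

/-- The number of epochs `T n`, `n ≥ 1`, in `[0, t]`, for `t ∈ [0, ∞]`. -/
def renewalCount (ξ : ℕ → Ω → ℝ) (t : ℝ≥0∞) (ω : Ω) : ℕ∞ :=
  Set.encard {n : ℕ | 1 ≤ n ∧ ENNReal.ofReal (renewalEpoch ξ n ω) ≤ t}

/-- The compound renewal process with linear component: the sum of the first `N t` jump sizes
plus `c * t`. The jump at the epoch `T (n + 1)` is `Y n`. (Almost surely `N t` is finite.) -/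
def compoundRenewal (c : ℝ) (ξ Y : ℕ → Ω → ℝ) (t : ℝ) (ω : Ω) : ℝ :=
  ∑ i ∈ Finset.range (renewalCount ξ (ENNReal.ofReal t) ω).toNat, Y i ω + c * t

/-- The supremum of the path of `X` over all finite times `u ∈ [0, t]`, for `t ∈ [0, ∞]`. -/
def pathSup (X : ℝ → Ω → ℝ) (t : ℝ≥0∞) (ω : Ω) : EReal :=
  ⨆ u ∈ {u : ℝ | 0 ≤ u ∧ ENNReal.ofReal u ≤ t}, (X u ω : EReal)

/-- The sigma-algebra `σ{X_s, s < T}` of the process strictly before the random time `T`: the one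
generated by the events `{s < T, X_s ∈ B}`. -/
@[reducible] def sigmaBefore (X : ℝ → Ω → ℝ) (T : Ω → ℝ) : MeasurableSpace Ω :=
  MeasurableSpace.generateFrom
    {E | ∃ s : ℝ, 0 ≤ s ∧ ∃ B : Set ℝ, MeasurableSet B ∧ E = {ω | s < T ω ∧ X s ω ∈ B}}

/-- The sigma-algebra `σ{X_s - X_{T-0}, s ≥ T}` of the increments from the random time `T`
(the jump at `T` included), generated by `X_{T+u} - X_{T-0}`, `u ≥ 0`. -/
@[reducible] def sigmaIncrementsFrom (X : ℝ → Ω → ℝ) (T : Ω → ℝ) : MeasurableSpace Ω :=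
  ⨆ u : {u : ℝ // 0 ≤ u}, MeasurableSpace.comap
    (fun ω => X (T ω + u) ω - Function.leftLim (fun t => X t ω) (T ω)) (borel ℝ)

variable [MeasurableSpace Ω]

/-- The random time `τ` (with values in `[0, ∞]`) is independent of the future increments of `X`
with respect to the random times `T n`, `n ≥ 1`. -/
def IndepFutureIncrements (μ : Measure Ω) (X : ℝ → Ω → ℝ) (T : ℕ → Ω → ℝ) (τ : Ω → ℝ≥0∞) :
    Prop :=
  ∀ n : ℕ, 1 ≤ n →
    Indep (sigmaBefore X (T n) ⊔
        MeasurableSpace.generateFrom {{ω | τ ω < ENNReal.ofReal (T n ω)}})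
      (sigmaIncrementsFrom X (T n)) μ

/-- The standing assumptions on a compound renewal process: the interarrival times `ξ n` are
i.i.d., positive, with finite mean; the jump sizes `Y n` are i.i.d. with distribution `F` and
finite mean; the two sequences are independent of each other. -/
structure IsCompoundRenewalModel (μ : Measure Ω) (F : Measure ℝ) (ξ Y : ℕ → Ω → ℝ) : Prop where
  measurable_interarrival : ∀ n, Measurable (ξ n)
  measurable_jump : ∀ n, Measurable (Y n)
  pos_interarrival : ∀ n, ∀ᵐ ω ∂μ, 0 < ξ n ω
  indep_interarrival : iIndepFun ξ μ
  indep_jump : iIndepFun Y μ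
  indep_interarrival_jump : IndepFun (fun ω n => ξ n ω) (fun ω n => Y n ω) μ
  identDistrib_interarrival : ∀ n, IdentDistrib (ξ n) (ξ 0) μ μ
  law_jump : ∀ n, μ.map (Y n) = F
  integrable_interarrival : Integrable (ξ 0) μ
  integrable_jump : Integrable (Y 0) μ

end Processes

/-- `∫_x^{x + a n} F (y, ∞) dy` for `n ∈ {0, 1, 2, …, ∞}` (and `a > 0`). -/
def tailIntegral (F : Measure ℝ) (a x : ℝ) : ℕ∞ → ℝ
  | ⊤ => ∫ y in Set.Ioi x, distTail F y
  | (n : ℕ) => ∫ y in x..(x + a * n), distTail F y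

end

/-! The principle is that of one big jump. The process drifts down by `a` per epoch, so just before
epoch `n` it stands near `-a n` and passes `x` essentially only through a single jump larger than `x
+ a n`. Summing the tail of `F` at `x + a n` over the epochs not later than `τ` gives, for long
tails, the expectation of the integral over `[x, x + a N]` divided by `a`.

The independence hypothesis speaks of the path only, and an epoch with a zero jump leaves no trace
in it. The argument therefore runs along the nonzero jumps: the state is the position just before
such a jump, the mark is the jump together with the waiting time to the next nonzero one. On the
event that this jump occurs by `τ` and that `x` was not exceeded earlier, the mark is independent of
the state (`isIncrementChain`). With `q = F {0}ᶜ` the mean increment is `-b`, `b = a / q`. The main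
inequalities are proved for an abstract `IsIncrementChain` with arbitrary decreasing events, and
their constants depend only on the laws of the increment and of the initial state. This is the
source of the uniformity over `τ`.

Since only first moments are available, the state `S n` is compared with the line `-b n` through a
Huber function. It is convex, its increments are linear up to an error bounded by both `|w|` and `w²
/ L`, and the mean of this error vanishes as `L → ∞`. This replaces a law of large numbers.

Lower bound (`sum_integral_le`). The integrated tail is convex. Evaluated at a smoothed minimum of
`S n` and `-b n`, it gives a telescoping inequality that bounds the weighted tail integrals by `b`
times the sum of the expected tails at `x - S n`. Each of these is `q` times the probability that
the `n`-th nonzero jump crosses `x`, and the crossings are disjoint.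

Upper bound (`exists_excessive`, `crossing_le`). Let `κ` be slightly larger than `1 / a`. The
function `κ` times the integrated tail, truncated and frozen at the value `1`, is excessive for the
smoothed chain even when every crossing is paid the value `1`: the drift lowers it by about `κ b f`,
while large jumps raise it by about `f / q`. Strong subexponentiality bounds the second effect
(`exists_gain_le`). Telescoping bounds the crossing probabilities. For `c > 0` the linear rise
before the next nonzero jump is a geometric sum of negligible terms, hence negligible
(`negligibleTail_of_geometric`).

It remains to pass from nonzero jumps to all epochs. One direction applies `sum_integral_le` to the
chain that merely counts jumps in a set (`eventually_tailSum_survivalSet_le`); the other combines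
it, for the zero jumps, with concavity of the tail integral (`eventually_tailSum_markSet_le`). -/

set_option linter.unusedSectionVars false

/-! ### Integrable tail functions -/

/-- A nonnegative nonincreasing function on the line that is integrable at `+∞`. -/
structure IsTail (f : ℝ → ℝ) : Prop where
  anti : Antitone f
  nonneg : ∀ x, 0 ≤ f x
  integrableOn : ∀ x, IntegrableOn f (Set.Ioi x)

/-- The integrated tail `∫_x^∞ f`. -/
noncomputable def tailInt (f : ℝ → ℝ) (x : ℝ) : ℝ := ∫ y in Set.Ioi x, f y

namespace IsTail

variable {f : ℝ → ℝ}

lemma intervalIntegrable (hf : IsTail f) (a b : ℝ) : IntervalIntegrable f volume a b :=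
  hf.anti.antitoneOn _ |>.intervalIntegrable

lemma tailInt_sub (hf : IsTail f) (x y : ℝ) : tailInt f x - tailInt f y = ∫ u in x..y, f u :=
  intervalIntegral.integral_Ioi_sub_Ioi' (hf.integrableOn x) (hf.integrableOn y)

lemma tailInt_nonneg (hf : IsTail f) (x : ℝ) : 0 ≤ tailInt f x :=
  setIntegral_nonneg measurableSet_Ioi fun y _ => hf.nonneg y

lemma integral_nonneg (hf : IsTail f) {x y : ℝ} (h : x ≤ y) : 0 ≤ ∫ u in x..y, f u :=
  intervalIntegral.integral_nonneg h fun u _ => hf.nonneg u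

lemma tailInt_anti (hf : IsTail f) : Antitone (tailInt f) := fun x y h => by
  have := hf.tailInt_sub x y
  have := hf.integral_nonneg h
  linarith

lemma measurable (hf : IsTail f) : Measurable f := hf.anti.measurable

lemma measurable_tailInt (hf : IsTail f) : Measurable (tailInt f) := hf.tailInt_anti.measurable

lemma integral_le_mul (hf : IsTail f) {x y : ℝ} (h : x ≤ y) :
    ∫ u in x..y, f u ≤ f x * (y - x) := by
  have := intervalIntegral.integral_mono_on h (hf.intervalIntegrable x y)
    (intervalIntegrable_const (c := f x)) fun u hu => hf.anti hu.1
  simpa [mul_comm] using this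

lemma mul_le_integral (hf : IsTail f) {x y : ℝ} (h : x ≤ y) :
    f y * (y - x) ≤ ∫ u in x..y, f u := by
  have := intervalIntegral.integral_mono_on h (intervalIntegrable_const (c := f y))
    (hf.intervalIntegrable x y) fun u hu => hf.anti hu.2
  simpa [mul_comm] using this

/-- Convexity of the integrated tail. -/
lemma mul_le_integral_sub (hf : IsTail f) (y η : ℝ) : f y * η ≤ ∫ u in (y - η)..y, f u := by
  rcases le_total 0 η with h | h
  · simpa using hf.mul_le_integral (show y - η ≤ y by linarith)
  · have := hf.integral_le_mul (show y ≤ y - η by linarith)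
    rw [intervalIntegral.integral_symm]
    linarith [show f y * (y - η - y) = - (f y * η) by ring]

/-- A converse to the convexity bound, for a signed displacement `η`. As long as `|η| ≤ K` the
values of `f` stay within `e` of `f y`; a negative displacement beyond `K` is credited only up to
`K`, which costs at most `f y * (|η| - K)`. -/
lemma integral_sub_le (hf : IsTail f) {y η K e : ℝ} (he : 0 ≤ e) (hK : 0 ≤ K) (hη : η ≤ K)
    (h1 : f (y - K) ≤ f y + e) (h2 : f y - e ≤ f (y + K)) :
    ∫ u in (y - η)..y, f u ≤ f y * η + e * |η| + f y * max (|η| - K) 0 := by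
  have hfy := hf.nonneg y
  rcases le_total 0 η with h | h
  · have h3 := hf.integral_le_mul (show y - η ≤ y by linarith)
    have h4 : f (y - η) ≤ f y + e := (hf.anti (by linarith)).trans h1
    have h5 : 0 ≤ f y * max (|η| - K) 0 := mul_nonneg hfy (le_max_right _ _)
    rw [abs_of_nonneg h] at *
    nlinarith
  · rw [intervalIntegral.integral_symm, abs_of_nonpos h]
    rcases le_total (-η) K with h6 | h6
    · have h3 := hf.mul_le_integral (show y ≤ y - η by linarith)
      have h4 : f y - e ≤ f (y - η) := h2.trans (hf.anti (by linarith))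
      rw [max_eq_right (by linarith)]
      nlinarith
    · have h3 := hf.mul_le_integral (show y ≤ y + K by linarith)
      have h4 : ∫ u in y..(y + K), f u ≤ ∫ u in y..(y - η), f u := by
        rw [← intervalIntegral.integral_add_adjacent_intervals
          (hf.intervalIntegrable y (y + K)) (hf.intervalIntegrable (y + K) (y - η))]
        linarith [hf.integral_nonneg (show y + K ≤ y - η by linarith)]
      rw [max_eq_left (by linarith)]
      nlinarith

lemma tendsto_tailInt (hf : IsTail f) : Tendsto (tailInt f) atTop (𝓝 0) := by
  have h1 := intervalIntegral_tendsto_integral_Ioi 0 (hf.integrableOn 0) tendsto_id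
  have h2 := (tendsto_const_nhds (x := tailInt f 0)).sub h1
  have h3 : tailInt f 0 - ∫ u in Set.Ioi 0, f u = 0 := sub_self _
  rw [h3] at h2
  refine h2.congr fun x => ?_
  have := hf.tailInt_sub 0 x
  simp only [id]
  linarith

lemma tendsto_mul_self (hf : IsTail f) : Tendsto (fun x => x * f x) atTop (𝓝 0) := by
  have h1 : Tendsto (fun x : ℝ => 2 * tailInt f (x / 2)) atTop (𝓝 0) := by
    simpa using (hf.tendsto_tailInt.comp (tendsto_id.atTop_div_const (zero_lt_two' ℝ))).const_mul 2
  refine tendsto_of_tendsto_of_tendsto_of_le_of_le' tendsto_const_nhds h1 ?_ ?_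
  · filter_upwards [eventually_ge_atTop 0] with x hx using mul_nonneg hx (hf.nonneg x)
  · filter_upwards [eventually_ge_atTop 0] with x hx
    have h2 := hf.mul_le_integral (show x / 2 ≤ x by linarith)
    have h3 := hf.tailInt_sub (x / 2) x
    have h4 := hf.tailInt_nonneg x
    linarith [show f x * (x - x / 2) = x * f x / 2 by ring]

lemma tendsto_zero (hf : IsTail f) : Tendsto f atTop (𝓝 0) := by
  refine tendsto_of_tendsto_of_tendsto_of_le_of_le' tendsto_const_nhds hf.tendsto_mul_self ?_ ?_
  · exact Eventually.of_forall hf.nonneg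
  · filter_upwards [eventually_ge_atTop 1] with x hx
    have := hf.nonneg x
    nlinarith

/-- Truncating a tail function from above at its value at `t`. -/
lemma comp_max (hf : IsTail f) (t : ℝ) : IsTail fun u => f (max u t) where
  anti := fun u v h => hf.anti (max_le_max_right _ h)
  nonneg := fun u => hf.nonneg _
  integrableOn := fun x => by
    refine Integrable.mono' (hf.integrableOn x) ?_ ?_
    · exact (hf.measurable.comp (measurable_id.max measurable_const)).aestronglyMeasurable
    · refine Eventually.of_forall fun u => ?_
      rw [Real.norm_of_nonneg (hf.nonneg _)]
      exact hf.anti (le_max_left _ _)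

end IsTail

/-- Integrability on `(0, ∞)` is the layer cake formula for the positive part; on a bounded interval
monotonicity is enough. -/
lemma isTail_distTail {F : Measure ℝ} [IsProbabilityMeasure F] (hF : Integrable (fun y : ℝ => y) F) :
    IsTail (distTail F) where
  anti := fun x y h => measureReal_mono (Set.Ioi_subset_Ioi h)
  nonneg := fun x => measureReal_nonneg
  integrableOn := fun x => by
    have hanti : Antitone (distTail F) := fun x y h => measureReal_mono (Set.Ioi_subset_Ioi h)
    have h0 : IntegrableOn (distTail F) (Set.Ioi 0) := by
      have h1 := lintegral_eq_lintegral_meas_lt F (f := fun y : ℝ => max y 0)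
        (Eventually.of_forall fun y => le_max_right _ _)
        (measurable_id.max measurable_const).aemeasurable
      have h2 : ∫⁻ y, ENNReal.ofReal (max y 0) ∂F < ∞ := hF.pos_part.lintegral_lt_top
      refine ⟨hanti.measurable.aestronglyMeasurable, ?_⟩
      rw [hasFiniteIntegral_iff_ofReal (f := distTail F) (Eventually.of_forall fun x => measureReal_nonneg)]
      rw [h1] at h2
      refine lt_of_le_of_lt (le_of_eq ?_) h2
      refine setLIntegral_congr_fun measurableSet_Ioi fun t ht => ?_
      have : {a : ℝ | t < max a 0} = Set.Ioi t := by
        ext a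
        simp only [Set.mem_ofPred_eq, lt_max_iff, Set.mem_Ioi]
        exact ⟨fun h => h.resolve_right (not_lt.2 (le_of_lt ht)), Or.inl⟩
      simp only [distTail, this]
      rw [ofReal_measureReal]
    rcases le_total 0 x with h | h
    · exact h0.mono_set (Set.Ioi_subset_Ioi h)
    · rw [← Set.Ioc_union_Ioi_eq_Ioi h]
      exact (((hanti.antitoneOn _).intervalIntegrable (a := x) (b := 0)).1).union h0

/-! ### The Huber function -/

/-- The slope of the Huber function. -/
noncomputable def huberSlope (L z : ℝ) : ℝ := max 0 (min (z / L) 1)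

/-- The one-sided Huber function: `0` for `z ≤ 0`, `z² / (2 L)` for `0 ≤ z ≤ L`, and
`z - L / 2` for `L ≤ z`. -/
noncomputable def huber (L z : ℝ) : ℝ := huberSlope L z * z - huberSlope L z ^ 2 * L / 2

lemma huberSlope_nonneg (L z : ℝ) : 0 ≤ huberSlope L z := le_max_left _ _

lemma huberSlope_le_one (L z : ℝ) : huberSlope L z ≤ 1 := max_le zero_le_one (min_le_right _ _)

lemma huberSlope_of_nonpos {L z : ℝ} (hL : 0 < L) (hz : z ≤ 0) : huberSlope L z = 0 :=
  max_eq_left ((min_le_left _ _).trans (div_nonpos_of_nonpos_of_nonneg hz hL.le))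

lemma huber_of_nonpos {L z : ℝ} (hL : 0 < L) (hz : z ≤ 0) : huber L z = 0 := by
  simp [huber, huberSlope_of_nonpos hL hz]

/-- The Huber function is the maximum over slopes `s ∈ [0, 1]` of `s z - s² L / 2`, attained at
`huberSlope L z`. Convexity and the bounds below follow by inserting a suitable slope. -/
lemma le_huber {L : ℝ} (hL : 0 < L) (z : ℝ) {s : ℝ} (h0 : 0 ≤ s) (h1 : s ≤ 1) :
    s * z - s ^ 2 * L / 2 ≤ huber L z := by
  unfold huber huberSlope
  have hz : z = z / L * L := by field_simp
  set t := z / L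
  rw [hz]
  rcases le_total t 1 with h | h
  · rw [min_eq_left h]
    rcases le_total 0 t with h' | h'
    · rw [max_eq_right h']; nlinarith [mul_nonneg hL.le (sq_nonneg (s - t))]
    · rw [max_eq_left h']; nlinarith [mul_nonneg h0 hL.le, mul_nonneg (mul_nonneg h0 hL.le) (neg_nonneg.2 h'),
        mul_nonneg hL.le (sq_nonneg s)]
  · rw [min_eq_right h, max_eq_right zero_le_one]
    nlinarith [mul_nonneg (sub_nonneg.2 h1) (mul_nonneg hL.le (sub_nonneg.2 h)),
      mul_nonneg hL.le (sq_nonneg (1 - s))]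

lemma huber_nonneg {L : ℝ} (hL : 0 < L) (z : ℝ) : 0 ≤ huber L z := by
  simpa using le_huber hL z le_rfl zero_le_one

lemma sub_le_huber {L : ℝ} (hL : 0 < L) (z : ℝ) : z - L / 2 ≤ huber L z := by
  simpa using le_huber hL z zero_le_one le_rfl

lemma huber_add_sub_le {L : ℝ} (hL : 0 < L) (z w : ℝ) :
    huber L (z + w) - huber L z ≤ huberSlope L (z + w) * w := by
  have := le_huber hL z (huberSlope_nonneg L (z + w)) (huberSlope_le_one L (z + w))
  unfold huber at *
  linarith

lemma huber_add_le {L : ℝ} (hL : 0 < L) (z w : ℝ) : huber L (z + w) ≤ huber L z + max w 0 := by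
  have h1 := huber_add_sub_le hL z w
  have h2 : huberSlope L (z + w) * w ≤ max w 0 := by
    have h3 := huberSlope_nonneg L (z + w)
    have h4 := huberSlope_le_one L (z + w)
    rcases le_total 0 w with h | h
    · exact le_max_of_le_left (by nlinarith)
    · exact le_max_of_le_right (mul_nonpos_of_nonneg_of_nonpos h3 h)
  linarith

lemma huberSlope_sub_le {L : ℝ} (hL : 0 < L) (z w : ℝ) :
    |huberSlope L (z + w) - huberSlope L z| ≤ min 1 (|w| / L) := by
  refine le_min ?_ ?_
  · have := huberSlope_nonneg L (z + w)
    have := huberSlope_nonneg L z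
    have := huberSlope_le_one L (z + w)
    have := huberSlope_le_one L z
    rw [abs_le]; constructor <;> linarith
  · unfold huberSlope
    have h1 := abs_max_sub_max_le_abs (min ((z + w) / L) 1) (min (z / L) 1) 0
    have h2 := abs_min_sub_min_le_max ((z + w) / L) 1 (z / L) 1
    rw [max_comm, max_comm 0]
    refine h1.trans (h2.trans ?_)
    rw [sub_self, abs_zero, max_eq_left (abs_nonneg _), ← sub_div, add_sub_cancel_left, abs_div,
      abs_of_pos hL]

/-- The second order error of the Huber function. -/
noncomputable def huberErr (L w : ℝ) : ℝ := min |w| (w ^ 2 / L)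

lemma huberErr_nonneg {L : ℝ} (hL : 0 < L) (w : ℝ) : 0 ≤ huberErr L w :=
  le_min (abs_nonneg _) (by positivity)

lemma huberErr_le_abs (L w : ℝ) : huberErr L w ≤ |w| := min_le_left _ _

/-- Convexity gives the slope at the end point. Replacing it by the slope at `z` costs the change of
slope times `|w|`, and the slope is `1 / L`-Lipschitz with values in `[0, 1]`. -/
lemma huber_add_sub_le_add {L : ℝ} (hL : 0 < L) (z w : ℝ) :
    huber L (z + w) - huber L z ≤ huberSlope L z * w + huberErr L w := by
  have h1 := huber_add_sub_le hL z w
  have h2 := huberSlope_sub_le hL z w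
  have h3 : (huberSlope L (z + w) - huberSlope L z) * w ≤ huberErr L w := by
    refine (le_abs_self _).trans ?_
    rw [abs_mul]
    refine le_min ?_ ?_
    · nlinarith [abs_nonneg w, h2.trans (min_le_left _ _)]
    · have h4 := mul_le_mul_of_nonneg_right (h2.trans (min_le_right _ _)) (abs_nonneg w)
      rwa [div_mul_eq_mul_div, ← sq, sq_abs] at h4
  linarith

lemma huber_le_huberErr {L : ℝ} (hL : 0 < L) (w : ℝ) : huber L w ≤ huberErr L w := by
  have := huber_add_sub_le_add hL 0 w
  simpa [huber_of_nonpos hL le_rfl, huberSlope_of_nonpos hL le_rfl] using this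

lemma measurable_huberSlope (L : ℝ) : Measurable (huberSlope L) := by
  unfold huberSlope; fun_prop

lemma measurable_huber (L : ℝ) : Measurable (huber L) := by
  unfold huber
  have := measurable_huberSlope L
  fun_prop

lemma measurable_huberErr (L : ℝ) : Measurable (huberErr L) := by
  unfold huberErr
  fun_prop

lemma integrable_huberErr {E : Type*} [MeasurableSpace E] {Q : Measure E} {h : E → ℝ}
    (hh : Integrable h Q) {L : ℝ} (hL : 0 < L) : Integrable (fun w => huberErr L (h w)) Q := by
  refine hh.abs.mono' ((measurable_huberErr L).comp_aemeasurable hh.aemeasurable).aestronglyMeasurable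
    (Eventually.of_forall fun w => ?_)
  rw [Real.norm_of_nonneg (huberErr_nonneg hL _)]
  exact huberErr_le_abs _ _

/-- The error is dominated by `|h|` and tends to `0` pointwise. This is why a first moment suffices
for all drift estimates. -/
lemma eventually_integral_huberErr_le {E : Type*} [MeasurableSpace E] {Q : Measure E} {h : E → ℝ}
    (hh : Integrable h Q) {ε : ℝ} (hε : 0 < ε) :
    ∀ᶠ L in atTop, ∫ w, huberErr L (h w) ∂Q ≤ ε := by
  have : Tendsto (fun L => ∫ w, huberErr L (h w) ∂Q) atTop (𝓝 (∫ _, (0 : ℝ) ∂Q)) := by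
    refine tendsto_integral_filter_of_dominated_convergence (fun w => |h w|) ?_ ?_ hh.abs ?_
    · exact Eventually.of_forall fun L =>
        ((measurable_huberErr L).comp_aemeasurable hh.aemeasurable).aestronglyMeasurable
    · filter_upwards [eventually_gt_atTop 0] with L hL
      refine Eventually.of_forall fun w => ?_
      rw [Real.norm_of_nonneg (huberErr_nonneg hL _)]
      exact huberErr_le_abs _ _
    · refine Eventually.of_forall fun w => ?_
      have h1 : Tendsto (fun L : ℝ => h w ^ 2 / L) atTop (𝓝 0) :=
        tendsto_const_nhds.div_atTop tendsto_id
      refine tendsto_of_tendsto_of_tendsto_of_le_of_le' tendsto_const_nhds h1 ?_ ?_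
      · filter_upwards [eventually_gt_atTop 0] with L hL using huberErr_nonneg hL _
      · exact Eventually.of_forall fun L => min_le_right _ _
  rw [integral_zero] at this
  exact this.eventually_le_const hε

lemma integral_add_add_add_sub {α : Type*} [MeasurableSpace α] {μ : Measure α}
    {u₁ u₂ u₃ u₄ u₅ : α → ℝ} (h₁ : Integrable u₁ μ) (h₂ : Integrable u₂ μ) (h₃ : Integrable u₃ μ)
    (h₄ : Integrable u₄ μ) (h₅ : Integrable u₅ μ) :
    ∫ a, (u₁ a + u₂ a + (u₃ a + u₄ a - u₅ a)) ∂μ =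
      ∫ a, u₁ a ∂μ + ∫ a, u₂ a ∂μ + (∫ a, u₃ a ∂μ + ∫ a, u₄ a ∂μ - ∫ a, u₅ a ∂μ) := by
  have h12 : Integrable (fun a => u₁ a + u₂ a) μ := h₁.add h₂
  have h34 : Integrable (fun a => u₃ a + u₄ a) μ := h₃.add h₄
  have h345 : Integrable (fun a => u₃ a + u₄ a - u₅ a) μ := h34.sub h₅
  rw [integral_add h12 h345, integral_add h₁ h₂, integral_sub h34 h₅, integral_add h₃ h₄]

/-! ### Chains with independent increments on a decreasing sequence of events -/

/-- States `S n`, marks `W n` and a decreasing sequence of events `B n` such that on `B n` the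
mark `W n` has law `Q` and is independent of `S n`, and the increment of the state is `ζ (W n)`. -/
structure IsIncrementChain {Ω E : Type*} [MeasurableSpace Ω] [MeasurableSpace E] (μ : Measure Ω)
    (S : ℕ → Ω → ℝ) (W : ℕ → Ω → E) (B : ℕ → Set Ω) (Q : Measure E) (ζ : E → ℝ) : Prop where
  measurable_state : ∀ n, Measurable (S n)
  measurable_mark : ∀ n, Measurable (W n)
  measurableSet : ∀ n, MeasurableSet (B n)
  anti : ∀ n, B (n + 1) ⊆ B n
  measurable_incr : Measurable ζ
  step : ∀ n, ∀ᵐ ω ∂μ, ω ∈ B n → S (n + 1) ω = S n ω + ζ (W n ω)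
  law : ∀ n, (μ.restrict (B n)).map (fun ω => (S n ω, W n ω)) =
    ((μ.restrict (B n)).map (S n)).prod Q

namespace IsIncrementChain

variable {Ω E : Type*} [MeasurableSpace Ω] [MeasurableSpace E] {μ : Measure Ω}
  [IsProbabilityMeasure μ] {S : ℕ → Ω → ℝ} {W : ℕ → Ω → E} {B : ℕ → Set Ω} {Q : Measure E}
  [IsProbabilityMeasure Q] {ζ : E → ℝ}

lemma setIntegral_mul (hC : IsIncrementChain μ S W B Q ζ) (n : ℕ) {φ : ℝ → ℝ} {k : E → ℝ}
    (hφ : Measurable φ) (hk : Measurable k) :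
    ∫ ω in B n, φ (S n ω) * k (W n ω) ∂μ = (∫ ω in B n, φ (S n ω) ∂μ) * ∫ w, k w ∂Q := by
  have hp : Measurable fun ω => (S n ω, W n ω) :=
    (hC.measurable_state n).prodMk (hC.measurable_mark n)
  have h1 : ∫ ω in B n, φ (S n ω) * k (W n ω) ∂μ =
      ∫ p, φ p.1 * k p.2 ∂((μ.restrict (B n)).map (fun ω => (S n ω, W n ω))) := by
    rw [integral_map hp.aemeasurable]
    exact ((hφ.comp measurable_fst).mul (hk.comp measurable_snd)).aestronglyMeasurable
  rw [h1, hC.law n, integral_prod_mul,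
    integral_map (hC.measurable_state n).aemeasurable hφ.aestronglyMeasurable]

lemma integrableOn_mul (hC : IsIncrementChain μ S W B Q ζ) (n : ℕ) {φ : ℝ → ℝ} {k : E → ℝ}
    (hφ : Measurable φ) {M : ℝ} (hM : ∀ s, |φ s| ≤ M) (hki : Integrable k Q) :
    IntegrableOn (fun ω => φ (S n ω) * k (W n ω)) (B n) μ := by
  have hp : Measurable fun ω => (S n ω, W n ω) :=
    (hC.measurable_state n).prodMk (hC.measurable_mark n)
  have : IsFiniteMeasure ((μ.restrict (B n)).map (S n)) := by
    exact Measure.isFiniteMeasure_map _ _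
  have h1 : Integrable (fun p : ℝ × E => φ p.1 * k p.2)
      (((μ.restrict (B n)).map (S n)).prod Q) := by
    refine Integrable.mul_prod ?_ hki
    exact Integrable.of_bound hφ.aestronglyMeasurable M (Eventually.of_forall hM)
  rw [← hC.law n] at h1
  exact (integrable_map_measure h1.aestronglyMeasurable hp.aemeasurable).1 h1

lemma setIntegral_le_of_forall (hC : IsIncrementChain μ S W B Q ζ) (n : ℕ) {h : ℝ → E → ℝ}
    {φ : ℝ → ℝ} (hh : Measurable (Function.uncurry h)) {M : ℝ} (hM : ∀ s w, |h s w| ≤ M)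
    (hφ : Measurable φ) (hφM : ∀ s, |φ s| ≤ M) (hle : ∀ s, ∫ w, h s w ∂Q ≤ φ s) :
    ∫ ω in B n, h (S n ω) (W n ω) ∂μ ≤ ∫ ω in B n, φ (S n ω) ∂μ := by
  have hp : Measurable fun ω => (S n ω, W n ω) :=
    (hC.measurable_state n).prodMk (hC.measurable_mark n)
  have : IsFiniteMeasure ((μ.restrict (B n)).map (S n)) := Measure.isFiniteMeasure_map _ _
  have hi : Integrable (Function.uncurry h) (((μ.restrict (B n)).map (S n)).prod Q) :=
    Integrable.of_bound hh.aestronglyMeasurable M (Eventually.of_forall fun p => hM p.1 p.2)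
  have h1 : ∫ ω in B n, h (S n ω) (W n ω) ∂μ =
      ∫ p, Function.uncurry h p ∂((μ.restrict (B n)).map (fun ω => (S n ω, W n ω))) := by
    rw [integral_map hp.aemeasurable hh.aestronglyMeasurable]
    rfl
  rw [h1, hC.law n, integral_prod _ hi,
    ← integral_map (hC.measurable_state n).aemeasurable hφ.aestronglyMeasurable]
  refine integral_mono hi.integral_prod_left
    (Integrable.of_bound hφ.aestronglyMeasurable M (Eventually.of_forall hφM)) hle

/-- Lower bound for the tail sums along a chain with negative drift `-b`. -/
theorem sum_integral_le (hC : IsIncrementChain μ S W B Q ζ) {f : ℝ → ℝ} (hf : IsTail f)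
    (hf' : ∀ y, f y ≤ 1) {b L ε : ℝ} (hζ : Integrable ζ Q) (hb : ∫ w, ζ w ∂Q = -b) (hb0 : 0 ≤ b) (hL : 0 < L)
    (hε : ∫ w, huberErr L (-(ζ w + b)) ∂Q ≤ ε) (hS0 : Integrable (S 0) μ) (x : ℝ) (m : ℕ) :
    ∑ n ∈ Finset.range m, μ.real (B n) * ∫ u in (x + b * n)..(x + b * (n + 1)), f u ≤
      (b + ε) * ∑ n ∈ Finset.range m, ∫ ω in B n, f (x - L / 2 - S n ω) ∂μ +
        f x * ∫ ω, huberErr L (-S 0 ω) ∂μ := by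
  have hf1 := hf.measurable
  have hf2 := hf.measurable_tailInt
  have hg1 := measurable_huber L
  have hg2 := measurable_huberSlope L
  have hg3 := measurable_huberErr L
  have hζm := hC.measurable_incr
  -- the modified state
  let s : ℕ → ℝ → ℝ := fun n z => -(b * n) - huber L (-(z + b * n))
  have hs : ∀ n, Measurable (s n) := fun n => by
    simp only [s]; fun_prop
  have hsle : ∀ n z, s n z ≤ -(b * n) := fun n z => by
    have := huber_nonneg hL (-(z + b * n)); simp only [s]; linarith
  have hsle' : ∀ n z, s n z ≤ z + L / 2 := fun n z => by
    have := sub_le_huber hL (-(z + b * n)); simp only [s]; linarith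
  -- Here `s n` is a smoothed minimum of the state and `-b n`. The potential `h` is nonpositive and
  -- vanishes as soon as the state is above the line `-b n`.
  let h : ℕ → ℝ → ℝ := fun n z => tailInt f (x - s n z) - tailInt f (x + b * n)
  have hh : ∀ n, Measurable (h n) := fun n => by
    have := hs n
    simp only [h]; fun_prop
  have hh0 : ∀ n z, h n z ≤ 0 := fun n z => by
    have := hf.tailInt_anti (show x + b * n ≤ x - s n z by linarith [hsle n z])
    simp only [h]; linarith
  have hbn : ∀ n : ℕ, 0 ≤ b * n := fun n => by positivity
  have hhM : ∀ n z, |h n z| ≤ tailInt f x := fun n z => by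
    rw [abs_of_nonpos (hh0 n z)]
    have h1 := hf.tailInt_nonneg (x - s n z)
    have h2 := hf.tailInt_anti (show x ≤ x + b * n by linarith [hbn n])
    simp only [h]; linarith
  have hhi : ∀ n k, IntegrableOn (fun ω => h n (S k ω)) (B k) μ := fun n k =>
    Integrable.of_bound (((hh n).comp (hC.measurable_state k)).aestronglyMeasurable) (tailInt f x)
      (Eventually.of_forall fun ω => hhM n _)
  -- one step
  let φ : ℕ → ℝ → ℝ := fun n z => f (x - s n z)
  have hφ : ∀ n, Measurable (φ n) := fun n => by
    have := hs n
    simp only [φ]; fun_prop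
  have hφ0 : ∀ n z, 0 ≤ φ n z := fun n z => hf.nonneg _
  have hφx : ∀ n z, φ n z ≤ f x := fun n z => hf.anti (by linarith [hsle n z, hbn n])
  have hφle : ∀ n z, φ n z ≤ f (x - L / 2 - z) := fun n z =>
    hf.anti (by linarith [hsle' n z])
  let ψ : ℕ → ℝ → ℝ := fun n z => φ n z * huberSlope L (-(z + b * n))
  have hψ : ∀ n, Measurable (ψ n) := fun n => by
    have := hφ n
    simp only [ψ]; fun_prop
  have hψM : ∀ n z, |ψ n z| ≤ f x := fun n z => by
    have h1 := huberSlope_nonneg L (-(z + b * n))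
    have h2 := huberSlope_le_one L (-(z + b * n))
    rw [abs_of_nonneg (mul_nonneg (hφ0 n z) h1)]
    exact (mul_le_of_le_one_right (hφ0 n z) h2).trans (hφx n z)
  have hφM : ∀ n z, |φ n z| ≤ f x := fun n z => by
    rw [abs_of_nonneg (hφ0 n z)]; exact hφx n z
  have hcent : ∫ w, (ζ w + b) ∂Q = 0 := by
    rw [integral_add hζ (integrable_const _), hb]; simp
  have hci : Integrable (fun w => ζ w + b) Q := hζ.add (integrable_const _)
  have hei : Integrable (fun w => huberErr L (-(ζ w + b))) Q := integrable_huberErr hci.neg hL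
  -- The tangent bound for the convex integrated tail, with slope `f (x - s n z)`, is combined with
  -- the first-order expansion of the Huber function. The term with `ψ` is linear in the centred
  -- increment `v + b`, so it has mean zero by independence.
  have hpt : ∀ n z v, h n z + (tailInt f (x + b * n) - tailInt f (x + b * (n + 1 : ℕ))) +
      (-b * φ n z + ψ n z * (v + b) - φ n z * huberErr L (-(v + b))) ≤ h (n + 1) (z + v) := by
    intro n z v
    have h1 := huber_add_sub_le_add hL (-(z + b * n)) (-(v + b))
    have h2 := hf.mul_le_integral_sub (x - s n z) (s (n + 1) (z + v) - s n z)
    rw [show x - s n z - (s (n + 1) (z + v) - s n z) = x - s (n + 1) (z + v) by ring,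
      ← hf.tailInt_sub] at h2
    have h3 : s (n + 1) (z + v) - s n z ≥ -b + huberSlope L (-(z + b * n)) * (v + b) -
        huberErr L (-(v + b)) := by
      have : -(z + v + b * ((n + 1 : ℕ) : ℝ)) = -(z + b * n) + -(v + b) := by push_cast; ring
      simp only [s]
      rw [this]
      push_cast
      linarith
    have h4 := mul_le_mul_of_nonneg_left h3 (hφ0 n z)
    simp only [h, ψ]
    simp only [φ] at h4 ⊢
    nlinarith
  have hstep : ∀ n, ∫ ω in B n, h n (S n ω) ∂μ +
      μ.real (B n) * (∫ u in (x + b * n)..(x + b * (n + 1)), f u) -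
      (b + ε) * ∫ ω in B n, f (x - L / 2 - S n ω) ∂μ ≤ ∫ ω in B (n + 1), h (n + 1) (S (n + 1) ω) ∂μ := by
    intro n
    -- Because the potential is nonpositive, discarding `B n \ B (n + 1)` can only increase its
    -- integral; nothing needs to be known about how the events decrease.
    have h1 : ∫ ω in B n, h (n + 1) (S (n + 1) ω) ∂μ ≤
        ∫ ω in B (n + 1), h (n + 1) (S (n + 1) ω) ∂μ := by
      have hi : IntegrableOn (fun ω => h (n + 1) (S (n + 1) ω)) (B n) μ :=
        Integrable.of_bound (((hh _).comp (hC.measurable_state _)).aestronglyMeasurable)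
          (tailInt f x) (Eventually.of_forall fun ω => hhM _ _)
      have := setIntegral_mono_set (f := fun ω => -h (n + 1) (S (n + 1) ω)) hi.neg
        (Eventually.of_forall fun ω => neg_nonneg.2 (hh0 _ _)) (hC.anti n).eventuallyLE
      rw [integral_neg, integral_neg] at this
      linarith
    have h2 : ∫ ω in B n, h (n + 1) (S (n + 1) ω) ∂μ =
        ∫ ω in B n, h (n + 1) (S n ω + ζ (W n ω)) ∂μ := by
      refine setIntegral_congr_ae (hC.measurableSet n) ?_
      filter_upwards [hC.step n] with ω hω hB
      rw [hω hB]
    have i1 := hhi n n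
    have i2 : IntegrableOn (fun ω => φ n (S n ω)) (B n) μ :=
      Integrable.of_bound (((hφ n).comp (hC.measurable_state n)).aestronglyMeasurable) (f x)
        (Eventually.of_forall fun ω => hφM n _)
    have i3 := hC.integrableOn_mul n (hψ n) (hψM n) hci
    have i4 := hC.integrableOn_mul n (hφ n) (hφM n) hei
    have i0 : IntegrableOn (fun _ : Ω => tailInt f (x + b * n) - tailInt f (x + b * (n + 1 : ℕ)))
      (B n) μ := integrable_const _
    have h3 : ∫ ω in B n, (h n (S n ω) +
        (tailInt f (x + b * n) - tailInt f (x + b * (n + 1 : ℕ))) +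
        (-b * φ n (S n ω) + ψ n (S n ω) * (ζ (W n ω) + b) -
          φ n (S n ω) * huberErr L (-(ζ (W n ω) + b)))) ∂μ ≤
        ∫ ω in B n, h (n + 1) (S n ω + ζ (W n ω)) ∂μ := by
      refine setIntegral_mono ((i1.add i0).add (((i2.const_mul (-b)).add i3).sub i4)) ?_
        fun ω => hpt n _ _
      refine Integrable.of_bound ?_ (tailInt f x) (Eventually.of_forall fun ω => hhM _ _)
      exact ((hh _).comp ((hC.measurable_state n).add
        (hζm.comp (hC.measurable_mark n)))).aestronglyMeasurable
    have h4 : ∫ ω in B n, (h n (S n ω) +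
        (tailInt f (x + b * n) - tailInt f (x + b * (n + 1 : ℕ))) +
        (-b * φ n (S n ω) + ψ n (S n ω) * (ζ (W n ω) + b) -
          φ n (S n ω) * huberErr L (-(ζ (W n ω) + b)))) ∂μ =
        ∫ ω in B n, h n (S n ω) ∂μ +
          μ.real (B n) * (∫ u in (x + b * n)..(x + b * (n + 1)), f u) +
          (-b * ∫ ω in B n, φ n (S n ω) ∂μ + 0 -
            (∫ ω in B n, φ n (S n ω) ∂μ) * ∫ w, huberErr L (-(ζ w + b)) ∂Q) := by
      rw [integral_add_add_add_sub i1 i0 (i2.const_mul (-b)) i3 i4, integral_const_mul, hC.setIntegral_mul n (hψ n) (hζm.add_const b), hcent,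
        hC.setIntegral_mul (k := fun w => huberErr L (-(ζ w + b))) n (hφ n)
          (hg3.comp (hζm.add_const b).neg), setIntegral_const,
        hf.tailInt_sub]
      push_cast
      simp
    have h5 : ∫ ω in B n, φ n (S n ω) ∂μ ≤ ∫ ω in B n, f (x - L / 2 - S n ω) ∂μ := by
      refine setIntegral_mono i2 ?_ fun ω => hφle n _
      refine Integrable.of_bound ?_ 1 (Eventually.of_forall fun ω => ?_)
      · exact (hf1.comp (measurable_const.sub (hC.measurable_state n))).aestronglyMeasurable
      · rw [Real.norm_of_nonneg (hf.nonneg _)]; exact hf' _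
    have h6 : 0 ≤ ∫ ω in B n, φ n (S n ω) ∂μ := integral_nonneg fun ω => hφ0 n _
    have h7 : 0 ≤ ∫ w, huberErr L (-(ζ w + b)) ∂Q := integral_nonneg fun w => huberErr_nonneg hL _
    nlinarith
  have hinit : -(f x * ∫ ω, huberErr L (-S 0 ω) ∂μ) ≤ ∫ ω in B 0, h 0 (S 0 ω) ∂μ := by
    have i1 : Integrable (fun ω => huberErr L (-S 0 ω)) μ := integrable_huberErr hS0.neg hL
    have h1 : ∀ z, -(f x * huberErr L (-z)) ≤ h 0 z := fun z => by
      have h2 := hf.mul_le_integral_sub x (s 0 z)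
      rw [← hf.tailInt_sub] at h2
      have h3 := huber_le_huberErr hL (-z)
      have h4 : s 0 z = -huber L (-z) := by simp [s]
      have h5 := hf.nonneg x
      have h6 : h 0 z = tailInt f (x - s 0 z) - tailInt f x := by simp [h]
      rw [h6]
      rw [h4] at h2 ⊢
      nlinarith
    have h2 : ∫ ω in B 0, -(f x * huberErr L (-S 0 ω)) ∂μ ≤ ∫ ω in B 0, h 0 (S 0 ω) ∂μ :=
      setIntegral_mono (i1.const_mul _).neg.integrableOn (hhi 0 0) fun ω => h1 _
    have h3 : ∫ ω in B 0, f x * huberErr L (-S 0 ω) ∂μ ≤ ∫ ω, f x * huberErr L (-S 0 ω) ∂μ :=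
      setIntegral_le_integral (i1.const_mul _)
        (Eventually.of_forall fun ω => mul_nonneg (hf.nonneg _) (huberErr_nonneg hL _))
    rw [integral_neg] at h2
    rw [integral_const_mul (μ := μ) (f x) fun ω => huberErr L (-S 0 ω)] at h3
    linarith
  have htel : ∀ m, ∫ ω in B 0, h 0 (S 0 ω) ∂μ +
      ∑ n ∈ Finset.range m, μ.real (B n) * (∫ u in (x + b * n)..(x + b * (n + 1)), f u) -
      (b + ε) * ∑ n ∈ Finset.range m, ∫ ω in B n, f (x - L / 2 - S n ω) ∂μ ≤
      ∫ ω in B m, h m (S m ω) ∂μ := by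
    intro m
    induction m with
    | zero => simp
    | succ k ih =>
      rw [Finset.sum_range_succ, Finset.sum_range_succ]
      have := hstep k
      linarith
  -- The sign of the final potential closes the telescoped inequality, whatever the events do later.
  have h1 : ∫ ω in B m, h m (S m ω) ∂μ ≤ 0 := integral_nonpos fun ω => hh0 _ _
  linarith [htel m]

end IsIncrementChain

/-! ### Strong subexponential tails -/

/-- The analytic properties of strong subexponential tails. -/
structure IsStrongTail (f : ℝ → ℝ) : Prop extends IsTail f where
  pos : ∀ x, 0 < f x
  le_one : ∀ x, f x ≤ 1
  shift : ∀ C ε : ℝ, 0 < ε → ∀ᶠ y in atTop, f (y - C) ≤ (1 + ε) * f y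
  middle : ∀ ε : ℝ, 0 < ε → ∃ K₀ : ℝ, ∀ K ≥ K₀, ∀ y ≥ 2 * K,
    ∫ u in K..(y - K), f u * f (y - u) ≤ ε * f y
  conv : ∃ C : ℝ, ∀ᶠ y in atTop, ∫ u in (0 : ℝ)..y, f u * f (y - u) ≤ C * f y

/-- The expected gain of the integrated tail of `G` caused by upward jumps larger than `K`. -/
lemma IsTail.integral_gain_le {E : Type*} [MeasurableSpace E] {Q : Measure E} [IsFiniteMeasure Q]
    {f G : ℝ → ℝ} (hf : IsTail f) (hG : IsTail G) {p : E → ℝ} (hp : Measurable p) {r K t y : ℝ}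
    (hty : t ≤ y) (htail : ∀ u ≥ K, Q.real {w | u < p w} ≤ r * f u) :
    ∫ w, (if K < p w then tailInt G (max (y - p w) t) - tailInt G y else 0) ∂Q ≤
      r * ∫ u in t..y, G u * f (max K (y - u)) := by
  have hGm := hG.measurable
  have hfm := hf.measurable
  -- The gain caused by `w` is the integral of `G` over the stretch passed by the jump. After
  -- exchanging the integrals, the set of `w` whose jump passes `u` is `{p > max K (y - u)}`, to
  -- which the tail bound applies.
  let k : E → ℝ → ℝ := fun w u => if K < p w ∧ y - p w < u then G u else 0
  have hkm : Measurable (Function.uncurry k) := by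
    refine Measurable.ite ?_ (hGm.comp measurable_snd) measurable_const
    exact (measurableSet_lt measurable_const (hp.comp measurable_fst)).inter
      (measurableSet_lt (measurable_const.sub (hp.comp measurable_fst)) measurable_snd)
  have hk0 : ∀ w u, 0 ≤ k w u := fun w u => by
    simp only [k]; split_ifs
    exacts [hG.nonneg _, le_rfl]
  have hkG : ∀ w u, k w u ≤ G u := fun w u => by
    simp only [k]; split_ifs
    exacts [le_rfl, hG.nonneg _]
  have h1 : ∀ w, (if K < p w then tailInt G (max (y - p w) t) - tailInt G y else 0) ≤
      ∫ u in Set.Ioc t y, k w u := by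
    intro w
    split_ifs with h
    · rcases le_total y (max (y - p w) t) with h2 | h2
      · have := hG.tailInt_anti h2
        have h3 : 0 ≤ ∫ u in Set.Ioc t y, k w u := MeasureTheory.integral_nonneg fun u => hk0 w u
        linarith
      · rw [hG.tailInt_sub, intervalIntegral.integral_of_le h2]
        have h4 : ∫ u in Set.Ioc (max (y - p w) t) y, G u =
            ∫ u in Set.Ioc (max (y - p w) t) y, k w u := by
          refine setIntegral_congr_fun measurableSet_Ioc fun u hu => ?_
          simp only [k]
          rw [if_pos ⟨h, (le_max_left _ _).trans_lt hu.1⟩]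
        rw [h4]
        refine setIntegral_mono_set ?_ (Eventually.of_forall fun u => hk0 w u)
          (Set.Ioc_subset_Ioc_left (le_max_right _ _)).eventuallyLE
        refine Integrable.mono' ((hG.intervalIntegrable t y).1)
          (hkm.comp measurable_prodMk_left).aestronglyMeasurable (Eventually.of_forall fun u => ?_)
        rw [Real.norm_of_nonneg (hk0 w u)]
        exact hkG w u
    · exact MeasureTheory.integral_nonneg fun u => hk0 w u
  have hki : Integrable (Function.uncurry k) (Q.prod (volume.restrict (Set.Ioc t y))) := by
    have hi : Integrable (fun q : E × ℝ => (1 : ℝ) * G q.2)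
        (Q.prod (volume.restrict (Set.Ioc t y))) :=
      Integrable.mul_prod (integrable_const _) (hG.intervalIntegrable t y).1
    refine hi.mono' hkm.aestronglyMeasurable (Eventually.of_forall fun q => ?_)
    rw [one_mul]
    exact (Real.norm_of_nonneg (hk0 q.1 q.2)).trans_le (hkG q.1 q.2)
  have h2 : ∫ w, (if K < p w then tailInt G (max (y - p w) t) - tailInt G y else 0) ∂Q ≤
      ∫ w, (∫ u in Set.Ioc t y, k w u) ∂Q := by
    -- In the non-integrable case the integral on the left is `0` by convention, and the right side
    -- is nonnegative.
    by_cases hi : Integrable (fun w => (if K < p w then tailInt G (max (y - p w) t) - tailInt G y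
        else 0)) Q
    · exact integral_mono hi hki.integral_prod_left h1
    · rw [integral_undef hi]
      exact MeasureTheory.integral_nonneg fun w => MeasureTheory.integral_nonneg fun u => hk0 w u
  rw [integral_integral_swap hki] at h2
  refine h2.trans ?_
  rw [← intervalIntegral.integral_const_mul, intervalIntegral.integral_of_le hty]
  refine setIntegral_mono_on hki.integral_prod_right ?_ measurableSet_Ioc fun u hu => ?_
  · refine Integrable.const_mul ?_ r
    refine ((hG.intervalIntegrable t y).1.mul_const (f K)).mono' ?_ (Eventually.of_forall fun u => ?_)
    · exact (hGm.mul (hfm.comp (measurable_const.max (measurable_const.sub measurable_id)))).aestronglyMeasurable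
    · rw [Real.norm_of_nonneg (mul_nonneg (hG.nonneg _) (hf.nonneg _))]
      exact mul_le_mul_of_nonneg_left (hf.anti (le_max_left _ _)) (hG.nonneg _)
  · have h3 : ∀ w, k w u = Set.indicator {w | max K (y - u) < p w} (fun _ => G u) w := fun w => by
      simp only [k, Set.indicator, Set.mem_ofPred_eq, max_lt_iff]
      congr 1
      rw [sub_lt_comm]
    simp_rw [h3]
    rw [integral_indicator (measurableSet_lt measurable_const hp), setIntegral_const, smul_eq_mul]
    have := htail (max K (y - u)) (le_max_left _ _)
    have := hG.nonneg u
    nlinarith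

namespace IsTail

variable {f : ℝ → ℝ}

lemma tailInt_comp_max_of_le {t x : ℝ} (h : t ≤ x) :
    tailInt (fun u => f (max u t)) x = tailInt f x :=
  setIntegral_congr_fun measurableSet_Ioi fun u hu => by
    simp only [max_eq_left (h.trans (le_of_lt hu))]

lemma tailInt_comp_max_of_ge (hf : IsTail f) {t x : ℝ} (h : x ≤ t) :
    tailInt (fun u => f (max u t)) x = f t * (t - x) + tailInt f t := by
  have h1 := (hf.comp_max t).tailInt_sub x t
  rw [tailInt_comp_max_of_le le_rfl] at h1
  have h2 : ∫ u in x..t, f (max u t) = ∫ u in x..t, f t := by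
    refine intervalIntegral.integral_congr fun u hu => ?_
    rw [Set.uIcc_of_le h] at hu
    simp only [max_eq_right hu.2]
  rw [h2, intervalIntegral.integral_const, smul_eq_mul] at h1
  linarith

/-- To the left of `t` the truncated function is constant, so the equation is linear in `s`. The
solution is nonpositive for large `t` because `t f t` and the integrated tail at `t` tend to `0`. -/
lemma eventually_exists_level (hf : IsTail f) (hpos : ∀ x, 0 < f x) {κ : ℝ} (hκ : 0 < κ) :
    ∀ᶠ t in atTop, ∃ s ≤ 0, κ * tailInt (fun u => f (max u t)) s = 1 := by
  have h1 : Tendsto (fun t => t * f t + tailInt f t) atTop (𝓝 0) := by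
    simpa using hf.tendsto_mul_self.add hf.tendsto_tailInt
  filter_upwards [h1.eventually_le_const (show (0 : ℝ) < 1 / κ by positivity),
    eventually_ge_atTop 0] with t ht ht0
  have hft := hpos t
  have h3 : t - (1 / κ - tailInt f t) / f t ≤ 0 := by
    rw [sub_nonpos, le_div_iff₀ hft]
    linarith
  refine ⟨t - (1 / κ - tailInt f t) / f t, h3, ?_⟩
  rw [hf.tailInt_comp_max_of_ge (h3.trans ht0)]
  field_simp
  ring

/-- Integrability of the convolution integrands. -/
lemma intervalIntegrable_mul (hf : IsTail f) {G : ℝ → ℝ} (hG : IsTail G) (hf1 : ∀ x, f x ≤ 1)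
    {k : ℝ → ℝ} (hk : Measurable k) (a b : ℝ) :
    IntervalIntegrable (fun u => G u * f (k u)) volume a b := by
  refine (hG.intervalIntegrable a b).mono_fun ?_ (Eventually.of_forall fun u => ?_)
  · exact (hG.measurable.mul (hf.measurable.comp hk)).aestronglyMeasurable
  · beta_reduce
    rw [Real.norm_of_nonneg (mul_nonneg (hG.nonneg _) (hf.nonneg _)),
      Real.norm_of_nonneg (hG.nonneg _)]
    exact mul_le_of_le_one_right (hG.nonneg _) (hf1 _)

end IsTail

namespace IsStrongTail

variable {f : ℝ → ℝ}

lemma integral_neg_part_le (hf : IsTail f) (hf1 : ∀ x, f x ≤ 1) {t s K y : ℝ} (hs : s ≤ 0) :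
    ∫ u in s..0, f (max u t) * f (max K (y - u)) ≤ f t * -s * f y := by
  have h1 := intervalIntegral.integral_mono_on hs
    (hf.intervalIntegrable_mul (hf.comp_max t) hf1
      (measurable_const.max (measurable_const.sub measurable_id)) s 0 (k := fun u => max K (y - u)))
    (intervalIntegrable_const (c := f t * f y)) fun u hu =>
      mul_le_mul (hf.anti (le_max_right _ _))
        (hf.anti (le_max_of_le_right (by linarith [hu.2]))) (hf.nonneg _) (hf.nonneg _)
  rw [intervalIntegral.integral_const, smul_eq_mul] at h1
  linarith [show (0 - s) * (f t * f y) = f t * -s * f y by ring]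

/-- On `[s, 0]` the truncated factor is at most `f t` and the other at most `f y`; on `[0, y]` both
truncations only decrease the integrand of `conv`. -/
lemma exists_conv_le (hf : IsStrongTail f) :
    ∃ C, 0 ≤ C ∧ ∀ᶠ y in atTop, ∀ s ≤ 0, ∀ t K,
      ∫ u in s..y, f (max u t) * f (max K (y - u)) ≤ (f t * -s + C) * f y := by
  obtain ⟨C, hC⟩ := hf.conv
  refine ⟨max C 0, le_max_right _ _, ?_⟩
  filter_upwards [hC, eventually_ge_atTop 0] with y hy hy0 s hs t K
  have hi : ∀ a b, IntervalIntegrable (fun u => f (max u t) * f (max K (y - u))) volume a b :=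
    fun a b => hf.intervalIntegrable_mul (hf.comp_max t) hf.le_one (k := fun u => max K (y - u))
      (measurable_const.max (measurable_const.sub measurable_id)) a b
  rw [← intervalIntegral.integral_add_adjacent_intervals (hi s 0) (hi 0 y)]
  have h1 := integral_neg_part_le hf.toIsTail hf.le_one hs (t := t) (K := K) (y := y)
  have h2 : ∫ u in (0 : ℝ)..y, f (max u t) * f (max K (y - u)) ≤
      ∫ u in (0 : ℝ)..y, f u * f (y - u) :=
    intervalIntegral.integral_mono_on hy0 (hi 0 y)
      (hf.intervalIntegrable_mul hf.toIsTail hf.le_one (measurable_const.sub measurable_id) 0 y)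
      fun u _ => mul_le_mul (hf.anti (le_max_left _ _)) (hf.anti (le_max_right _ _))
        (hf.nonneg _) (hf.nonneg _)
  have h3 := mul_le_mul_of_nonneg_right (le_max_left C 0) (hf.nonneg y)
  linarith

/-- This is where strong subexponentiality enters the upper bound. If `y ≤ t`, the first factor is
at most `f t` and the second integrates to a small number. If `y ≥ t`, the interval is split at `0`,
`K` and `y - K`. The flat part on `[s, 0]` has mass at most `1 / κ` and yields the main term; the
pieces next to the end points `0` and `y` are small by shift insensitivity, and the central one by
`middle`. -/
lemma exists_gain_le (hf : IsStrongTail f) {κ θ : ℝ} (hκ : 0 < κ) (hθ : 0 < θ) :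
    ∃ K₀, ∀ K ≥ K₀, ∀ᶠ t in atTop, ∀ s ≤ 0, κ * tailInt (fun u => f (max u t)) s = 1 →
      ∀ y ≥ s, ∫ u in s..y, f (max u t) * f (max K (y - u)) ≤ f (max y t) * (1 / κ + θ) := by
  obtain ⟨K₁, hK₁⟩ := hf.middle (θ / 4) (by positivity)
  have hlim : Tendsto (fun K => K * f K + tailInt f K) atTop (𝓝 0) := by
    simpa using hf.tendsto_mul_self.add hf.tendsto_tailInt
  obtain ⟨K₂, hK₂⟩ := eventually_atTop.1 (hlim.eventually_le_const (show 0 < θ / 8 by positivity))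
  refine ⟨max (max K₁ K₂) 0, fun K hK => ?_⟩
  have hK0 : 0 ≤ K := (le_max_right _ _).trans hK
  have hKa := hK₁ K (((le_max_left _ _).trans (le_max_left _ _)).trans hK)
  have hKb := hK₂ K (((le_max_right _ _).trans (le_max_left _ _)).trans hK)
  have hKf : K * f K ≤ θ / 8 := by linarith [hf.tailInt_nonneg K]
  have hshift := hf.shift K 1 one_pos
  obtain ⟨t₀, ht₀⟩ := eventually_atTop.1 hshift
  have hKt : ∀ᶠ t in atTop, K * f t ≤ θ / 8 := by
    have : Tendsto (fun t => K * f t) atTop (𝓝 0) := by simpa using hf.tendsto_zero.const_mul K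
    exact this.eventually_le_const (by positivity)
  filter_upwards [hKt, eventually_ge_atTop t₀, eventually_ge_atTop (2 * K), eventually_ge_atTop 0]
    with t ht1 ht2 ht3 ht4 s hs hsκ y hy
  have hi : ∀ a b, IntervalIntegrable (fun u => f (max u t) * f (max K (y - u))) volume a b :=
    fun a b => hf.intervalIntegrable_mul (hf.comp_max t) hf.le_one (k := fun u => max K (y - u))
      (measurable_const.max (measurable_const.sub measurable_id)) a b
  rcases le_total y t with hyt | hyt
  · rw [max_eq_right hyt]
    have hanti : Antitone fun v => f (max K v) := fun v v' h => hf.anti (max_le_max_left _ h)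
    have hiv : ∀ a b, IntervalIntegrable (fun v => f (max K v)) volume a b := fun a b =>
      hanti.antitoneOn _ |>.intervalIntegrable
    have h1 : ∫ u in s..y, f (max u t) * f (max K (y - u)) ≤
        ∫ u in s..y, f t * f (max K (y - u)) := by
      refine intervalIntegral.integral_mono_on hy (hi s y) ?_ fun u hu =>
        mul_le_mul_of_nonneg_right (hf.anti (le_max_right _ _)) (hf.nonneg _)
      have hm : Monotone fun u => f (max K (y - u)) := fun v v' h => hanti (by linarith)
      exact (hm.monotoneOn _ |>.intervalIntegrable).const_mul _
    have h2 : ∫ u in s..y, f t * f (max K (y - u)) = f t * ∫ v in (0 : ℝ)..(y - s), f (max K v) := by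
      rw [intervalIntegral.integral_const_mul,
        intervalIntegral.integral_comp_sub_left (fun v => f (max K v)), sub_self]
    have h3 : ∫ v in (0 : ℝ)..(y - s), f (max K v) ≤ K * f K + tailInt f K := by
      have hG := hf.comp_max K
      have h4 := hG.tailInt_sub 0 (y - s)
      have h5 := hf.toIsTail.tailInt_comp_max_of_ge hK0
      have h6 := hG.tailInt_nonneg (y - s)
      have h7 : ∫ v in (0 : ℝ)..(y - s), f (max K v) = ∫ v in (0 : ℝ)..(y - s), f (max v K) := by
        simp_rw [max_comm]
      rw [h7]
      linarith [mul_comm K (f K), show f K * (K - 0) = f K * K by ring]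
    have h4 := mul_le_mul_of_nonneg_left (h3.trans hKb) (hf.nonneg t)
    have h5 : 0 < 1 / κ := by positivity
    nlinarith [hf.pos t]
  · rw [max_eq_left hyt]
    have hfy := hf.pos y
    have hyK : f (y - K) ≤ 2 * f y := by
      have := ht₀ y (ht2.trans hyt)
      linarith
    rw [← intervalIntegral.integral_add_adjacent_intervals (hi s 0) (hi 0 y),
      ← intervalIntegral.integral_add_adjacent_intervals (hi 0 K) (hi K y),
      ← intervalIntegral.integral_add_adjacent_intervals (hi K (y - K)) (hi (y - K) y)]
    have h1 := integral_neg_part_le hf.toIsTail hf.le_one hs (t := t) (K := K) (y := y)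
    have h1' : f t * -s ≤ 1 / κ := by
      rw [hf.tailInt_comp_max_of_ge (hs.trans ht4)] at hsκ
      rw [le_div_iff₀ hκ]
      have := hf.tailInt_nonneg t
      have := mul_nonneg (hf.nonneg t) ht4
      nlinarith
    have h2 : ∫ u in (0 : ℝ)..K, f (max u t) * f (max K (y - u)) ≤ K * (f t * (2 * f y)) := by
      have := intervalIntegral.integral_mono_on hK0 (hi 0 K)
        (intervalIntegrable_const (c := f t * (2 * f y))) fun u hu =>
          mul_le_mul (hf.anti (le_max_right u t))
            ((hf.anti (le_max_of_le_right (by linarith [hu.2]))).trans hyK) (hf.nonneg _) (hf.nonneg _)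
      refine this.trans_eq ?_
      rw [intervalIntegral.integral_const, smul_eq_mul]
      ring
    have h3 : ∫ u in K..(y - K), f (max u t) * f (max K (y - u)) ≤ θ / 4 * f y :=
      (intervalIntegral.integral_mono_on (by linarith) (hi K (y - K))
      (hf.intervalIntegrable_mul hf.toIsTail hf.le_one (measurable_const.sub measurable_id) _ _)
      fun u _ => mul_le_mul (hf.anti (le_max_left _ _)) (hf.anti (le_max_right _ _))
        (hf.nonneg _) (hf.nonneg _)).trans (hKa y (ht3.trans hyt))
    have h4 : ∫ u in (y - K)..y, f (max u t) * f (max K (y - u)) ≤ K * (2 * f y * f K) := by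
      have := intervalIntegral.integral_mono_on (by linarith) (hi (y - K) y)
        (intervalIntegrable_const (c := 2 * f y * f K)) fun u hu =>
          mul_le_mul ((hf.anti (le_max_of_le_left hu.1)).trans hyK)
            (hf.anti (le_max_left _ _)) (hf.nonneg _) (by positivity)
      refine this.trans_eq ?_
      rw [intervalIntegral.integral_const, smul_eq_mul]
      ring
    have h5 := mul_le_mul_of_nonneg_right h1' hfy.le
    have h6 := mul_le_mul_of_nonneg_right ht1 hfy.le
    have h7 := mul_le_mul_of_nonneg_right hKf hfy.le
    nlinarith

/-- Truncation at a large `t` makes shift insensitivity uniform over the whole line. -/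
lemma eventually_truncated_shift (hf : IsStrongTail f) {K ε : ℝ} (hK : 0 ≤ K) (hε : 0 < ε) :
    ∀ᶠ t in atTop, ∀ y, f (max (y - K) t) ≤ f (max y t) + ε * f (max y t) ∧
      f (max y t) - ε * f (max y t) ≤ f (max (y + K) t) := by
  obtain ⟨t₀, ht₀⟩ := eventually_atTop.1 (hf.shift K ε hε)
  filter_upwards [eventually_ge_atTop t₀] with t ht y
  have key : ∀ y, f (max (y - K) t) ≤ (1 + ε) * f (max y t) := fun y => by
    rcases le_total y t with h | h
    · rw [max_eq_right h, max_eq_right (by linarith)]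
      nlinarith [hf.nonneg t]
    · rw [max_eq_left h]
      exact (hf.anti (le_max_left _ _)).trans (ht₀ y (ht.trans h))
  constructor
  · linarith [key y]
  · have h1 := key (y + K)
    rw [add_sub_cancel_right] at h1
    have h2 : f (max (y + K) t) ≤ f (max y t) := hf.anti (max_le_max_right _ (by linarith))
    nlinarith

end IsStrongTail

/-! ### The Lyapunov function -/

/-- The Lyapunov function: `κ` times the integrated tail, with `f` truncated at its value at `t`
and the function frozen to the left of `s`. -/
noncomputable def lyapunov (f : ℝ → ℝ) (κ t s : ℝ) (y : ℝ) : ℝ :=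
  κ * tailInt (fun u => f (max u t)) (max y s)

section Lyapunov

variable {f : ℝ → ℝ} {κ t s : ℝ}

lemma lyapunov_anti (hf : IsTail f) (hκ : 0 ≤ κ) : Antitone (lyapunov f κ t s) := fun _ _ h =>
  mul_le_mul_of_nonneg_left ((hf.comp_max t).tailInt_anti (max_le_max_right _ h)) hκ

lemma lyapunov_nonneg (hf : IsTail f) (hκ : 0 ≤ κ) (y : ℝ) : 0 ≤ lyapunov f κ t s y :=
  mul_nonneg hκ ((hf.comp_max t).tailInt_nonneg _)

lemma lyapunov_le_one (hf : IsTail f) (hκ : 0 ≤ κ)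
    (hs : κ * tailInt (fun u => f (max u t)) s = 1) (y : ℝ) : lyapunov f κ t s y ≤ 1 :=
  hs ▸ mul_le_mul_of_nonneg_left ((hf.comp_max t).tailInt_anti (le_max_right _ _)) hκ

lemma lyapunov_of_le (hs : κ * tailInt (fun u => f (max u t)) s = 1) {y : ℝ} (hy : y ≤ s) :
    lyapunov f κ t s y = 1 := by
  rw [lyapunov, max_eq_right hy, hs]

lemma lyapunov_of_ge {y : ℝ} (hty : t ≤ y) (hsy : s ≤ y) :
    lyapunov f κ t s y = κ * tailInt f y := by
  rw [lyapunov, max_eq_left hsy, IsTail.tailInt_comp_max_of_le hty]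

lemma lyapunov_sub_le (hf : IsTail f) (hκ : 0 ≤ κ) {y η : ℝ} (hy : s ≤ y) :
    lyapunov f κ t s (y - η) - lyapunov f κ t s y ≤ κ * ∫ u in (y - η)..y, f (max u t) := by
  rw [lyapunov, lyapunov, max_eq_left hy, ← mul_sub, ← (hf.comp_max t).tailInt_sub]
  exact mul_le_mul_of_nonneg_left
    (sub_le_sub_right ((hf.comp_max t).tailInt_anti (le_max_left _ _)) _) hκ

lemma measurable_lyapunov (hf : IsTail f) (hκ : 0 ≤ κ) : Measurable (lyapunov f κ t s) :=
  (lyapunov_anti hf hκ).measurable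

end Lyapunov

/-- Upward jumps whose tail is dominated by `f` and a negative drift make the Lyapunov function
excessive, uniformly over the position `z` in the Huber function. -/
theorem IsStrongTail.exists_excessive {E : Type*} [MeasurableSpace E] {Q : Measure E}
    [IsProbabilityMeasure Q] {f : ℝ → ℝ} (hf : IsStrongTail f) {p ζ : E → ℝ} (hp : Measurable p)
    (hζm : Measurable ζ) (hle : ∀ᵐ w ∂Q, ζ w ≤ p w) (hζ : Integrable ζ Q) {b r κ : ℝ}
    (hb : ∫ w, ζ w ∂Q = -b) (hb0 : 0 < b) (hr : 0 ≤ r)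
    (htail : ∀ᶠ u in atTop, Q.real {w | u < p w} ≤ r * f u) (hκ : r < κ * b) (L₀ : ℝ) :
    ∃ L ≥ L₀, 0 < L ∧ ∃ t s C : ℝ, s ≤ 0 ∧ 0 ≤ t ∧ κ * tailInt (fun u => f (max u t)) s = 1 ∧
      ∀ y z, ∫ w, (if y + C < p w then 1 else
        lyapunov f κ t s (y - (huber L (z + (ζ w + b)) - huber L z - b))) ∂Q ≤
          lyapunov f κ t s y := by
  have hκ0 : 0 < κ := by
    by_contra h
    nlinarith
  -- Four error terms of size `θ` will weaken the drift, and the gain estimate contributes a further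
  -- `r * θ`. This value of `θ` uses up the slack `κ * b - r` exactly.
  set θ : ℝ := (κ * b - r) / (κ * (4 + r)) with hθdef
  have hθ : 0 < θ := div_pos (by linarith) (by positivity)
  have hθ' : κ * (b - 4 * θ - r * θ) = r := by
    rw [hθdef]; field_simp; ring
  have hci : Integrable (fun w => ζ w + b) Q := hζ.add (integrable_const _)
  have hcent : ∫ w, (ζ w + b) ∂Q = 0 := by
    rw [integral_add hζ (integrable_const _), hb]; simp
  obtain ⟨L, hL1, hL2, hL0⟩ := ((eventually_integral_huberErr_le hci hθ).and
    ((eventually_ge_atTop L₀).and (eventually_gt_atTop 0))).exists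
  -- domination of the modified increments
  let A : E → ℝ := fun w => |ζ w| + 2 * b
  have hA : Integrable A Q := hζ.abs.add (integrable_const _)
  have hAm : Measurable A := by simp only [A]; fun_prop
  have hA0 : ∀ w, 0 ≤ A w := fun w => by positivity
  obtain ⟨K₀, hK₀⟩ := hf.exists_gain_le hκ0 hθ
  have hlimA : ∀ᶠ K in atTop, ∫ w, max (A w - K) 0 ∂Q ≤ θ := by
    have : Tendsto (fun K => ∫ w, max (A w - K) 0 ∂Q) atTop (𝓝 (∫ _, (0 : ℝ) ∂Q)) := by
      refine tendsto_integral_filter_of_dominated_convergence A ?_ ?_ hA ?_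
      · exact Eventually.of_forall fun K =>
          ((hAm.sub_const K).max measurable_const).aestronglyMeasurable
      · filter_upwards [eventually_ge_atTop 0] with K hK
        refine Eventually.of_forall fun w => ?_
        rw [Real.norm_of_nonneg (le_max_right _ _)]
        exact max_le (by linarith) (hA0 w)
      · refine Eventually.of_forall fun w => tendsto_const_nhds.congr' ?_
        filter_upwards [eventually_ge_atTop (A w)] with K hK
        rw [max_eq_right (by linarith)]
    rw [integral_zero] at this
    exact this.eventually_le_const hθ
  have hlimp : ∀ᶠ K in atTop, ∫ w, (if K < p w then A w else 0) ∂Q ≤ θ := by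
    have : Tendsto (fun K => ∫ w, (if K < p w then A w else 0) ∂Q) atTop (𝓝 (∫ _, (0 : ℝ) ∂Q)) := by
      refine tendsto_integral_filter_of_dominated_convergence A ?_ ?_ hA ?_
      · exact Eventually.of_forall fun K =>
          (Measurable.ite (measurableSet_lt measurable_const hp) hAm
            measurable_const).aestronglyMeasurable
      · refine Eventually.of_forall fun K => Eventually.of_forall fun w => ?_
        split_ifs
        · rw [Real.norm_of_nonneg (hA0 w)]
        · simpa using hA0 w
      · refine Eventually.of_forall fun w => tendsto_const_nhds.congr' ?_
        filter_upwards [eventually_ge_atTop (p w)] with K hK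
        rw [if_neg (not_lt.2 hK)]
    rw [integral_zero] at this
    exact this.eventually_le_const hθ
  obtain ⟨U, hU⟩ := eventually_atTop.1 htail
  obtain ⟨K, hK1, hK2, hK3, hK4, hK5⟩ := (hlimA.and (hlimp.and ((eventually_ge_atTop K₀).and
    ((eventually_ge_atTop U).and (eventually_ge_atTop 0))))).exists
  have hEA : 0 ≤ ∫ w, A w ∂Q := integral_nonneg hA0
  -- The relative oscillation allowed over a distance `K`; multiplied by the mean of the dominating
  -- function `A` it stays below `θ`.
  set e : ℝ := θ / (∫ w, A w ∂Q + 1) with hedef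
  have he : 0 < e := by positivity
  have heA : e * ∫ w, A w ∂Q ≤ θ := by
    rw [hedef, div_mul_eq_mul_div, div_le_iff₀ (by linarith)]
    nlinarith
  obtain ⟨t, ht1, ht2, ht3, s, hs, hsκ⟩ := ((hK₀ K hK3).and
    ((hf.eventually_truncated_shift hK5 he).and ((eventually_ge_atTop 0).and
      (hf.toIsTail.eventually_exists_level hf.pos hκ0)))).exists
  have hLam := hf.comp_max t
  set V := lyapunov f κ t s with hV
  have hV0 : ∀ y, 0 ≤ V y := lyapunov_nonneg hf.toIsTail hκ0.le
  have hV1 : ∀ y, V y ≤ 1 := lyapunov_le_one hf.toIsTail hκ0.le hsκ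
  have hVm : Measurable V := measurable_lyapunov hf.toIsTail hκ0.le
  have hVa : Antitone V := lyapunov_anti hf.toIsTail hκ0.le
  -- With `C = K - s` and `y ≥ s`, a crossing `y + C < p w` forces both `K < p w` and `y - p w < s`.
  -- The frozen function already equals `1` there, so paying `1` for a crossing is consistent with
  -- the gain term.
  refine ⟨L, hL2, hL0, t, s, K - s, hs, ht3, hsκ, fun y z => ?_⟩
  set η : E → ℝ := fun w => huber L (z + (ζ w + b)) - huber L z - b with hη
  have hηm : Measurable η := by
    have := measurable_huber L
    simp only [hη]; fun_prop
  set I : E → ℝ := fun w => if y + (K - s) < p w then 1 else V (y - η w) with hI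
  have hIm : Measurable I :=
    Measurable.ite (measurableSet_lt measurable_const hp) measurable_const
      (hVm.comp (measurable_const.sub hηm))
  have hI1 : ∀ w, I w ≤ 1 := fun w => by
    simp only [hI]; split_ifs
    exacts [le_rfl, hV1 _]
  have hI0 : ∀ w, 0 ≤ I w := fun w => by
    simp only [hI]; split_ifs
    exacts [zero_le_one, hV0 _]
  have hIi : Integrable I Q := Integrable.of_bound hIm.aestronglyMeasurable 1
    (Eventually.of_forall fun w => by rw [Real.norm_of_nonneg (hI0 w)]; exact hI1 w)
  rcases le_total y s with hys | hys
  · rw [lyapunov_of_le hsκ hys]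
    calc ∫ w, I w ∂Q ≤ ∫ _, (1 : ℝ) ∂Q := integral_mono hIi (integrable_const _) hI1
      _ = 1 := by simp
  set ℓ : ℝ := f (max y t) with hℓ
  have hℓ0 : 0 < ℓ := hf.pos _
  let γ := huberSlope L z
  have hηle : ∀ w, η w ≤ -b + γ * (ζ w + b) + huberErr L (ζ w + b) := fun w => by
    have := huber_add_sub_le_add hL0 z (ζ w + b)
    simp only [hη, γ]; linarith
  have hηmax : ∀ w, η w ≤ max (ζ w + b) 0 - b := fun w => by
    have := huber_add_le hL0 z (ζ w + b)
    simp only [hη]; linarith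
  have hηabs : ∀ w, |η w| ≤ A w := fun w => by
    have h1 := huber_add_le hL0 z (ζ w + b)
    have h2 := huber_add_le hL0 (z + (ζ w + b)) (-(ζ w + b))
    rw [add_neg_cancel_right] at h2
    have h3 := abs_le.1 (le_refl |ζ w|)
    have h4 : max (ζ w + b) 0 ≤ |ζ w| + b := max_le (by linarith) (by positivity)
    have h5 : max (-(ζ w + b)) 0 ≤ |ζ w| + b := max_le (by linarith) (by positivity)
    simp only [A, hη]
    rw [abs_le]; constructor <;> linarith
  let g : E → ℝ := fun w => if K < p w then
    tailInt (fun u => f (max u t)) (max (y - p w) s) - tailInt (fun u => f (max u t)) y else 0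
  have hg := hf.toIsTail.integral_gain_le (Q := Q) hLam hp hys (r := r) (K := K)
    (fun u hu => hU u (hK4.trans hu))
  have hJ := ht1 s hs hsκ y hys
  have hVy : V y = κ * tailInt (fun u => f (max u t)) y := by rw [hV, lyapunov, max_eq_left hys]
  -- For `K < p w` the gain `g` alone suffices, and adding `A w` keeps the drift terms nonnegative.
  -- For `p w ≤ K` there is no crossing, and the first-order expansion over a range on which the
  -- truncated tail is nearly constant applies.
  have hpt : ∀ᵐ w ∂Q, I w ≤ V y + κ * ℓ * (-b + γ * (ζ w + b) + huberErr L (ζ w + b)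
      + (if K < p w then A w else 0) + e * A w + max (A w - K) 0) + κ * g w := by
    filter_upwards [hle] with w hw
    have hηp : η w ≤ max (p w) (-b) := by
      refine (hηmax w).trans ?_
      rcases le_total (ζ w + b) 0 with h | h
      · rw [max_eq_right h]; exact le_max_of_le_right (by linarith)
      · rw [max_eq_left h]; exact le_max_of_le_left (by linarith)
    have hA' := hA0 w
    have hmx : 0 ≤ max (A w - K) 0 := le_max_right _ _
    by_cases hpK : K < p w
    · have h1 : I w ≤ κ * tailInt (fun u => f (max u t)) (max (y - p w) s) := by
        simp only [hI]
        split_ifs with hc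
        · rw [max_eq_right (by linarith), hsκ]
        · refine (hVa (show y - p w ≤ y - η w from ?_)).trans_eq ?_
          · have : max (p w) (-b) = p w := max_eq_left (by linarith)
            linarith
          · rfl
      have h2 : 0 ≤ -b + γ * (ζ w + b) + huberErr L (ζ w + b) + A w := by
        have := hηle w
        have := (abs_le.1 (hηabs w)).1
        linarith
      have h3 : 0 ≤ κ * ℓ * (-b + γ * (ζ w + b) + huberErr L (ζ w + b)
          + A w + e * A w + max (A w - K) 0) := by
        have : 0 ≤ e * A w := by positivity
        refine mul_nonneg (by positivity) (by linarith)
      simp only [g, if_pos hpK]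
      rw [hVy]
      linarith
    · have hpK' := not_lt.1 hpK
      have h1 : I w = V (y - η w) := by
        simp only [hI]
        rw [if_neg (by linarith)]
      have h2 := lyapunov_sub_le hf.toIsTail hκ0.le (t := t) (η := η w) hys
      have h3 := hLam.integral_sub_le (y := y) (η := η w) (K := K) (e := e * ℓ) (by positivity) hK5
        (hηp.trans (max_le hpK' (by linarith))) (ht2 y).1 (ht2 y).2
      have h4 : ℓ * η w + e * ℓ * |η w| + ℓ * max (|η w| - K) 0 ≤
          ℓ * (-b + γ * (ζ w + b) + huberErr L (ζ w + b) + e * A w + max (A w - K) 0) := by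
        have a1 := mul_le_mul_of_nonneg_left (hηle w) hℓ0.le
        have a2 := mul_le_mul_of_nonneg_left (hηabs w) (by positivity : 0 ≤ e * ℓ)
        have a3 := mul_le_mul_of_nonneg_left
          (max_le_max_right 0 (sub_le_sub_right (hηabs w) K)) hℓ0.le
        linarith
      have h5 := mul_le_mul_of_nonneg_left (h3.trans h4) hκ0.le
      simp only [g, if_neg hpK]
      rw [h1]
      simp only [hV]
      linarith
  have i1 : Integrable (fun w => γ * (ζ w + b)) Q := hci.const_mul _
  have i2 : Integrable (fun w => huberErr L (ζ w + b)) Q := integrable_huberErr hci hL0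
  have i3 : Integrable (fun w => if K < p w then A w else 0) Q := by
    refine hA.mono' (Measurable.ite (measurableSet_lt measurable_const hp) hAm
            measurable_const).aestronglyMeasurable (Eventually.of_forall fun w => ?_)
    split_ifs
    · rw [Real.norm_of_nonneg (hA0 w)]
    · simpa using hA0 w
  have i4 : Integrable (fun w => max (A w - K) 0) Q := (hA.sub (integrable_const _)).pos_part
  have i5 : Integrable g Q := by
    have hm := hLam.measurable_tailInt
    refine Integrable.of_bound (Measurable.ite (measurableSet_lt measurable_const hp) ?_
      measurable_const).aestronglyMeasurable (tailInt (fun u => f (max u t)) s)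
      (Eventually.of_forall fun w => ?_)
    · fun_prop
    · have h0 := hLam.tailInt_nonneg s
      have h1 := hLam.tailInt_anti (le_max_right (y - p w) s)
      have h2 := hLam.tailInt_nonneg y
      have h3 := hLam.tailInt_anti hys
      have h4 := hLam.tailInt_nonneg (max (y - p w) s)
      simp only [g]
      split_ifs
      · rw [Real.norm_eq_abs, abs_le]; constructor <;> linarith
      · simpa using h0
  have i0 : Integrable (fun _ : E => -b) Q := integrable_const _
  have j1 : Integrable (fun w => -b + γ * (ζ w + b)) Q := i0.add i1
  have j2 : Integrable (fun w => -b + γ * (ζ w + b) + huberErr L (ζ w + b)) Q := j1.add i2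
  have j3 : Integrable (fun w => -b + γ * (ζ w + b) + huberErr L (ζ w + b)
      + (if K < p w then A w else 0)) Q := j2.add i3
  have j4 : Integrable (fun w => -b + γ * (ζ w + b) + huberErr L (ζ w + b)
      + (if K < p w then A w else 0) + e * A w) Q := j3.add (hA.const_mul e)
  have j5 : Integrable (fun w => -b + γ * (ζ w + b) + huberErr L (ζ w + b)
      + (if K < p w then A w else 0) + e * A w + max (A w - K) 0) Q := j4.add i4
  have j6 : Integrable (fun w => κ * ℓ * (-b + γ * (ζ w + b) + huberErr L (ζ w + b)
      + (if K < p w then A w else 0) + e * A w + max (A w - K) 0)) Q := j5.const_mul _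
  have i7 : Integrable (fun _ : E => V y) Q := integrable_const _
  have j7 : Integrable (fun w => V y + κ * ℓ * (-b + γ * (ζ w + b) + huberErr L (ζ w + b)
      + (if K < p w then A w else 0) + e * A w + max (A w - K) 0)) Q := i7.add j6
  have j8 : Integrable (fun w => κ * g w) Q := i5.const_mul κ
  have hbound := integral_mono_ae hIi (j7.add j8) hpt
  refine hbound.trans ?_
  have hadd : ∫ w, (V y + κ * ℓ * (-b + γ * (ζ w + b) + huberErr L (ζ w + b)
      + (if K < p w then A w else 0) + e * A w + max (A w - K) 0) + κ * g w) ∂Q =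
      V y + κ * ℓ * (-b + γ * 0 + ∫ w, huberErr L (ζ w + b) ∂Q +
        ∫ w, (if K < p w then A w else 0) ∂Q + e * ∫ w, A w ∂Q + ∫ w, max (A w - K) 0 ∂Q) +
        κ * ∫ w, g w ∂Q := by
    rw [integral_add j7 j8, integral_add i7 j6, integral_const_mul, integral_const_mul,
      integral_add j4 i4, integral_add j3 (hA.const_mul e), integral_add j2 i3,
      integral_add j1 i2, integral_add i0 i1, integral_const_mul, integral_const_mul, hcent]
    simp
  refine (le_of_eq hadd).trans ?_
  have h1 : -b + γ * 0 + ∫ w, huberErr L (ζ w + b) ∂Q +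
        ∫ w, (if K < p w then A w else 0) ∂Q + e * ∫ w, A w ∂Q + ∫ w, max (A w - K) 0 ∂Q ≤
        -b + 4 * θ := by linarith
  have h2 := mul_le_mul_of_nonneg_left h1 (by positivity : 0 ≤ κ * ℓ)
  have h3 : κ * ∫ w, g w ∂Q ≤ κ * (r * (ℓ * (1 / κ + θ))) :=
    mul_le_mul_of_nonneg_left (hg.trans (mul_le_mul_of_nonneg_left hJ hr)) hκ0.le
  have h4 : κ * (r * (ℓ * (1 / κ + θ))) = ℓ * (r + κ * r * θ) := by field_simp
  -- Drift and gain balance: the right side vanishes by the choice of `θ`.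
  have h5 : κ * ℓ * (-b + 4 * θ) + ℓ * (r + κ * r * θ) = ℓ * (r - κ * (b - 4 * θ - r * θ)) := by
    ring
  rw [hθ', sub_self, mul_zero] at h5
  linarith

/-- The expected increase of the Lyapunov function under a displacement whose tail is negligible
with respect to `f`. -/
theorem IsStrongTail.eventually_lyapunov_init_le {Ω : Type*} [MeasurableSpace Ω] {μ : Measure Ω}
    [IsProbabilityMeasure μ] {f : ℝ → ℝ} (hf : IsStrongTail f) {W : Ω → ℝ} (hW : Measurable W)
    (hWi : Integrable W μ) (htail : ∀ δ > 0, ∀ᶠ u in atTop, μ.real {ω | u < W ω} ≤ δ * f u)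
    {κ t s L ε : ℝ} (hκ : 0 < κ) (hs : s ≤ 0)
    (hL : 0 < L) (hε : 0 < ε) (herr : κ * ∫ ω, huberErr L (W ω) ∂μ ≤ ε / 4) :
    ∀ᶠ x in atTop, ∀ B : Set Ω, MeasurableSet B →
      ∫ ω in B, (lyapunov f κ t s (x - huber L (W ω)) - lyapunov f κ t s x) ∂μ ≤ ε * f x := by
  obtain ⟨C', hC0', hC⟩ := hf.exists_conv_le
  set C : ℝ := f t * -s + C' with hCdef
  have hC0 : 0 ≤ C := add_nonneg (mul_nonneg (hf.nonneg _) (by linarith)) hC0'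
  -- Large displacements then cost at most `ε / 2 * f x`. Moderate ones take the other half, since
  -- the factor `2` below turns the bound `ε / 4` on the Huber error into `ε / 2`.
  set δ : ℝ := ε / (2 * (κ * (C + 1))) with hδdef
  have hδ : 0 < δ := by positivity
  obtain ⟨U, hU⟩ := eventually_atTop.1 (htail δ hδ)
  set K : ℝ := max U 0 with hK
  have hK0 : 0 ≤ K := le_max_right _ _
  have hVm : Measurable (lyapunov f κ t s) := measurable_lyapunov hf.toIsTail hκ.le
  have hVa : Antitone (lyapunov f κ t s) := lyapunov_anti hf.toIsTail hκ.le
  have hLam := hf.comp_max t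
  filter_upwards [hC, hf.shift K 1 one_pos, eventually_ge_atTop 0,
    eventually_ge_atTop (t + K)] with x hx1' hx2 hx3 hx4 B hB
  have hx1 := hx1' s hs t K
  have hsx : s ≤ x := hs.trans hx3
  let g : Ω → ℝ := fun w => if K < W w then
    tailInt (fun u => f (max u t)) (max (x - W w) s) - tailInt (fun u => f (max u t)) x else 0
  have hg := hf.toIsTail.integral_gain_le (Q := μ) hLam hW hsx (r := δ) (K := K)
    (fun u hu => hU u ((le_max_left _ _).trans hu))
  have hg0 : ∀ w, 0 ≤ g w := fun w => by
    simp only [g]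
    split_ifs with h
    · exact sub_nonneg.2 (hLam.tailInt_anti (max_le (by linarith) hsx))
    · exact le_rfl
  have hgi : Integrable g μ := by
    have hm := hLam.measurable_tailInt
    refine Integrable.of_bound (Measurable.ite (measurableSet_lt measurable_const hW) ?_
      measurable_const).aestronglyMeasurable (tailInt (fun u => f (max u t)) s)
      (Eventually.of_forall fun w => ?_)
    · fun_prop
    · rw [Real.norm_of_nonneg (hg0 w)]
      have h0 := hLam.tailInt_nonneg s
      have h1 := hLam.tailInt_anti (le_max_right (x - W w) s)
      have h2 := hLam.tailInt_nonneg x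
      simp only [g]
      split_ifs <;> linarith
  have hei : Integrable (fun ω => huberErr L (W ω)) μ := integrable_huberErr hWi hL
  -- A displacement beyond `K` is charged to the gain `g`. Up to `K` the tail at most doubles along
  -- the way, and the displacement itself is bounded by the Huber error.
  have hpt : ∀ ω, lyapunov f κ t s (x - huber L (W ω)) - lyapunov f κ t s x ≤
      κ * (2 * f x) * huberErr L (W ω) + κ * g ω := fun ω => by
    have h0 := huber_nonneg hL (W ω)
    have h1 := huber_le_huberErr hL (W ω)
    have h2 := huberErr_nonneg hL (W ω)
    by_cases h : K < W ω
    · have h3 : huber L (W ω) ≤ W ω := by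
        have := huber_add_le hL 0 (W ω)
        rw [zero_add, huber_of_nonpos hL le_rfl, max_eq_left (by linarith)] at this
        linarith
      have h4 : lyapunov f κ t s (x - huber L (W ω)) ≤ lyapunov f κ t s (x - W ω) :=
        hVa (by linarith)
      have h5 : 0 ≤ κ * (2 * f x) * huberErr L (W ω) :=
        mul_nonneg (mul_nonneg hκ.le (by linarith [hf.pos x])) h2
      simp only [g, if_pos h]
      unfold lyapunov at *
      rw [max_eq_left hsx] at *
      linarith
    · have h' := not_lt.1 h
      simp only [g, if_neg h]
      have h3 := lyapunov_sub_le hf.toIsTail hκ.le (t := t) (η := huber L (W ω)) hsx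
      have h4 := hLam.integral_le_mul (show x - huber L (W ω) ≤ x by linarith)
      have h5 : huber L (W ω) ≤ K := by
        have := huber_add_le hL 0 (W ω)
        rw [zero_add, huber_of_nonpos hL le_rfl] at this
        exact this.trans (by rw [zero_add]; exact max_le h' hK0)
      have h6 : f (max (x - huber L (W ω)) t) ≤ 2 * f x := by
        have : f (max (x - huber L (W ω)) t) ≤ f (x - K) :=
          hf.anti (le_max_of_le_left (by linarith))
        linarith
      have h7 : f (max (x - huber L (W ω)) t) * (x - (x - huber L (W ω))) ≤
          2 * f x * huberErr L (W ω) := by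
        rw [sub_sub_cancel]
        exact mul_le_mul h6 h1 h0 (by linarith [hf.pos x])
      have h8 := mul_le_mul_of_nonneg_left (h4.trans h7) hκ.le
      linarith
  have hb1 : Integrable (fun ω => κ * (2 * f x) * huberErr L (W ω) + κ * g ω) μ :=
    (hei.const_mul _).add (hgi.const_mul _)
  have h1 : ∫ ω in B, (lyapunov f κ t s (x - huber L (W ω)) - lyapunov f κ t s x) ∂μ ≤
      ∫ ω, (κ * (2 * f x) * huberErr L (W ω) + κ * g ω) ∂μ := by
    refine (integral_mono_of_nonneg ?_ hb1.integrableOn (Eventually.of_forall hpt)).trans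
      (setIntegral_le_integral hb1 (Eventually.of_forall fun ω => ?_))
    · exact Eventually.of_forall fun ω => sub_nonneg.2 (hVa (by linarith [huber_nonneg hL (W ω)]))
    · exact add_nonneg (mul_nonneg (mul_nonneg hκ.le (by linarith [hf.pos x]))
        (huberErr_nonneg hL _)) (mul_nonneg hκ.le (hg0 ω))
  rw [integral_add (hei.const_mul _) (hgi.const_mul _), integral_const_mul, integral_const_mul] at h1
  have h2 : κ * ∫ ω, g ω ∂μ ≤ κ * (δ * (C * f x)) :=
    mul_le_mul_of_nonneg_left (hg.trans (mul_le_mul_of_nonneg_left hx1 hδ.le)) hκ.le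
  have h3 : κ * (δ * (C * f x)) ≤ ε / 2 * f x := by
    have : κ * δ * (C + 1) = ε / 2 := by rw [hδdef]; field_simp
    have h4 : 0 ≤ κ * δ * f x := mul_nonneg (by positivity) (hf.nonneg x)
    rw [show κ * (δ * (C * f x)) = κ * δ * (C + 1) * f x - κ * δ * f x by ring, this]
    linarith
  have h4 : κ * (2 * f x) * ∫ ω, huberErr L (W ω) ∂μ ≤ ε / 2 * f x := by
    have := mul_le_mul_of_nonneg_right herr (hf.nonneg x)
    nlinarith
  linarith

/-- Upper bound for the crossing probabilities along a chain. -/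
theorem IsIncrementChain.crossing_le {Ω E : Type*} [MeasurableSpace Ω] [MeasurableSpace E]
    {μ : Measure Ω} [IsProbabilityMeasure μ] {S : ℕ → Ω → ℝ} {W : ℕ → Ω → E} {B : ℕ → Set Ω}
    {Q : Measure E} [IsProbabilityMeasure Q] {ζ p : E → ℝ} (hC : IsIncrementChain μ S W B Q ζ)
    (hp : Measurable p) {f : ℝ → ℝ} (hf : IsTail f) {κ t s b L C x : ℝ} (hκ : 0 ≤ κ) (hL : 0 < L)
    (hb : 0 ≤ b) (hsκ : κ * tailInt (fun u => f (max u t)) s = 1)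
    (hexc : ∀ y z, ∫ w, (if y + C < p w then 1 else
        lyapunov f κ t s (y - (huber L (z + (ζ w + b)) - huber L z - b))) ∂Q ≤ lyapunov f κ t s y)
    (hcross : ∀ n, ∀ᵐ ω ∂μ, ω ∈ B (n + 1) → S n ω + p (W n ω) ≤ x + L / 2 + C)
    (htx : t ≤ x) (hsx : s ≤ x) (m : ℕ) :
    (1 - κ * tailInt f x) *
        ∑ n ∈ Finset.range m, μ.real (B n ∩ {ω | x + L / 2 + C < S n ω + p (W n ω)}) ≤
      ∫ ω in B 0, (lyapunov f κ t s (x - huber L (S 0 ω)) - lyapunov f κ t s x) ∂μ +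
        κ * ∑ n ∈ Finset.range m, μ.real (B n) * ∫ u in (x + b * n)..(x + b * (n + 1)), f u := by
  set V := lyapunov f κ t s with hV
  have hV0 : ∀ y, 0 ≤ V y := lyapunov_nonneg hf hκ
  have hV1 : ∀ y, V y ≤ 1 := lyapunov_le_one hf hκ hsκ
  have hVm : Measurable V := measurable_lyapunov hf hκ
  have hVa : Antitone V := lyapunov_anti hf hκ
  have hζm := hC.measurable_incr
  have hgm := measurable_huber L
  have hbn : ∀ n : ℕ, 0 ≤ b * n := fun n => by positivity
  have hVx : ∀ n : ℕ, V (x + b * n) = κ * tailInt f (x + b * n) := fun n =>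
    lyapunov_of_ge (by linarith [hbn n]) (by linarith [hbn n])
  -- The distance to the level from a smoothed maximum of the state and `-b n`. It is at most `x + b
  -- n` and at most `x + L / 2 - z`.
  let y : ℕ → ℝ → ℝ := fun n z => x - (huber L (z + b * n) - b * n)
  have hym : ∀ n, Measurable (y n) := fun n => by simp only [y]; fun_prop
  have hyle : ∀ n z, y n z ≤ x + b * n := fun n z => by
    have := huber_nonneg hL (z + b * n)
    simp only [y]; linarith
  have hyle' : ∀ n z, y n z ≤ x + L / 2 - z := fun n z => by
    have := sub_le_huber hL (z + b * n)
    simp only [y]; linarith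
  let D : ℕ → ℝ → E → ℝ := fun n z w => if y n z + C < p w then 1 else
    V (y n z - (huber L (z + b * n + (ζ w + b)) - huber L (z + b * n) - b))
  have hDm : ∀ n, Measurable (Function.uncurry (D n)) := fun n => by
    have h1 := hym n
    refine Measurable.ite (measurableSet_lt ((h1.comp measurable_fst).add_const _)
      (hp.comp measurable_snd)) measurable_const ?_
    refine hVm.comp ?_
    fun_prop
  have hD0 : ∀ n z w, 0 ≤ D n z w := fun n z w => by
    simp only [D]; split_ifs
    exacts [zero_le_one, hV0 _]
  have hD1 : ∀ n z w, D n z w ≤ 1 := fun n z w => by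
    simp only [D]; split_ifs
    exacts [le_rfl, hV1 _]
  -- Without crossing this is an equality, the increment of `y` being exactly the modified increment
  -- of the excessivity hypothesis.
  have hDV : ∀ n z w, V (y (n + 1) (z + ζ w)) ≤ D n z w := fun n z w => by
    simp only [D]; split_ifs
    · exact hV1 _
    · refine le_of_eq (congrArg V ?_)
      simp only [y]
      rw [show z + ζ w + b * ((n + 1 : ℕ) : ℝ) = z + b * n + (ζ w + b) by push_cast; ring]
      push_cast
      ring
  have hint : ∀ n k (A : Set Ω), IntegrableOn (fun ω => V (y n (S k ω)) - V (x + b * n)) A μ :=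
    fun n k A => Integrable.of_bound
      ((hVm.comp ((hym n).comp (hC.measurable_state k))).sub_const _).aestronglyMeasurable 1
      (Eventually.of_forall fun ω => by
        rw [Real.norm_eq_abs, abs_le]
        constructor <;>
          linarith [hV0 (y n (S k ω)), hV1 (y n (S k ω)), hV0 (x + b * n), hV1 (x + b * n)])
  have hDi : ∀ n (A : Set Ω), IntegrableOn (fun ω => D n (S n ω) (W n ω)) A μ := fun n A =>
    Integrable.of_bound (((hDm n).comp ((hC.measurable_state n).prodMk
      (hC.measurable_mark n))).aestronglyMeasurable) 1 (Eventually.of_forall fun ω => by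
        rw [Real.norm_of_nonneg (hD0 _ _ _)]; exact hD1 _ _ _)
  let X : ℕ → Set Ω := fun n => {ω | x + L / 2 + C < S n ω + p (W n ω)}
  have hXm : ∀ n, MeasurableSet (X n) := fun n => measurableSet_lt measurable_const
    ((hC.measurable_state n).add (hp.comp (hC.measurable_mark n)))
  -- Subtracting the value on the line `x + b n` makes the potential nonnegative, so paths that
  -- leave the events can be dropped. The decrease of the subtracted value from step to step
  -- produces the tail integrals, weighted by the measure of `B n`.
  let h : ℕ → ℝ := fun n => ∫ ω in B n, (V (y n (S n ω)) - V (x + b * n)) ∂μ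
  have hstep : ∀ n, (1 - V x) * μ.real (B n ∩ X n) + h (n + 1) ≤
      h n + κ * (μ.real (B n) * ∫ u in (x + b * n)..(x + b * (n + 1)), f u) := by
    intro n
    set v : ℝ := V (x + b * ((n + 1 : ℕ) : ℝ)) with hv
    have hvx : v ≤ V x := hVa (by linarith [hbn (n + 1)])
    have hmeas := (hC.measurableSet n).inter (hXm n)
    have h1 : (1 - v) * μ.real (B n ∩ X n) + h (n + 1) ≤
        ∫ ω in B n, (D n (S n ω) (W n ω) - v) ∂μ := by
      have e1 : (1 - v) * μ.real (B n ∩ X n) =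
          ∫ ω in B n, (X n).indicator (fun _ => 1 - v) ω ∂μ := by
        rw [setIntegral_indicator (hXm n), setIntegral_const, smul_eq_mul, mul_comm]
      have e2 : h (n + 1) = ∫ ω in B n, (B (n + 1)).indicator
          (fun ω => V (y (n + 1) (S (n + 1) ω)) - v) ω ∂μ := by
        rw [setIntegral_indicator (hC.measurableSet _), Set.inter_eq_right.2 (hC.anti n)]
      have a1 : IntegrableOn ((X n).indicator (fun _ => 1 - v)) (B n) μ :=
        (integrable_const _).indicator (hXm n)
      have a2 : IntegrableOn ((B (n + 1)).indicator
          (fun ω => V (y (n + 1) (S (n + 1) ω)) - v)) (B n) μ :=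
        Integrable.indicator (hint (n + 1) (n + 1) (B n)) (hC.measurableSet _)
      rw [e1, e2, ← integral_add a1 a2]
      refine setIntegral_mono_ae_restrict (a1.add a2) ((hDi n _).sub (integrable_const _)) ?_
      rw [EventuallyLE, ae_restrict_iff' (hC.measurableSet n)]
      filter_upwards [hC.step n, hcross n] with ω hω hω' hB
      have hle : D n (S n ω) (W n ω) ≥ v := by
        refine le_trans (hVa ?_) (hDV n (S n ω) (W n ω))
        exact hyle _ _
      -- A crossing excludes `B (n + 1)` and makes the paid value equal to `1`, hence it contributes
      -- `1 - v`. In the other cases the next potential, or zero, is dominated.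
      by_cases hx : ω ∈ X n
      · have hnB : ω ∉ B (n + 1) := fun hB' => not_lt.2 (hω' hB') hx
        rw [Set.indicator_of_mem hx, Set.indicator_of_notMem hnB]
        have : D n (S n ω) (W n ω) = 1 := by
          simp only [D]
          rw [if_pos]
          have h2 := hyle' n (S n ω)
          have h3 : x + L / 2 + C < S n ω + p (W n ω) := hx
          linarith
        rw [this]; linarith
      · rw [Set.indicator_of_notMem hx]
        by_cases hB' : ω ∈ B (n + 1)
        · rw [Set.indicator_of_mem hB', hω hB]
          linarith [hDV n (S n ω) (W n ω)]
        · rw [Set.indicator_of_notMem hB']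
          linarith
    have h2 : ∫ ω in B n, D n (S n ω) (W n ω) ∂μ ≤ ∫ ω in B n, V (y n (S n ω)) ∂μ :=
      hC.setIntegral_le_of_forall n (φ := fun z => V (y n z)) (hDm n) (M := 1)
        (fun z w => by rw [abs_of_nonneg (hD0 _ _ _)]; exact hD1 _ _ _)
        (hVm.comp (hym n)) (fun z => by rw [abs_of_nonneg (hV0 _)]; exact hV1 _)
        (fun z => hexc (y n z) (z + b * n))
    have h3 : ∫ ω in B n, (D n (S n ω) (W n ω) - v) ∂μ =
        ∫ ω in B n, D n (S n ω) (W n ω) ∂μ - μ.real (B n) * v := by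
      rw [integral_sub (hDi n _) (integrable_const _), setIntegral_const, smul_eq_mul]
    have h4 : h n = ∫ ω in B n, V (y n (S n ω)) ∂μ - μ.real (B n) * V (x + b * n) := by
      have : IntegrableOn (fun ω => V (y n (S n ω))) (B n) μ := Integrable.of_bound
        (hVm.comp ((hym n).comp (hC.measurable_state n))).aestronglyMeasurable 1
        (Eventually.of_forall fun ω => by
          rw [Real.norm_of_nonneg (hV0 _)]; exact hV1 _)
      simp only [h]
      rw [integral_sub this (integrable_const _), setIntegral_const, smul_eq_mul]
    have h5 : V (x + b * n) - v = κ * ∫ u in (x + b * n)..(x + b * (n + 1)), f u := by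
      rw [hv, hVx, hVx, ← mul_sub, hf.tailInt_sub]
      push_cast
      rfl
    have h6 : μ.real (B n) * (V (x + b * n) - v) =
        κ * (μ.real (B n) * ∫ u in (x + b * n)..(x + b * (n + 1)), f u) := by
      rw [h5]; ring
    have h7 := mul_le_mul_of_nonneg_right (sub_le_sub_left hvx 1)
      (measureReal_nonneg (μ := μ) (s := B n ∩ X n))
    linarith
  have htel : ∀ m, (1 - V x) * ∑ n ∈ Finset.range m, μ.real (B n ∩ X n) + h m ≤ h 0 +
      κ * ∑ n ∈ Finset.range m, μ.real (B n) * ∫ u in (x + b * n)..(x + b * (n + 1)), f u := by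
    intro m
    induction m with
    | zero => simp
    | succ k ih =>
      rw [Finset.sum_range_succ, Finset.sum_range_succ, mul_add, mul_add]
      linarith [hstep k]
  have hm0 : 0 ≤ h m := integral_nonneg fun ω => sub_nonneg.2 (hVa (hyle _ _))
  have h00 : h 0 = ∫ ω in B 0, (V (x - huber L (S 0 ω)) - V x) ∂μ := by
    simp [h, y]
  have hVx0 : V x = κ * tailInt f x := lyapunov_of_ge htx hsx
  rw [← hVx0, ← h00]
  linarith [htel m]

/-! ### Long-tailed and strong subexponential distributions -/

/-- The unit shift is iterated, and monotonicity reduces a real shift to a larger integer one. -/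
lemma IsLongTailed.eventually_shift_le {F : Measure ℝ} [IsProbabilityMeasure F]
    (hF : IsLongTailed F) (C : ℝ) {ε : ℝ} (hε : 0 < ε) :
    ∀ᶠ y in atTop, distTail F (y - C) ≤ (1 + ε) * distTail F y := by
  obtain ⟨hpos, hlim⟩ := hF
  have hanti : Antitone (distTail F) := fun x y h => measureReal_mono (Set.Ioi_subset_Ioi h)
  have h1 : ∀ n : ℕ, Tendsto (fun x => distTail F (x - n) / distTail F x) atTop (𝓝 1) := by
    intro n
    induction n with
    | zero => simp [div_self (hpos _).ne']
    | succ n ih =>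
      have h2 := (hlim.comp (tendsto_atTop_add_const_right atTop (-((n : ℝ) + 1)) tendsto_id)).inv₀
        one_ne_zero
      rw [inv_one] at h2
      have h3 := h2.mul ih
      rw [one_mul] at h3
      refine h3.congr fun x => ?_
      have h4 := (hpos (x - n)).ne'
      have h5 := (hpos x).ne'
      simp only [Function.comp, id]
      rw [show x + -((n : ℝ) + 1) + 1 = x - n by ring,
        show x + -((n : ℝ) + 1) = x - ((n + 1 : ℕ) : ℝ) by push_cast; ring]
      field_simp
  obtain ⟨n, hn⟩ := exists_nat_ge C
  filter_upwards [(h1 n).eventually_le_const (show (1 : ℝ) < 1 + ε by linarith)] with y hy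
  rw [div_le_iff₀ (hpos y)] at hy
  exact (hanti (by linarith)).trans hy

lemma IsTail.mul_integral_le_integral_mul {f : ℝ → ℝ} (hf : IsTail f) (hf1 : ∀ x, f x ≤ 1)
    {a b x : ℝ} (hab : a ≤ b) :
    f (x - a) * ∫ u in a..b, f u ≤ ∫ u in a..b, f u * f (x - u) := by
  rw [← intervalIntegral.integral_const_mul]
  refine intervalIntegral.integral_mono_on hab ((hf.intervalIntegrable a b).const_mul _)
    (hf.intervalIntegrable_mul hf hf1 (measurable_const.sub measurable_id) a b) fun u hu => ?_
  rw [mul_comm]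
  exact mul_le_mul_of_nonneg_left (hf.anti (by linarith [hu.1])) (hf.nonneg _)

lemma integral_mul_comp_sub_symm (f : ℝ → ℝ) (a b x : ℝ) :
    ∫ u in a..b, f u * f (x - u) = ∫ u in (x - b)..(x - a), f u * f (x - u) := by
  rw [← intervalIntegral.integral_comp_sub_left (fun u => f u * f (x - u)) x]
  refine intervalIntegral.integral_congr fun u _ => ?_
  simp only [sub_sub_cancel]
  ring

/-- The distribution tail of a strong subexponential distribution. -/
theorem IsStrongSubexponential.isStrongTail {F : Measure ℝ} [IsProbabilityMeasure F]
    (hF : IsStrongSubexponential F) : IsStrongTail (distTail F) := by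
  obtain ⟨hint, hpos, hlim⟩ := hF
  have hf := isTail_distTail hint
  set f := distTail F
  have hf1 : ∀ x, f x ≤ 1 := fun x => measureReal_le_one
  have hi : ∀ x a b, IntervalIntegrable (fun u => f u * f (x - u)) volume a b := fun x a b =>
    hf.intervalIntegrable_mul hf hf1 (measurable_const.sub measurable_id) a b
  have htpos : ∀ x, 0 < tailInt f x := fun x => by
    have h1 := hf.tailInt_sub x (x + 1)
    have h2 := hf.mul_le_integral (show x ≤ x + 1 by linarith)
    have h3 := hf.tailInt_nonneg (x + 1)
    linarith [hpos (x + 1)]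
  set m := tailInt f 0 with hm
  have hm0 : 0 < m := htpos 0
  let I : ℝ → ℝ := fun x => ∫ u in (0 : ℝ)..x, f u * f (x - u)
  have hI : Tendsto (fun x => I x / f x) atTop (𝓝 (2 * m)) := by
    have h1 := hlim.const_mul (2 * m)
    rw [mul_one] at h1
    refine h1.congr fun x => ?_
    have h2 : ∫ y in (0 : ℝ)..x, f (x - y) * f y = I x := by
      simp only [I]; simp_rw [mul_comm]
    have h3 := (hpos x).ne'
    rw [h2]
    change 2 * m * (I x / (2 * m * f x)) = _
    field_simp
  have hshift0 : ∀ v ≥ 0, ∀ ε > 0, ∀ᶠ y in atTop, f (y - v) ≤ (1 + ε) * f y := by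
    intro v hv ε hε
    have ht2 : Tendsto (fun x : ℝ => tailInt f (x / 2)) atTop (𝓝 0) :=
      hf.tendsto_tailInt.comp (tendsto_id.atTop_div_const (zero_lt_two' ℝ))
    have h1 : Tendsto (fun x => I x / f x / 2 - m + tailInt f (x / 2)) atTop (𝓝 0) := by
      have := ((hI.div_const 2).sub_const m).add ht2
      simpa using this
    have hv2 := htpos v
    filter_upwards [h1.eventually_le_const (show 0 < ε * (tailInt f v / 2) by positivity),
      ht2.eventually_le_const (show 0 < tailInt f v / 2 by positivity),
      eventually_ge_atTop (2 * v)] with x hx1 hx2 hx3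
    have hxp := hpos x
    -- Half of the convolution is bounded below by splitting `[0, x / 2]` at `v`, with `f x` as the
    -- second factor before `v` and `f (x - v)` after it. Since half of it is also close to `m * f
    -- x`, the excess `f (x - v) - f x` is small relative to `f x`: strong subexponential tails are
    -- long.
    have e1 : I x = 2 * ∫ u in (0 : ℝ)..(x / 2), f u * f (x - u) := by
      simp only [I]
      rw [← intervalIntegral.integral_add_adjacent_intervals (hi x 0 (x / 2)) (hi x (x / 2) x),
        integral_mul_comp_sub_symm f (x / 2) x x]
      rw [sub_self, sub_half]
      ring
    have e2 := hf.mul_integral_le_integral_mul hf1 (x := x) hv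
    have e3 := hf.mul_integral_le_integral_mul hf1 (x := x) (show v ≤ x / 2 by linarith)
    have e4 := intervalIntegral.integral_add_adjacent_intervals (hi x 0 v) (hi x v (x / 2))
    rw [← hf.tailInt_sub] at e2 e3
    rw [sub_zero] at e2
    have e5 : f x * (m - tailInt f v) + f (x - v) * (tailInt f v - tailInt f (x / 2)) ≤ I x / 2 := by
      linarith
    have e6 : f x * (I x / f x / 2) = I x / 2 := by field_simp
    have e7 := mul_le_mul_of_nonneg_left hx1 hxp.le
    have e8 : f x ≤ f (x - v) := hf.anti (by linarith)
    have e9 : (f (x - v) - f x) * (tailInt f v / 2) ≤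
        (f (x - v) - f x) * (tailInt f v - tailInt f (x / 2)) :=
      mul_le_mul_of_nonneg_left (by linarith) (by linarith)
    have e10 : (f (x - v) - f x) * (tailInt f v / 2) ≤ f x * ε * (tailInt f v / 2) := by
      linarith
    have e11 := le_of_mul_le_mul_right e10 (by positivity)
    linarith
  refine { hf with
    pos := hpos
    le_one := hf1
    shift := fun C ε hε => ?_
    middle := fun ε hε => ?_
    conv := ⟨2 * m + 1, ?_⟩ }
  · filter_upwards [hshift0 (max C 0) (le_max_right _ _) ε hε] with y hy
    exact (hf.anti (by linarith [le_max_left C 0])).trans hy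
  · obtain ⟨x₀, hx₀⟩ := eventually_atTop.1
      (hI.eventually_le_const (show 2 * m < 2 * m + ε / 2 by linarith))
    obtain ⟨K₁, hK₁⟩ := eventually_atTop.1
      (hf.tendsto_tailInt.eventually_le_const (show 0 < ε / 4 by positivity))
    refine ⟨max (max x₀ K₁) 0, fun K hK y hy => ?_⟩
    have hK0 : 0 ≤ K := (le_max_right _ _).trans hK
    have hKx : x₀ ≤ K := ((le_max_left _ _).trans (le_max_left _ _)).trans hK
    have h1 := hK₁ K (((le_max_right _ _).trans (le_max_left _ _)).trans hK)
    have h2 := hx₀ y (by linarith)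
    -- The central part is what is left of a total close to `2 m f y` after removing the two ends.
    -- Each end is, by symmetry and monotonicity, at least `f y * (m - tailInt f K)`.
    rw [div_le_iff₀ (hpos y)] at h2
    have h3 := intervalIntegral.integral_add_adjacent_intervals (hi y 0 K) (hi y K (y - K))
    have h4 := intervalIntegral.integral_add_adjacent_intervals (hi y 0 (y - K)) (hi y (y - K) y)
    have h5 := integral_mul_comp_sub_symm f 0 K y
    rw [sub_zero] at h5
    have h6 := hf.mul_integral_le_integral_mul hf1 (x := y) hK0
    rw [← hf.tailInt_sub, sub_zero] at h6
    have h7 := mul_le_mul_of_nonneg_left h1 (hpos y).le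
    simp only [I] at h2
    linarith
  · filter_upwards [hI.eventually_le_const (show 2 * m < 2 * m + 1 by linarith)] with y hy
    rwa [div_le_iff₀ (hpos y)] at hy

/-! ### Sums with negligible tails -/

section NegligibleTails

variable {Ω : Type*} [MeasurableSpace Ω] {μ : Measure Ω} [IsProbabilityMeasure μ] {f : ℝ → ℝ}

/-- The tail of `W` is negligible with respect to `f`. -/
def NegligibleTail (μ : Measure Ω) (f : ℝ → ℝ) (W : Ω → ℝ) : Prop :=
  ∀ δ > 0, ∀ᶠ u in atTop, μ.real {ω | u < W ω} ≤ δ * f u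

/-- Smearing `f` by a negligible displacement costs a factor `1 + ε`, uniformly in `t` thanks to the
truncation. For `W ≤ K` this is shift insensitivity; `W > t` has probability at most `δ f t`. In
between, the value at `t - W` is at most the integral over the unit interval to its left, which is
part of the gain of the integrated tail at `t - 1`. -/
lemma NegligibleTail.eventually_integral_le (hf : IsStrongTail f) {W : Ω → ℝ} (hW : Measurable W)
    (hW0 : ∀ᵐ ω ∂μ, 0 ≤ W ω) (htail : NegligibleTail μ f W) {ε : ℝ} (hε : 0 < ε) :
    ∀ᶠ t₀ in atTop, ∀ t, ∫ ω, f (max (t - W ω) t₀) ∂μ ≤ (1 + ε) * f (max t t₀) := by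
  obtain ⟨C, hC0, hC⟩ := hf.exists_conv_le
  obtain ⟨y₀, hy₀⟩ := eventually_atTop.1 hC
  set δ : ℝ := ε / (4 * (C + 2)) with hδdef
  have hδ : 0 < δ := by positivity
  have hδ' : δ * (2 * (C + 1) + 1) ≤ ε / 2 := by
    have : δ * (4 * (C + 2)) = ε := by rw [hδdef]; field_simp
    nlinarith
  obtain ⟨U, hU⟩ := eventually_atTop.1 (htail δ hδ)
  set K : ℝ := max U 1 with hK
  have hK1 : 1 ≤ K := le_max_right _ _
  have hUK : U ≤ K := le_max_left _ _
  obtain ⟨t₁, ht₁⟩ := eventually_atTop.1 (hf.shift 1 1 one_pos)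
  filter_upwards [hf.eventually_truncated_shift (by linarith : (0 : ℝ) ≤ K)
    (by positivity : 0 < ε / 2), eventually_ge_atTop (max y₀ 0 + 1), eventually_ge_atTop t₁,
    eventually_ge_atTop K] with t₀ h1 h2 h3 h4 t
  have hy₀1 : y₀ + 1 ≤ t₀ := by linarith [le_max_left y₀ 0]
  have ht₀1 : 1 ≤ t₀ := by linarith [le_max_right y₀ 0]
  have hLam := hf.comp_max t₀
  have hmeas : Measurable fun ω => f (max (t - W ω) t₀) :=
    hf.measurable.comp ((measurable_const.sub hW).max measurable_const)
  have hint : Integrable (fun ω => f (max (t - W ω) t₀)) μ :=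
    Integrable.of_bound hmeas.aestronglyMeasurable 1 (Eventually.of_forall fun ω => by
      rw [Real.norm_of_nonneg (hf.nonneg _)]; exact hf.le_one _)
  rcases le_total t t₀ with htt | htt
  · rw [max_eq_right htt]
    have h5 : ∫ ω, f (max (t - W ω) t₀) ∂μ = f t₀ := by
      rw [integral_congr_ae (g := fun _ => f t₀)]
      · simp
      · filter_upwards [hW0] with ω hω
        rw [max_eq_right (by linarith)]
    rw [h5]
    nlinarith [hf.nonneg t₀]
  · rw [max_eq_left htt]
    let g : Ω → ℝ := fun w => if K < W w then tailInt (fun u => f (max u t₀)) (max (t - 1 - W w) (-1))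
      - tailInt (fun u => f (max u t₀)) (t - 1) else 0
    have hg := hf.toIsTail.integral_gain_le (Q := μ) hLam hW (t := -1) (y := t - 1)
      (by linarith) (r := δ) (K := K) (fun u hu => hU u (hUK.trans hu))
    have hJ := hy₀ (t - 1) (by linarith) (-1) (by norm_num) t₀ K
    have hg0 : ∀ w, 0 ≤ g w := fun w => by
      simp only [g]
      split_ifs with h
      · exact sub_nonneg.2 (hLam.tailInt_anti (max_le (by linarith) (by linarith)))
      · exact le_rfl
    have hgi : Integrable g μ := by
      have hm := hLam.measurable_tailInt
      refine Integrable.of_bound (Measurable.ite (measurableSet_lt measurable_const hW) ?_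
        measurable_const).aestronglyMeasurable (tailInt (fun u => f (max u t₀)) (-1))
        (Eventually.of_forall fun w => ?_)
      · fun_prop
      · rw [Real.norm_of_nonneg (hg0 w)]
        have h0 := hLam.tailInt_nonneg (-1)
        have h1 := hLam.tailInt_anti (le_max_right (t - 1 - W w) (-1))
        have h2 := hLam.tailInt_nonneg (t - 1)
        simp only [g]
        split_ifs <;> linarith
    have hXm : MeasurableSet {ω | t < W ω} := measurableSet_lt measurable_const hW
    have hpt : ∀ ω, f (max (t - W ω) t₀) ≤
        (1 + ε / 2) * f t + g ω + {ω | t < W ω}.indicator (fun _ => (1 : ℝ)) ω := fun ω => by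
      have hft := hf.nonneg t
      have hi0 : 0 ≤ {ω | t < W ω}.indicator (fun _ => (1 : ℝ)) ω :=
        Set.indicator_nonneg (fun _ _ => zero_le_one) _
      by_cases h : t < W ω
      · rw [Set.indicator_of_mem (show ω ∈ {ω | t < W ω} from h)]
        have := hf.le_one (max (t - W ω) t₀)
        have := hg0 ω
        nlinarith
      by_cases h' : K < W ω
      · simp only [g, if_pos h']
        have h5 : max (t - 1 - W ω) (-1) = t - 1 - W ω := max_eq_left (by linarith)
        rw [h5]
        have h6 := hLam.tailInt_sub (t - 1 - W ω) (t - W ω)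
        have h7 := hLam.mul_le_integral (show t - 1 - W ω ≤ t - W ω by linarith)
        have h8 := hLam.tailInt_anti (show t - W ω ≤ t - 1 by linarith)
        rw [show t - W ω - (t - 1 - W ω) = 1 by ring, mul_one] at h7
        nlinarith
      · have h5 := (h1 t).1
        rw [max_eq_left htt] at h5
        have h6 : f (max (t - W ω) t₀) ≤ f (max (t - K) t₀) :=
          hf.anti (max_le_max_right _ (by linarith [not_lt.1 h']))
        have := hg0 ω
        linarith
    have i1 : Integrable (fun _ : Ω => (1 + ε / 2) * f t) μ := integrable_const _
    have i2 : Integrable (fun ω => (1 + ε / 2) * f t + g ω) μ := i1.add hgi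
    have i3 : Integrable ({ω | t < W ω}.indicator (fun _ => (1 : ℝ))) μ :=
      (integrable_const _).indicator hXm
    have h5 := integral_mono hint (i2.add i3) hpt
    have h5' : ∫ ω, ((1 + ε / 2) * f t + g ω + {ω | t < W ω}.indicator (fun _ => (1 : ℝ)) ω) ∂μ =
        (1 + ε / 2) * f t + ∫ ω, g ω ∂μ + μ.real {ω | t < W ω} := by
      rw [integral_add i2 i3, integral_add i1 hgi, integral_indicator hXm, setIntegral_const]
      simp
    have h6 := h5.trans_eq h5'
    have h7 := hU t (by linarith)
    have h8 := ht₁ t (by linarith)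
    have hft0 := hf.le_one t₀
    have hft := hf.nonneg t
    have h9 : ∫ ω, g ω ∂μ ≤ δ * ((C + 1) * (2 * f t)) := by
      refine hg.trans (mul_le_mul_of_nonneg_left (hJ.trans ?_) hδ.le)
      exact mul_le_mul (by linarith) (by linarith) (hf.nonneg _) (by linarith)
    have h10 := mul_le_mul_of_nonneg_right hδ' hft
    linarith

end NegligibleTails

section NegligibleTails

variable {Ω : Type*} [MeasurableSpace Ω] {μ : Measure Ω} [IsProbabilityMeasure μ] {f : ℝ → ℝ}

lemma measureReal_lt_add_of_indepFun {A W : Ω → ℝ} (hA : Measurable A) (hW : Measurable W)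
    (h : IndepFun A W μ) (t : ℝ) :
    μ.real {ω | t < A ω + W ω} = ∫ ω, μ.real {ω' | t - W ω < A ω'} ∂μ := by
  have hs : MeasurableSet {q : ℝ × ℝ | t < q.1 + q.2} :=
    measurableSet_lt measurable_const (measurable_fst.add measurable_snd)
  have h1 : μ {ω | t < A ω + W ω} = (μ.map fun ω => (A ω, W ω)) {q : ℝ × ℝ | t < q.1 + q.2} := by
    rw [Measure.map_apply (hA.prodMk hW) hs]; rfl
  rw [(indepFun_iff_map_prod_eq_prod_map_map hA.aemeasurable hW.aemeasurable).1 h,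
    Measure.prod_apply_symm hs] at h1
  have hPA : IsProbabilityMeasure (μ.map A) := Measure.isProbabilityMeasure_map hA.aemeasurable
  have hanti : Antitone fun w : ℝ => (μ.map A) (Set.Ioi w) := fun x y hxy =>
    measure_mono (Set.Ioi_subset_Ioi hxy)
  have h2 : ∀ w : ℝ, (fun x => (x, w)) ⁻¹' {q : ℝ × ℝ | t < q.1 + q.2} = Set.Ioi (t - w) := fun w => by
    ext x; simp [sub_lt_iff_lt_add]
  simp_rw [h2] at h1
  have hm : Measurable fun w : ℝ => (μ.map A) (Set.Ioi (t - w)) :=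
    hanti.measurable.comp (measurable_const.sub measurable_id)
  rw [lintegral_map hm hW] at h1
  rw [measureReal_def, h1, ← integral_toReal (f := fun a => (μ.map A) (Set.Ioi (t - W a))) (hm.comp hW).aemeasurable
    (Eventually.of_forall fun ω => measure_lt_top _ _)]
  refine integral_congr_ae (Eventually.of_forall fun ω => ?_)
  simp only
  rw [Measure.map_apply hA measurableSet_Ioi]
  rfl

lemma measurable_measureReal_lt {A W : Ω → ℝ} (hW : Measurable W) (t : ℝ) :
    Measurable fun ω => μ.real {ω' | t - W ω < A ω'} := by
  have hanti : Antitone fun w : ℝ => μ.real {ω' | w < A ω'} := fun x y hxy =>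
    measureReal_mono fun ω (h : y < A ω) => hxy.trans_lt h
  exact hanti.measurable.comp (measurable_const.sub hW)

/-- Adding an independent summand with negligible tail to a summand whose tail is dominated. -/
lemma NegligibleTail.eventually_add_le (hf : IsStrongTail f) {A W : Ω → ℝ} (hA : Measurable A)
    (hW : Measurable W) (h : IndepFun A W μ) (hW0 : ∀ᵐ ω ∂μ, 0 ≤ W ω)
    (htail : NegligibleTail μ f W) {r : ℝ} (hr : 0 ≤ r)
    (hAr : ∀ᶠ u in atTop, μ.real {ω | u < A ω} ≤ r * f u) {ε : ℝ} (hε : 0 < ε) :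
    ∀ᶠ t in atTop, μ.real {ω | t < A ω + W ω} ≤ (r + ε) * f t := by
  set ε' := ε / (r + 2) with hε'
  have hε'0 : 0 < ε' := by positivity
  have hε'1 : ε' * (r + 2) = ε := by rw [hε']; field_simp
  obtain ⟨U, hU⟩ := eventually_atTop.1 hAr
  obtain ⟨t₀, h1, h2⟩ := ((htail.eventually_integral_le hf hW hW0 hε'0).and
    (eventually_ge_atTop U)).exists
  have hsh : Tendsto (fun t : ℝ => t - t₀) atTop atTop :=
    tendsto_atTop_add_const_right _ _ tendsto_id
  filter_upwards [eventually_ge_atTop t₀, hsh.eventually (htail ε' hε'0),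
    hf.shift t₀ 1 one_pos] with t ht h3 h4
  rw [measureReal_lt_add_of_indepFun hA hW h]
  have hXm : MeasurableSet {ω | t - t₀ < W ω} := measurableSet_lt measurable_const hW
  have hmeas : Measurable fun ω => f (max (t - W ω) t₀) :=
    hf.measurable.comp ((measurable_const.sub hW).max measurable_const)
  have hint : Integrable (fun ω => f (max (t - W ω) t₀)) μ :=
    Integrable.of_bound hmeas.aestronglyMeasurable 1 (Eventually.of_forall fun ω => by
      rw [Real.norm_of_nonneg (hf.nonneg _)]; exact hf.le_one _)
  have i3 : Integrable ({ω | t - t₀ < W ω}.indicator (fun _ => (1 : ℝ))) μ :=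
    (integrable_const _).indicator hXm
  -- Unless `W` alone exceeds `t - t₀`, the summand `A` has to pass a level of at least `t₀`, where
  -- its tail bound is in force.
  have hpt : ∀ ω, μ.real {ω' | t - W ω < A ω'} ≤
      r * f (max (t - W ω) t₀) + {ω | t - t₀ < W ω}.indicator (fun _ => (1 : ℝ)) ω := fun ω => by
    by_cases hω : t - t₀ < W ω
    · rw [Set.indicator_of_mem (show ω ∈ {ω | t - t₀ < W ω} from hω)]
      have := measureReal_le_one (μ := μ) (s := {ω' | t - W ω < A ω'})
      have := mul_nonneg hr (hf.nonneg (max (t - W ω) t₀))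
      linarith
    · rw [Set.indicator_of_notMem (show ω ∉ {ω | t - t₀ < W ω} from hω), add_zero,
        max_eq_left (by linarith [not_lt.1 hω])]
      exact hU _ (by linarith [not_lt.1 hω])
  have i0 : Integrable (fun ω => μ.real {ω' | t - W ω < A ω'}) μ :=
    Integrable.of_bound (measurable_measureReal_lt hW t).aestronglyMeasurable 1
      (Eventually.of_forall fun ω => by
        rw [Real.norm_of_nonneg measureReal_nonneg]; exact measureReal_le_one)
  have h5 := integral_mono i0 ((hint.const_mul r).add i3) hpt
  have h5' : ∫ ω, (r * f (max (t - W ω) t₀) +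
      {ω | t - t₀ < W ω}.indicator (fun _ => (1 : ℝ)) ω) ∂μ =
      r * ∫ ω, f (max (t - W ω) t₀) ∂μ + μ.real {ω | t - t₀ < W ω} := by
    rw [integral_add (hint.const_mul r) i3, integral_const_mul, integral_indicator hXm,
      setIntegral_const]
    simp
  have h6 := h5.trans_eq h5'
  have h7 := h1 t
  rw [max_eq_left ht] at h7
  have h8 := mul_le_mul_of_nonneg_left h7 hr
  have h9 := mul_le_mul_of_nonneg_left h4 hε'0.le
  have h10 : (r + ε) * f t = r * ((1 + ε') * f t) + ε' * ((1 + 1) * f t) := by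
    rw [← hε'1]; ring
  linarith

lemma NegligibleTail.add (hf : IsStrongTail f) {A W : Ω → ℝ} (hA : Measurable A)
    (hW : Measurable W) (h : IndepFun A W μ) (hW0 : ∀ᵐ ω ∂μ, 0 ≤ W ω)
    (hAt : NegligibleTail μ f A) (htail : NegligibleTail μ f W) :
    NegligibleTail μ f (fun ω => A ω + W ω) := fun δ hδ => by
  filter_upwards [htail.eventually_add_le hf hA hW h hW0 (half_pos hδ).le (hAt _ (half_pos hδ))
    (half_pos hδ)] with t ht
  rwa [add_halves] at ht

section Sums

variable {W : ℕ → Ω → ℝ}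

lemma negligibleTail_sum (hf : IsStrongTail f) (hW : ∀ i, Measurable (W i))
    (hind : iIndepFun W μ) (hid : ∀ i, IdentDistrib (W i) (W 0) μ μ) (hW0 : ∀ i, ∀ᵐ ω ∂μ, 0 ≤ W i ω)
    (htail : NegligibleTail μ f (W 0)) (k : ℕ) :
    NegligibleTail μ f (fun ω => ∑ i ∈ Finset.range k, W i ω) := by
  induction k with
  | zero =>
    intro δ hδ
    filter_upwards [eventually_ge_atTop 0] with u hu
    have : {ω : Ω | u < ∑ i ∈ Finset.range 0, W i ω} = ∅ := by
      ext ω; simpa using hu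
    rw [this, measureReal_empty]
    exact mul_nonneg hδ.le (hf.nonneg _)
  | succ k ih =>
    simp_rw [Finset.sum_range_succ]
    have hk : NegligibleTail μ f (W k) := fun δ hδ => by
      filter_upwards [htail δ hδ] with u hu
      have := (hid k).measure_mem_eq (s := Set.Ioi u) measurableSet_Ioi
      have h2 : μ.real {ω | u < W k ω} = μ.real {ω | u < W 0 ω} := congrArg ENNReal.toReal this
      rwa [h2]
    refine ih.add hf (Finset.measurable_sum _ fun i _ => hW i) (hW k) ?_ (hW0 k) hk
    have := hind.indepFun_sum_range_succ hW k
    convert this using 1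
    ext ω
    simp

/-- A Kesten type bound for the tails of sums with negligible summands. -/
lemma exists_sum_tail_le (hf : IsStrongTail f) (hW : ∀ i, Measurable (W i))
    (hind : iIndepFun W μ) (hid : ∀ i, IdentDistrib (W i) (W 0) μ μ) (hW0 : ∀ᵐ ω ∂μ, 0 ≤ W 0 ω)
    (htail : NegligibleTail μ f (W 0)) {ε : ℝ} (hε : 0 < ε) :
    ∃ t₀ C : ℝ, 0 ≤ C ∧ ∀ (k : ℕ) (t : ℝ), μ.real {ω | t < ∑ i ∈ Finset.range k, W i ω} ≤
      C * (1 + ε) ^ k * f (max t t₀) := by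
  obtain ⟨t₀, h1, h2⟩ := ((htail.eventually_integral_le hf (hW 0) hW0 hε).and
    (eventually_ge_atTop 0)).exists
  refine ⟨t₀, 1 / f t₀, by have := hf.pos t₀; positivity, fun k => ?_⟩
  have hfp := hf.pos t₀
  induction k with
  | zero =>
    intro t
    rcases le_total 0 t with h | h
    · have : {ω : Ω | t < ∑ i ∈ Finset.range 0, W i ω} = ∅ := by
        ext ω; simpa using h
      rw [this, measureReal_empty]
      have := hf.nonneg (max t t₀)
      positivity
    · rw [max_eq_right (by linarith), pow_zero, mul_one, one_div, inv_mul_cancel₀ hfp.ne']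
      exact measureReal_le_one
  | succ k ih =>
    intro t
    simp_rw [Finset.sum_range_succ]
    have hindep : IndepFun (fun ω => ∑ i ∈ Finset.range k, W i ω) (W k) μ := by
      have := hind.indepFun_sum_range_succ hW k
      convert this using 1
      ext ω
      simp
    rw [measureReal_lt_add_of_indepFun (Finset.measurable_sum _ fun i _ => hW i) (hW k) hindep]
    have hfm := hf.measurable
    have hmeas : Measurable fun w => f (max (t - w) t₀) := by fun_prop
    have hint : Integrable (fun ω => f (max (t - W k ω) t₀)) μ :=
      Integrable.of_bound (hmeas.comp (hW k)).aestronglyMeasurable 1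
        (Eventually.of_forall fun ω => by
          rw [Real.norm_of_nonneg (hf.nonneg _)]; exact hf.le_one _)
    have i0 : Integrable
        (fun ω => μ.real {ω' | t - W k ω < ∑ i ∈ Finset.range k, W i ω'}) μ :=
      Integrable.of_bound (measurable_measureReal_lt (hW k) t).aestronglyMeasurable 1
        (Eventually.of_forall fun ω => by
          rw [Real.norm_of_nonneg measureReal_nonneg]; exact measureReal_le_one)
    have h3 := integral_mono i0 (hint.const_mul (1 / f t₀ * (1 + ε) ^ k)) fun ω => ih (t - W k ω)
    rw [integral_const_mul] at h3
    have h4 : ∫ ω, f (max (t - W k ω) t₀) ∂μ = ∫ ω, f (max (t - W 0 ω) t₀) ∂μ :=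
      ((hid k).comp hmeas).integral_eq
    rw [h4] at h3
    have h5 := mul_le_mul_of_nonneg_left (h1 t) (by positivity : 0 ≤ 1 / f t₀ * (1 + ε) ^ k)
    refine h3.trans (h5.trans_eq ?_)
    rw [pow_succ]; ring

/-- Geometric sums of negligible summands are negligible. -/
theorem negligibleTail_of_geometric (hf : IsStrongTail f) (hW : ∀ i, Measurable (W i))
    (hind : iIndepFun W μ) (hid : ∀ i, IdentDistrib (W i) (W 0) μ μ) (hW0 : ∀ i, ∀ᵐ ω ∂μ, 0 ≤ W i ω)
    (htail : NegligibleTail μ f (W 0)) {q : ℝ} (hq0 : 0 < q) (hq1 : q ≤ 1) {G : Ω → ℝ}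
    (hG : ∀ t, μ.real {ω | t < G ω} =
      ∑' k : ℕ, q * (1 - q) ^ k * μ.real {ω | t < ∑ i ∈ Finset.range (k + 1), W i ω}) :
    NegligibleTail μ f G := by
  -- The growth rate in the Kesten bound is taken to be `1 + q`. Against the geometric weights this
  -- leaves the ratio `(1 - q) * (1 + q) < 1`, hence a summable majorant that permits passing to the
  -- limit term by term.
  obtain ⟨t₀, C, hC0, hC⟩ := exists_sum_tail_le hf hW hind hid (hW0 0) htail hq0
  have hfac0 : 0 ≤ (1 - q) * (1 + q) := mul_nonneg (by linarith) (by linarith)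
  have hfac1 : (1 - q) * (1 + q) < 1 := by nlinarith
  have hlim : Tendsto (fun t => ∑' k : ℕ, q * (1 - q) ^ k *
      (μ.real {ω | t < ∑ i ∈ Finset.range (k + 1), W i ω} / f t)) atTop (𝓝 (∑' _ : ℕ, (0 : ℝ))) := by
    refine tendsto_tsum_of_dominated_convergence
      (bound := fun k => q * (C * (1 + q)) * ((1 - q) * (1 + q)) ^ k) ?_ ?_ ?_
    · exact (summable_geometric_of_lt_one hfac0 hfac1).mul_left _
    · intro k
      have h1 : Tendsto (fun t => μ.real {ω | t < ∑ i ∈ Finset.range (k + 1), W i ω} / f t)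
          atTop (𝓝 0) := by
        rw [Metric.tendsto_nhds]
        intro δ hδ
        filter_upwards [negligibleTail_sum hf hW hind hid hW0 htail (k + 1) (δ / 2) (half_pos hδ)]
          with t ht
        have hft := hf.pos t
        rw [Real.dist_0_eq_abs, abs_of_nonneg (div_nonneg measureReal_nonneg hft.le), div_lt_iff₀ hft]
        nlinarith
      simpa using h1.const_mul (q * (1 - q) ^ k)
    · filter_upwards [eventually_ge_atTop t₀] with t ht k
      have hft := hf.pos t
      have h1 := hC (k + 1) t
      rw [max_eq_left ht] at h1
      have hq' : 0 ≤ (1 - q) ^ k := pow_nonneg (by linarith) k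
      rw [Real.norm_of_nonneg (mul_nonneg (mul_nonneg hq0.le hq')
        (div_nonneg measureReal_nonneg hft.le))]
      have h2 : μ.real {ω | t < ∑ i ∈ Finset.range (k + 1), W i ω} / f t ≤ C * (1 + q) ^ (k + 1) := by
        rwa [div_le_iff₀ hft]
      refine (mul_le_mul_of_nonneg_left h2 (mul_nonneg hq0.le hq')).trans_eq ?_
      rw [mul_pow, pow_succ]; ring
  rw [tsum_zero] at hlim
  intro δ hδ
  filter_upwards [hlim.eventually_le_const hδ] with t ht
  have hft := hf.pos t
  rw [hG t]
  have : ∀ k : ℕ, q * (1 - q) ^ k * (μ.real {ω | t < ∑ i ∈ Finset.range (k + 1), W i ω} / f t) =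
      (q * (1 - q) ^ k * μ.real {ω | t < ∑ i ∈ Finset.range (k + 1), W i ω}) / f t := fun k => by ring
  simp_rw [this] at ht
  rw [tsum_div_const] at ht
  rwa [div_le_iff₀ hft] at ht

end Sums

end NegligibleTails

/-! ### Paths of compound renewal processes -/

/-- The partial sums of the jump sizes. -/
noncomputable def jumpSum {Ω : Type*} (Y : ℕ → Ω → ℝ) (n : ℕ) (ω : Ω) : ℝ :=
  ∑ i ∈ Finset.range n, Y i ω

/-- The interarrival times are positive and the epochs tend to infinity. -/
structure IsRegularPath {Ω : Type*} (ξ : ℕ → Ω → ℝ) (ω : Ω) : Prop where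
  pos : ∀ n, 0 < ξ n ω
  tendsto : Tendsto (fun n => renewalEpoch ξ n ω) atTop atTop

section Paths

variable {Ω : Type*} {ξ Y : ℕ → Ω → ℝ} {ω : Ω} {c : ℝ}

lemma renewalEpoch_zero : renewalEpoch ξ 0 ω = 0 := by simp [renewalEpoch]

lemma renewalEpoch_succ (n : ℕ) : renewalEpoch ξ (n + 1) ω = renewalEpoch ξ n ω + ξ n ω := by
  simp [renewalEpoch, Finset.sum_range_succ]

lemma jumpSum_succ (n : ℕ) : jumpSum Y (n + 1) ω = jumpSum Y n ω + Y n ω := by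
  simp [jumpSum, Finset.sum_range_succ]

namespace IsRegularPath

lemma strictMono (h : IsRegularPath ξ ω) : StrictMono fun n => renewalEpoch ξ n ω :=
  strictMono_nat_of_lt_succ fun n => by rw [renewalEpoch_succ]; linarith [h.pos n]

lemma nonneg (h : IsRegularPath ξ ω) (n : ℕ) : 0 ≤ renewalEpoch ξ n ω := by
  rw [← renewalEpoch_zero (ξ := ξ) (ω := ω)]
  exact h.strictMono.monotone (Nat.zero_le n)

lemma exists_mem_Ico (h : IsRegularPath ξ ω) {t : ℝ} (ht : 0 ≤ t) :
    ∃ n, renewalEpoch ξ n ω ≤ t ∧ t < renewalEpoch ξ (n + 1) ω := by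
  have h1 : ∃ n, t < renewalEpoch ξ n ω := (h.tendsto.eventually_gt_atTop t).exists
  classical
  have h2 := Nat.find_spec h1
  have h3 : Nat.find h1 ≠ 0 := fun h0 => by
    rw [h0, renewalEpoch_zero] at h2; linarith
  obtain ⟨n, hn⟩ := Nat.exists_eq_succ_of_ne_zero h3
  refine ⟨n, ?_, ?_⟩
  · exact not_lt.1 (Nat.find_min h1 (by omega))
  · rw [Nat.succ_eq_add_one] at hn
    rwa [← hn]

lemma lt_renewalCount_iff (h : IsRegularPath ξ ω) (τ : ℝ≥0∞) (i : ℕ) :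
    (i : ℕ∞) < renewalCount ξ τ ω ↔ ENNReal.ofReal (renewalEpoch ξ (i + 1) ω) ≤ τ := by
  constructor
  · contrapose!
    intro hlt
    have hsub : {n : ℕ | 1 ≤ n ∧ ENNReal.ofReal (renewalEpoch ξ n ω) ≤ τ} ⊆ Finset.Icc 1 i := by
      intro n hn
      simp only [Set.mem_ofPred_eq] at hn
      rw [Finset.coe_Icc, Set.mem_Icc]
      refine ⟨hn.1, ?_⟩
      by_contra hni
      have h1 : renewalEpoch ξ (i + 1) ω ≤ renewalEpoch ξ n ω := h.strictMono.monotone (by omega)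
      exact absurd (hlt.trans_le (ENNReal.ofReal_le_ofReal h1)) (not_lt.2 hn.2)
    have h2 := Set.encard_le_encard hsub
    rw [Set.encard_coe_eq_coe_finsetCard, Nat.card_Icc] at h2
    simpa [renewalCount] using h2
  · intro hle
    have hsub : (Finset.Icc 1 (i + 1) : Set ℕ) ⊆
        {n : ℕ | 1 ≤ n ∧ ENNReal.ofReal (renewalEpoch ξ n ω) ≤ τ} := by
      intro n hn
      rw [Finset.coe_Icc, Set.mem_Icc] at hn
      exact ⟨hn.1, (ENNReal.ofReal_le_ofReal (h.strictMono.monotone hn.2)).trans hle⟩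
    have h2 := Set.encard_le_encard hsub
    rw [Set.encard_coe_eq_coe_finsetCard, Nat.card_Icc] at h2
    refine lt_of_lt_of_le ?_ h2
    exact_mod_cast Nat.lt_succ_self i

lemma renewalCount_eq (h : IsRegularPath ξ ω) {t : ℝ} {n : ℕ} (h1 : renewalEpoch ξ n ω ≤ t)
    (h2 : t < renewalEpoch ξ (n + 1) ω) : renewalCount ξ (ENNReal.ofReal t) ω = n := by
  have ht : 0 ≤ t := (h.nonneg n).trans h1
  refine le_antisymm (not_lt.1 fun h3 => ?_) ?_
  · rw [h.lt_renewalCount_iff, ENNReal.ofReal_le_ofReal_iff ht] at h3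
    linarith
  · rcases n with _ | n
    · simp
    · have : (n : ℕ∞) < renewalCount ξ (ENNReal.ofReal t) ω := by
        rw [h.lt_renewalCount_iff]
        exact ENNReal.ofReal_le_ofReal h1
      have h4 := Order.add_one_le_of_lt this
      exact_mod_cast h4

lemma compoundRenewal_eq (h : IsRegularPath ξ ω) {t : ℝ} {n : ℕ} (h1 : renewalEpoch ξ n ω ≤ t)
    (h2 : t < renewalEpoch ξ (n + 1) ω) : compoundRenewal c ξ Y t ω = jumpSum Y n ω + c * t := by
  rw [compoundRenewal, h.renewalCount_eq h1 h2]
  rfl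

lemma leftLim_eq (h : IsRegularPath ξ ω) (n : ℕ) :
    Function.leftLim (fun t => compoundRenewal c ξ Y t ω) (renewalEpoch ξ (n + 1) ω) =
      jumpSum Y n ω + c * renewalEpoch ξ (n + 1) ω := by
  refine leftLim_eq_of_tendsto ?_
  have h1 : Tendsto (fun t : ℝ => jumpSum Y n ω + c * t) (𝓝[<] renewalEpoch ξ (n + 1) ω)
      (𝓝 (jumpSum Y n ω + c * renewalEpoch ξ (n + 1) ω)) :=
    (Continuous.tendsto (by fun_prop) _).mono_left nhdsWithin_le_nhds
  refine h1.congr' ?_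
  filter_upwards [Ico_mem_nhdsLT (h.strictMono n.lt_succ_self)] with t ht
  exact (h.compoundRenewal_eq ht.1 ht.2).symm

/-- The level `x` is exceeded between two consecutive epochs. -/
lemma exists_rat_of_lt (h : IsRegularPath ξ ω) {x : ℝ} {l : ℕ}
    (hx : x < jumpSum Y l ω + max (c * renewalEpoch ξ l ω) (c * renewalEpoch ξ (l + 1) ω)) :
    ∃ s : ℚ, 0 ≤ s ∧ renewalEpoch ξ l ω ≤ s ∧ s < renewalEpoch ξ (l + 1) ω ∧
      x < compoundRenewal c ξ Y s ω := by
  set T := renewalEpoch ξ l ω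
  set T' := renewalEpoch ξ (l + 1) ω
  have hT : T < T' := h.strictMono l.lt_succ_self
  have hcont : Continuous fun t : ℝ => jumpSum Y l ω + c * t := by fun_prop
  -- The larger end value of the affine piece may be attained only as a left limit at `T'`, so an
  -- open interval of crossing times next to that end is used.
  have key : ∃ a b : ℝ, T ≤ a ∧ a < b ∧ b ≤ T' ∧ ∀ t ∈ Set.Ioo a b, x < jumpSum Y l ω + c * t := by
    rcases le_total (c * T) (c * T') with h1 | h1
    · rw [max_eq_right h1] at hx
      have h2 := (hcont.tendsto T').eventually_const_lt hx
      obtain ⟨a, ha, ha'⟩ := (mem_nhdsLE_iff_exists_Ioc_subset' hT).1 (nhdsWithin_le_nhds h2)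
      refine ⟨max a T, T', le_max_right _ _, max_lt ha hT, le_rfl, fun t ht => ?_⟩
      exact ha' ⟨(le_max_left _ _).trans_lt ht.1, ht.2.le⟩
    · rw [max_eq_left h1] at hx
      have h2 := (hcont.tendsto T).eventually_const_lt hx
      obtain ⟨b, hb, hb'⟩ := (mem_nhdsGE_iff_exists_Ico_subset' hT).1 (nhdsWithin_le_nhds h2)
      refine ⟨T, min b T', le_rfl, lt_min hb hT, min_le_right _ _, fun t ht => ?_⟩
      exact hb' ⟨ht.1.le, ht.2.trans_le (min_le_left _ _)⟩
  obtain ⟨a, b, haT, hab, hbT, hI⟩ := key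
  obtain ⟨s, hs1, hs2⟩ := exists_rat_btwn hab
  have hTs : T ≤ s := haT.trans hs1.le
  have hsT : (s : ℝ) < T' := hs2.trans_le hbT
  refine ⟨s, ?_, hTs, hsT, ?_⟩
  · exact_mod_cast (h.nonneg l).trans hTs
  · rw [h.compoundRenewal_eq hTs hsT]
    exact hI s ⟨hs1, hs2⟩

lemma le_max_of_mem (h : IsRegularPath ξ ω) {t : ℝ} {l : ℕ} (h1 : renewalEpoch ξ l ω ≤ t)
    (h2 : t < renewalEpoch ξ (l + 1) ω) : compoundRenewal c ξ Y t ω ≤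
      jumpSum Y l ω + max (c * renewalEpoch ξ l ω) (c * renewalEpoch ξ (l + 1) ω) := by
  rw [h.compoundRenewal_eq h1 h2]
  rcases le_total 0 c with hc | hc
  · linarith [le_max_right (c * renewalEpoch ξ l ω) (c * renewalEpoch ξ (l + 1) ω),
      mul_le_mul_of_nonneg_left h2.le hc]
  · linarith [le_max_left (c * renewalEpoch ξ l ω) (c * renewalEpoch ξ (l + 1) ω),
      mul_le_mul_of_nonpos_left h1 hc]

/-- Only countably many times are needed to recognise an earlier crossing, so the event that there
was none is determined by the path before the epoch. -/
lemma forall_rat_le_iff (h : IsRegularPath ξ ω) (x : ℝ) (i : ℕ) :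
    (∀ s : ℚ, 0 ≤ s → (s : ℝ) < renewalEpoch ξ (i + 1) ω → compoundRenewal c ξ Y s ω ≤ x) ↔
      ∀ l ≤ i, jumpSum Y l ω +
        max (c * renewalEpoch ξ l ω) (c * renewalEpoch ξ (l + 1) ω) ≤ x := by
  constructor
  · intro h1 l hl
    by_contra h2
    obtain ⟨s, hs0, hs1, hs2, hs3⟩ := h.exists_rat_of_lt (not_le.1 h2)
    have h3 : renewalEpoch ξ (l + 1) ω ≤ renewalEpoch ξ (i + 1) ω :=
      h.strictMono.monotone (by omega)
    exact absurd (h1 s hs0 (hs2.trans_le h3)) (not_le.2 hs3)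
  · intro h1 s hs0 hs1
    obtain ⟨n, hn1, hn2⟩ := h.exists_mem_Ico (t := s) (by exact_mod_cast hs0)
    have h2 : n < i + 1 := h.strictMono.lt_iff_lt.1 (hn1.trans_lt hs1)
    exact (h.le_max_of_mem hn1 hn2).trans (h1 n (by omega))

lemma lt_pathSup_iff {X : ℝ → Ω → ℝ} {x : ℝ} {t : ℝ≥0∞} :
    (x : EReal) < pathSup X t ω ↔ ∃ u : ℝ, 0 ≤ u ∧ ENNReal.ofReal u ≤ t ∧ x < X u ω := by
  simp [pathSup, lt_iSup_iff, and_assoc]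

/-- The level `x` is exceeded up to time `t` only between epochs the first of which is at most `t`. -/
lemma exists_of_lt_pathSup (h : IsRegularPath ξ ω) {x : ℝ} {t : ℝ≥0∞}
    (hx : (x : EReal) < pathSup (compoundRenewal c ξ Y) t ω) :
    ∃ l, ENNReal.ofReal (renewalEpoch ξ l ω) ≤ t ∧
      x < jumpSum Y l ω + max (c * renewalEpoch ξ l ω) (c * renewalEpoch ξ (l + 1) ω) := by
  obtain ⟨u, hu0, hut, hux⟩ := lt_pathSup_iff.1 hx
  obtain ⟨n, hn1, hn2⟩ := h.exists_mem_Ico hu0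
  exact ⟨n, (ENNReal.ofReal_le_ofReal hn1).trans hut, hux.trans_le (h.le_max_of_mem hn1 hn2)⟩

lemma lt_pathSup_of_lt (h : IsRegularPath ξ ω) {x : ℝ} {t : ℝ≥0∞} {l : ℕ}
    (ht : ENNReal.ofReal (renewalEpoch ξ (l + 1) ω) ≤ t)
    (hx : x < jumpSum Y l ω + max (c * renewalEpoch ξ l ω) (c * renewalEpoch ξ (l + 1) ω)) :
    (x : EReal) < pathSup (compoundRenewal c ξ Y) t ω := by
  obtain ⟨s, hs0, _, hs2, hs3⟩ := h.exists_rat_of_lt hx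
  exact lt_pathSup_iff.2 ⟨s, by exact_mod_cast hs0, (ENNReal.ofReal_le_ofReal hs2.le).trans ht, hs3⟩

lemma lt_pathSup_of_lt_jump (h : IsRegularPath ξ ω) {x : ℝ} {t : ℝ≥0∞} {l : ℕ}
    (ht : ENNReal.ofReal (renewalEpoch ξ l ω) ≤ t)
    (hx : x < jumpSum Y l ω + c * renewalEpoch ξ l ω) :
    (x : EReal) < pathSup (compoundRenewal c ξ Y) t ω := by
  refine lt_pathSup_iff.2 ⟨renewalEpoch ξ l ω, h.nonneg l, ht, ?_⟩
  rwa [h.compoundRenewal_eq le_rfl (h.strictMono l.lt_succ_self)]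

/-- Additive functionals of the jumps before an epoch are recovered from the path on a grid. -/
lemma eventually_grid_sum_eq (h : IsRegularPath ξ ω) {φ : ℝ → ℝ} (hφ : φ 0 = 0) (i : ℕ) :
    ∀ᶠ m : ℕ in atTop, ∑ k ∈ Finset.range (4 ^ m),
      (if ((k : ℝ) + 1) / 2 ^ m < renewalEpoch ξ (i + 1) ω then
        φ ((compoundRenewal c ξ Y (((k : ℝ) + 1) / 2 ^ m) ω - c * (((k : ℝ) + 1) / 2 ^ m)) -
          (compoundRenewal c ξ Y ((k : ℝ) / 2 ^ m) ω - c * ((k : ℝ) / 2 ^ m))) else 0) =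
      ∑ l ∈ Finset.range i, φ (Y l ω) := by
  set T := fun n => renewalEpoch ξ n ω with hT
  have htwo : Tendsto (fun m : ℕ => (2 : ℝ) ^ m) atTop atTop :=
    tendsto_pow_atTop_atTop_of_one_lt one_lt_two
  -- Once the mesh is finer than the first `i + 1` interarrival times, a grid cell before the epoch
  -- contains at most one earlier epoch. After removal of `c t` the increment over a cell is `0` or
  -- a single jump, and `φ 0 = 0` deletes the empty cells. The `4 ^ m` cells of width `2 ^ (-m)`
  -- reach up to `2 ^ m`.
  have hgap : ∀ᶠ m : ℕ in atTop, ∀ l ∈ Finset.range (i + 1), 1 / (2 : ℝ) ^ m < ξ l ω := by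
    rw [Filter.eventually_all_finset]
    intro l _
    have h1 : Tendsto (fun m : ℕ => 1 / (2 : ℝ) ^ m) atTop (𝓝 0) :=
      tendsto_const_nhds.div_atTop htwo
    exact h1.eventually_lt_const (h.pos l)
  filter_upwards [hgap, htwo.eventually_gt_atTop (T (i + 1))] with m hm hm2
  set η : ℝ := 1 / (2 : ℝ) ^ m with hη
  have hη0 : 0 < η := by positivity
  have hdiv : ∀ y : ℝ, y / 2 ^ m = y * η := fun y => by rw [hη]; ring
  simp_rw [hdiv]
  have hN : ∀ k : ℕ, ∃ n, T n ≤ k * η ∧ (k : ℝ) * η < T (n + 1) := fun k =>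
    h.exists_mem_Ico (by positivity)
  choose N hN1 hN2 using hN
  have hD : ∀ k : ℕ, compoundRenewal c ξ Y (k * η) ω - c * (k * η) = jumpSum Y (N k) ω := fun k => by
    rw [h.compoundRenewal_eq (hN1 k) (hN2 k)]; ring
  have hD' : ∀ k : ℕ, compoundRenewal c ξ Y (((k : ℝ) + 1) * η) ω - c * (((k : ℝ) + 1) * η) =
      jumpSum Y (N (k + 1)) ω := fun k => by
    have := hD (k + 1)
    push_cast at this
    exact this
  simp_rw [hD, hD']
  have hsum : ∀ K : ℕ, (K : ℝ) * η < T (i + 1) →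
      ∑ k ∈ Finset.range K, (if ((k : ℝ) + 1) * η < T (i + 1) then
        φ (jumpSum Y (N (k + 1)) ω - jumpSum Y (N k) ω) else 0) =
      ∑ l ∈ Finset.range (N K), φ (Y l ω) := by
    intro K
    induction K with
    | zero =>
      intro _
      have : N 0 = 0 := by
        have h1 := hN1 0
        by_contra h0
        have h2 : T 0 < T (N 0) := h.strictMono (Nat.pos_of_ne_zero h0)
        have h3 : T 0 = 0 := renewalEpoch_zero
        simp at h1
        linarith
      simp [this]
    | succ K ih =>
      intro hK
      have hK1 : ((K : ℝ) + 1) * η < T (i + 1) := by exact_mod_cast hK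
      have hKlt : (K : ℝ) * η < T (i + 1) := by linarith
      rw [Finset.sum_range_succ, ih hKlt, if_pos hK1]
      have hNi : N K < i + 1 := h.strictMono.lt_iff_lt.1 ((hN1 K).trans_lt hKlt)
      have hNi' : N (K + 1) < i + 1 := h.strictMono.lt_iff_lt.1 ((hN1 (K + 1)).trans_lt hK)
      have hle : N K ≤ N (K + 1) := by
        have h1 : T (N K) < T (N (K + 1) + 1) := (hN1 K).trans_lt (lt_of_le_of_lt
          (by push_cast; linarith) (hN2 (K + 1)))
        have := h.strictMono.lt_iff_lt.1 h1
        omega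
      have hle' : N (K + 1) ≤ N K + 1 := by
        by_contra hcon
        have h1 : T (N K + 2) ≤ T (N (K + 1)) := h.strictMono.monotone (by omega)
        have h2 := hN1 (K + 1)
        have h3 := hN2 K
        have h4 : T (N K + 2) = T (N K + 1) + ξ (N K + 1) ω := renewalEpoch_succ _
        have h5 := hm (N K + 1) (Finset.mem_range.2 (by omega))
        push_cast at h2
        linarith
      rcases Nat.lt_or_ge (N K) (N (K + 1)) with h1 | h1
      · have h2 : N (K + 1) = N K + 1 := by omega
        rw [h2, jumpSum_succ, Finset.sum_range_succ, add_sub_cancel_left]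
      · have h2 : N (K + 1) = N K := by omega
        rw [h2, sub_self, hφ, add_zero]
  have hTpos : 0 < T (i + 1) := by
    have h1 : T 0 < T (i + 1) := h.strictMono (Nat.succ_pos i)
    have h3 : T 0 = 0 := renewalEpoch_zero
    linarith
  -- The last grid point strictly before the epoch. The mesh being finer than `ξ i`, this point has
  -- already passed epoch `i`, so exactly the first `i` jumps are seen.
  set K := ⌈T (i + 1) / η⌉₊ - 1 with hK
  have hceil : 0 < ⌈T (i + 1) / η⌉₊ := Nat.ceil_pos.2 (by positivity)
  have hKη : (K : ℝ) * η < T (i + 1) := by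
    have h1 : K < ⌈T (i + 1) / η⌉₊ := by omega
    rwa [Nat.lt_ceil, lt_div_iff₀ hη0] at h1
  have hKη' : T (i + 1) ≤ ((K : ℝ) + 1) * η := by
    have h1 : ⌈T (i + 1) / η⌉₊ ≤ K + 1 := by omega
    rw [Nat.ceil_le, div_le_iff₀ hη0] at h1
    exact_mod_cast h1
  have hNK : N K = i := by
    have h1 : N K < i + 1 := h.strictMono.lt_iff_lt.1 ((hN1 K).trans_lt hKη)
    by_contra h2
    have h3 : T (N K + 1) ≤ T i := h.strictMono.monotone (by omega)
    have h4 : T (i + 1) = T i + ξ i ω := renewalEpoch_succ _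
    have h5 := hm i (Finset.mem_range.2 (by omega))
    have h6 := hN2 K
    linarith
  have hK4 : K ≤ 4 ^ m := by
    have h1 : (K : ℝ) * η < 2 ^ m := hKη.trans hm2
    have h2 : (K : ℝ) < 4 ^ m := by
      rw [hη, mul_one_div, div_lt_iff₀ (by positivity), ← mul_pow] at h1
      norm_num at h1
      exact h1
    exact_mod_cast h2.le
  have h1 := hsum K hKη
  rw [hNK] at h1
  rw [← h1]
  symm
  refine Finset.sum_subset (Finset.range_mono hK4) fun k _ hk => ?_
  rw [Finset.mem_range, not_lt] at hk
  rw [if_neg]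
  rw [not_lt]
  have : (K : ℝ) ≤ k := by exact_mod_cast hk
  nlinarith

end IsRegularPath

end Paths

/-! ### Jumps with values in a given set -/

section Marks

variable {Ω : Type*} {ξ Y : ℕ → Ω → ℝ} {ω : Ω} {U : Set ℝ}

open Classical in
/-- The number of jumps with values in `U` among the first `n` jumps. -/
noncomputable def jumpCount (U : Set ℝ) (Y : ℕ → Ω → ℝ) (n : ℕ) (ω : Ω) : ℕ :=
  Nat.count (fun i => Y i ω ∈ U) n

/-- The index of the jump with value in `U` that is preceded by exactly `j` such jumps. -/
noncomputable def markIndex (U : Set ℝ) (Y : ℕ → Ω → ℝ) (j : ℕ) (ω : Ω) : ℕ :=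
  sInf {i | Y i ω ∈ U ∧ jumpCount U Y i ω = j}

/-- The time from the `i`-th epoch to the first later epoch whose jump has its value in `U`. -/
noncomputable def waitTime (U : Set ℝ) (ξ Y : ℕ → Ω → ℝ) (i : ℕ) (ω : Ω) : ℝ :=
  renewalEpoch ξ (markIndex U Y (jumpCount U Y i ω) ω + 1) ω - renewalEpoch ξ i ω

/-- The first jump with value in `U`, from the index `i` on, is the one with index `i + m`. -/
def gapEvent (U : Set ℝ) (Y : ℕ → Ω → ℝ) (i m : ℕ) : Set Ω :=
  {ω | Y (i + m) ω ∈ U ∧ ∀ l < m, Y (i + l) ω ∉ U}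

lemma jumpCount_zero : jumpCount U Y 0 ω = 0 := by simp [jumpCount]

lemma jumpCount_succ_of_mem {i : ℕ} (h : Y i ω ∈ U) :
    jumpCount U Y (i + 1) ω = jumpCount U Y i ω + 1 := by
  simp [jumpCount, Nat.count_succ, h]

lemma jumpCount_succ_of_notMem {i : ℕ} (h : Y i ω ∉ U) :
    jumpCount U Y (i + 1) ω = jumpCount U Y i ω := by
  simp [jumpCount, Nat.count_succ, h]

lemma jumpCount_mono (U : Set ℝ) (Y : ℕ → Ω → ℝ) (ω : Ω) :
    Monotone fun i => jumpCount U Y i ω := by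
  classical
  exact Nat.count_monotone _

lemma jumpCount_le (i : ℕ) : jumpCount U Y i ω ≤ i := by
  classical
  exact Nat.count_le _

lemma jumpCount_add_compl (i : ℕ) : jumpCount U Y i ω + jumpCount Uᶜ Y i ω = i := by
  induction i with
  | zero => simp [jumpCount_zero]
  | succ i ih =>
    by_cases h : Y i ω ∈ U
    · rw [jumpCount_succ_of_mem h, jumpCount_succ_of_notMem (U := Uᶜ) (fun h' => h' h)]
      omega
    · rw [jumpCount_succ_of_notMem h, jumpCount_succ_of_mem (U := Uᶜ) h]
      omega

lemma jumpCount_eq_sum (i : ℕ) :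
    (jumpCount U Y i ω : ℝ) = ∑ l ∈ Finset.range i, U.indicator 1 (Y l ω) := by
  induction i with
  | zero => simp [jumpCount_zero]
  | succ i ih =>
    rw [Finset.sum_range_succ, ← ih]
    by_cases h : Y i ω ∈ U
    · rw [jumpCount_succ_of_mem h, Set.indicator_of_mem h]; simp
    · rw [jumpCount_succ_of_notMem h, Set.indicator_of_notMem h]; simp

lemma eq_of_jumpCount_eq {i k : ℕ} (hi : Y i ω ∈ U) (hk : Y k ω ∈ U)
    (h : jumpCount U Y i ω = jumpCount U Y k ω) : i = k := by
  have key : ∀ {i k : ℕ}, Y i ω ∈ U → jumpCount U Y i ω = jumpCount U Y k ω → ¬ i < k :=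
    fun {i k} hi h hlt => by
      have h1 := jumpCount_mono U Y ω (Nat.succ_le_of_lt hlt)
      simp only [Nat.succ_eq_add_one, jumpCount_succ_of_mem hi] at h1
      omega
  have h1 := key hi h
  have h2 := key hk h.symm
  omega

lemma markIndex_eq {i j : ℕ} (hi : Y i ω ∈ U) (h : jumpCount U Y i ω = j) :
    markIndex U Y j ω = i := by
  have h1 : {k | Y k ω ∈ U ∧ jumpCount U Y k ω = j} = {i} := by
    ext k
    simp only [Set.mem_ofPred_eq, Set.mem_singleton_iff]
    refine ⟨fun hk => eq_of_jumpCount_eq hk.1 hi (hk.2.trans h.symm), ?_⟩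
    rintro rfl
    exact ⟨hi, h⟩
  rw [markIndex, h1, csInf_singleton]

lemma jumpCount_add_of_forall {i m : ℕ} (h : ∀ l < m, Y (i + l) ω ∉ U) :
    jumpCount U Y (i + m) ω = jumpCount U Y i ω := by
  induction m with
  | zero => rfl
  | succ m ih =>
    rw [← add_assoc, jumpCount_succ_of_notMem (h m m.lt_succ_self),
      ih fun l hl => h l (hl.trans m.lt_succ_self)]

lemma exists_mem_gapEvent (h : ∃ᶠ i in atTop, Y i ω ∈ U) (i : ℕ) : ∃ m, ω ∈ gapEvent U Y i m := by
  classical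
  have h1 : ∃ m, Y (i + m) ω ∈ U := by
    obtain ⟨k, hk, hk'⟩ := (frequently_atTop.1 h) i
    exact ⟨k - i, by rwa [Nat.add_sub_cancel' hk]⟩
  exact ⟨Nat.find h1, Nat.find_spec h1, fun l hl => Nat.find_min h1 hl⟩

lemma markIndex_of_mem_gapEvent {i m : ℕ} (h : ω ∈ gapEvent U Y i m) :
    markIndex U Y (jumpCount U Y i ω) ω = i + m :=
  markIndex_eq h.1 (jumpCount_add_of_forall h.2)

lemma renewalEpoch_add (i n : ℕ) :
    renewalEpoch ξ (i + n) ω = renewalEpoch ξ i ω + ∑ l ∈ Finset.range n, ξ (i + l) ω :=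
  Finset.sum_range_add _ _ _

lemma waitTime_of_mem_gapEvent {i m : ℕ} (h : ω ∈ gapEvent U Y i m) :
    waitTime U ξ Y i ω = ∑ l ∈ Finset.range (m + 1), ξ (i + l) ω := by
  rw [waitTime, markIndex_of_mem_gapEvent h, add_assoc, renewalEpoch_add, add_sub_cancel_left]

lemma pairwise_disjoint_gapEvent (U : Set ℝ) (Y : ℕ → Ω → ℝ) (i : ℕ) :
    Pairwise (Function.onFun Disjoint (gapEvent U Y i)) := by
  intro m n hmn
  refine Set.disjoint_left.2 fun ω hm hn => hmn ?_
  have h1 := markIndex_of_mem_gapEvent hm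
  have h2 := markIndex_of_mem_gapEvent hn
  omega

lemma exists_markIndex (h : ∃ᶠ i in atTop, Y i ω ∈ U) (j : ℕ) :
    Y (markIndex U Y j ω) ω ∈ U ∧ jumpCount U Y (markIndex U Y j ω) ω = j := by
  have key : ∃ i, Y i ω ∈ U ∧ jumpCount U Y i ω = j := by
    induction j with
    | zero =>
      obtain ⟨m, hm⟩ := exists_mem_gapEvent h 0
      exact ⟨0 + m, hm.1, by rw [jumpCount_add_of_forall hm.2, jumpCount_zero]⟩
    | succ j ih =>
      obtain ⟨i, hi, hij⟩ := ih
      obtain ⟨m, hm⟩ := exists_mem_gapEvent h (i + 1)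
      exact ⟨i + 1 + m, hm.1, by
        rw [jumpCount_add_of_forall hm.2, jumpCount_succ_of_mem hi, hij]⟩
  obtain ⟨i, hi, hij⟩ := key
  rw [markIndex_eq hi hij]
  exact ⟨hi, hij⟩

variable [MeasurableSpace Ω]

lemma measurable_renewalEpoch (hξ : ∀ n, Measurable (ξ n)) (n : ℕ) :
    Measurable (renewalEpoch ξ n) :=
  Finset.measurable_sum _ fun i _ => hξ i

lemma measurable_jumpSum (hY : ∀ n, Measurable (Y n)) (n : ℕ) : Measurable (jumpSum Y n) :=
  Finset.measurable_sum _ fun i _ => hY i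

lemma measurable_jumpCount (hY : ∀ n, Measurable (Y n)) (hU : MeasurableSet U) (n : ℕ) :
    Measurable (jumpCount U Y n) := by
  classical
  induction n with
  | zero =>
    have h1 : jumpCount U Y 0 = fun _ => 0 := funext fun ω => jumpCount_zero
    rw [h1]
    exact measurable_const
  | succ n ih =>
    have h1 : jumpCount U Y (n + 1) =
        fun ω => if Y n ω ∈ U then jumpCount U Y n ω + 1 else jumpCount U Y n ω := by
      funext ω
      split_ifs with h
      · exact jumpCount_succ_of_mem h
      · exact jumpCount_succ_of_notMem h
    rw [h1]
    exact Measurable.ite (hY n hU) (ih.add_const 1) ih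

lemma measurableSet_mark (hY : ∀ n, Measurable (Y n)) (hU : MeasurableSet U) (i j : ℕ) :
    MeasurableSet {ω | Y i ω ∈ U ∧ jumpCount U Y i ω = j} :=
  (hY i hU).inter (measurable_jumpCount hY hU i (measurableSet_singleton j))

lemma measurable_markIndex (hY : ∀ n, Measurable (Y n)) (hU : MeasurableSet U) (j : ℕ) :
    Measurable (markIndex U Y j) := by
  have h0 : ∀ i ≠ 0, markIndex U Y j ⁻¹' {i} = {ω | Y i ω ∈ U ∧ jumpCount U Y i ω = j} := by
    intro i hi
    ext ω
    simp only [Set.mem_preimage, Set.mem_singleton_iff, Set.mem_ofPred_eq]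
    refine ⟨fun h => ?_, fun h => markIndex_eq h.1 h.2⟩
    have hne : {k | Y k ω ∈ U ∧ jumpCount U Y k ω = j}.Nonempty := by
      by_contra hempty
      rw [Set.not_nonempty_iff_eq_empty] at hempty
      rw [markIndex, hempty, Nat.sInf_empty] at h
      exact hi h.symm
    have h1 := Nat.sInf_mem hne
    rw [← markIndex, h] at h1
    exact h1
  have h1 : ∀ i ≠ 0, MeasurableSet (markIndex U Y j ⁻¹' {i}) := fun i hi => by
    rw [h0 i hi]
    exact measurableSet_mark hY hU i j
  refine measurable_to_countable' fun i => ?_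
  -- The infimum of the empty set is `0`, so the fibre over `0` also contains the paths without such
  -- a jump; it is obtained as a complement.
  by_cases hi : i = 0
  · have h2 : markIndex U Y j ⁻¹' {i} = (⋃ k : ℕ, markIndex U Y j ⁻¹' {k + 1})ᶜ := by
      ext ω
      simp only [hi, Set.mem_preimage, Set.mem_singleton_iff, Set.mem_compl_iff, Set.mem_iUnion,
        not_exists]
      constructor
      · intro h k
        omega
      · intro h
        by_contra h3
        exact h (markIndex U Y j ω - 1) (by omega)
    rw [h2]
    exact (MeasurableSet.iUnion fun k => h1 _ k.succ_ne_zero).compl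
  · exact h1 i hi

lemma measurable_comp_index {α : Type*} [MeasurableSpace α] {g : ℕ → Ω → α}
    (hg : ∀ n, Measurable (g n)) {ν : Ω → ℕ} (hν : Measurable ν) :
    Measurable fun ω => g (ν ω) ω :=
  (measurable_from_prod_countable_right (f := fun p : ℕ × Ω => g p.1 p.2) hg).comp
    (hν.prodMk measurable_id)

lemma measurable_waitTime (hξ : ∀ n, Measurable (ξ n)) (hY : ∀ n, Measurable (Y n))
    (hU : MeasurableSet U) (i : ℕ) : Measurable (waitTime U ξ Y i) := by
  have h1 : Measurable fun ω => markIndex U Y (jumpCount U Y i ω) ω :=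
    measurable_comp_index (measurable_markIndex hY hU) (measurable_jumpCount hY hU i)
  exact (measurable_comp_index (fun n => measurable_renewalEpoch hξ (n + 1)) h1).sub
    (measurable_renewalEpoch hξ i)

lemma measurableSet_gapEvent (hY : ∀ n, Measurable (Y n)) (hU : MeasurableSet U) (i m : ℕ) :
    MeasurableSet (gapEvent U Y i m) := by
  have h1 : gapEvent U Y i m = Y (i + m) ⁻¹' U ∩ ⋂ l : ℕ, ⋂ _ : l < m, (Y (i + l) ⁻¹' U)ᶜ := by
    ext ω; simp [gapEvent]
  rw [h1]
  exact (hY _ hU).inter (MeasurableSet.iInter fun l => MeasurableSet.iInter fun _ => (hY _ hU).compl)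

end Marks

/-! ### Almost sure properties of the paths and the law of the waiting times -/

namespace IsCompoundRenewalModel

variable {Ω : Type*} [MeasurableSpace Ω] {μ : Measure Ω} [IsProbabilityMeasure μ] {F : Measure ℝ}
  {ξ Y : ℕ → Ω → ℝ} {U : Set ℝ}

lemma isProbabilityMeasure (h : IsCompoundRenewalModel μ F ξ Y) : IsProbabilityMeasure F := by
  rw [← h.law_jump 0]
  exact Measure.isProbabilityMeasure_map (h.measurable_jump 0).aemeasurable

lemma measure_jump_mem (h : IsCompoundRenewalModel μ F ξ Y) (i : ℕ) {s : Set ℝ}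
    (hs : MeasurableSet s) : μ (Y i ⁻¹' s) = F s := by
  rw [← h.law_jump i, Measure.map_apply (h.measurable_jump i) hs]

lemma integral_interarrival_pos (h : IsCompoundRenewalModel μ F ξ Y) : 0 < ∫ ω, ξ 0 ω ∂μ := by
  rw [integral_pos_iff_support_of_nonneg_ae ((h.pos_interarrival 0).mono fun ω hω => hω.le)
    h.integrable_interarrival]
  have h1 : ∀ᵐ ω ∂μ, ω ∈ Function.support (ξ 0) :=
    (h.pos_interarrival 0).mono fun ω hω => hω.ne'
  have h2 : μ (Function.support (ξ 0)) = μ Set.univ := measure_congr (eventuallyEq_univ.2 h1)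
  rw [h2, measure_univ]
  exact one_pos

lemma ae_isRegularPath (h : IsCompoundRenewalModel μ F ξ Y) : ∀ᵐ ω ∂μ, IsRegularPath ξ ω := by
  have h1 := strong_law_ae_real ξ h.integrable_interarrival
    (fun i j hij => h.indep_interarrival.indepFun hij) h.identDistrib_interarrival
  filter_upwards [h1, ae_all_iff.2 h.pos_interarrival] with ω hω hpos
  refine ⟨hpos, ?_⟩
  have h2 := hω.pos_mul_atTop h.integral_interarrival_pos tendsto_natCast_atTop_atTop
  refine h2.congr' ?_
  filter_upwards [eventually_gt_atTop 0] with n hn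
  have : (n : ℝ) ≠ 0 := by positivity
  rw [div_mul_cancel₀ _ this]
  rfl

/-- The strong law for the indicators makes the count of such jumps tend to infinity, whereas it
would stay constant after a last one. -/
lemma ae_frequently_mem (h : IsCompoundRenewalModel μ F ξ Y) (hU : MeasurableSet U)
    (hq : 0 < F.real U) : ∀ᵐ ω ∂μ, ∃ᶠ i in atTop, Y i ω ∈ U := by
  have hm : Measurable (U.indicator (1 : ℝ → ℝ)) := measurable_one.indicator hU
  have hid : ∀ i, IdentDistrib (Y i) (Y 0) μ μ := fun i =>
    ⟨(h.measurable_jump i).aemeasurable, (h.measurable_jump 0).aemeasurable,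
      (h.law_jump i).trans (h.law_jump 0).symm⟩
  have hint : ∫ ω, U.indicator (1 : ℝ → ℝ) (Y 0 ω) ∂μ = F.real U := by
    rw [← integral_map (h.measurable_jump 0).aemeasurable hm.aestronglyMeasurable,
      h.law_jump 0, integral_indicator_one hU]
  have h1 := strong_law_ae_real (fun i ω => U.indicator (1 : ℝ → ℝ) (Y i ω)) ?_
    (fun i j hij => (h.indep_jump.indepFun hij).comp hm hm) fun i => (hid i).comp hm
  · rw [hint] at h1
    filter_upwards [h1] with ω hω
    have h2 := hω.pos_mul_atTop hq tendsto_natCast_atTop_atTop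
    have h3 : Tendsto (fun n => (jumpCount U Y n ω : ℝ)) atTop atTop := by
      refine h2.congr' ?_
      filter_upwards [eventually_gt_atTop 0] with n hn
      have : (n : ℝ) ≠ 0 := by positivity
      rw [div_mul_cancel₀ _ this, jumpCount_eq_sum]
    intro hev
    obtain ⟨N, hN⟩ := eventually_atTop.1 hev
    obtain ⟨n, hn, hn'⟩ := ((eventually_ge_atTop N).and
      (h3.eventually_gt_atTop (jumpCount U Y N ω : ℝ))).exists
    obtain ⟨m, rfl⟩ := Nat.exists_eq_add_of_le hn
    rw [jumpCount_add_of_forall fun l _ => hN _ (Nat.le_add_right N l)] at hn'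
    exact lt_irrefl _ hn'
  · refine Integrable.of_bound (hm.comp (h.measurable_jump 0)).aestronglyMeasurable 1 ?_
    refine Eventually.of_forall fun ω => ?_
    simp only [Set.indicator, Pi.one_apply]
    split_ifs <;> simp

lemma measure_forall_jump (h : IsCompoundRenewalModel μ F ξ Y) (i n : ℕ) {s : ℕ → Set ℝ}
    (hs : ∀ l, MeasurableSet (s l)) :
    μ {ω | ∀ l < n, Y (i + l) ω ∈ s l} = ∏ l ∈ Finset.range n, F (s l) := by
  have h1 := (h.indep_jump.precomp (add_right_injective i)).measure_inter_preimage_eq_mul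
    (Finset.range n) (sets := s) fun l _ => hs l
  rw [Finset.prod_congr rfl fun l _ => h.measure_jump_mem (i + l) (hs l)] at h1
  rw [← h1]
  congr 1
  ext ω
  simp

lemma identDistrib_sum_interarrival (h : IsCompoundRenewalModel μ F ξ Y) (i n : ℕ) :
    IdentDistrib (fun ω => ∑ l ∈ Finset.range n, ξ (i + l) ω) (renewalEpoch ξ n) μ μ := by
  have h1 := IdentDistrib.pi (X := fun l => ξ (i + l)) (Y := ξ)
    (fun l => (h.identDistrib_interarrival _).trans (h.identDistrib_interarrival l).symm)
    (h.indep_interarrival.precomp (add_right_injective i)) h.indep_interarrival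
  exact h1.comp (u := fun v : ℕ → ℝ => ∑ l ∈ Finset.range n, v l)
    (Finset.measurable_sum _ fun l _ => measurable_pi_apply l)

lemma measure_jump_inter_interarrival (h : IsCompoundRenewalModel μ F ξ Y) (i n k m : ℕ)
    {s : ℕ → Set ℝ} (hs : ∀ l, MeasurableSet (s l)) {B : Set ℝ} (hB : MeasurableSet B) :
    μ ({ω | ∀ l < n, Y (i + l) ω ∈ s l} ∩ {ω | ∑ l ∈ Finset.range m, ξ (k + l) ω ∈ B}) =
      (∏ l ∈ Finset.range n, F (s l)) * μ (renewalEpoch ξ m ⁻¹' B) := by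
  have h1 : MeasurableSet {v : ℕ → ℝ | ∀ l < n, v (i + l) ∈ s l} := by
    have : {v : ℕ → ℝ | ∀ l < n, v (i + l) ∈ s l} =
        ⋂ l : ℕ, ⋂ _ : l < n, (fun v : ℕ → ℝ => v (i + l)) ⁻¹' s l := by
      ext v; simp
    rw [this]
    exact MeasurableSet.iInter fun l => MeasurableSet.iInter fun _ => measurable_pi_apply _ (hs l)
  have h2 : Measurable fun v : ℕ → ℝ => ∑ l ∈ Finset.range m, v (k + l) :=
    Finset.measurable_sum _ fun l _ => measurable_pi_apply _
  have h3 := h.indep_interarrival_jump.symm.measure_inter_preimage_eq_mul _ _ h1 (h2 hB)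
  rw [← h.measure_forall_jump i n hs, ← (h.identDistrib_sum_interarrival k m).measure_mem_eq hB]
  exact h3

/-- The event is split according to the index of the next jump in `U`; on each piece the waiting
time is a sum of a fixed number of interarrival times. -/
lemma measure_inter_waitTime (h : IsCompoundRenewalModel μ F ξ Y) (hU : MeasurableSet U)
    (hq : 0 < F.real U) (i : ℕ) {E : Set Ω} (hE : MeasurableSet E) {B : Set ℝ}
    (hB : MeasurableSet B) : μ (E ∩ waitTime U ξ Y i ⁻¹' B) =
      ∑' m, μ (E ∩ gapEvent U Y i m ∩ {ω | ∑ l ∈ Finset.range (m + 1), ξ (i + l) ω ∈ B}) := by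
  rw [← measure_iUnion]
  · refine measure_congr ?_
    filter_upwards [h.ae_frequently_mem hU hq] with ω hω
    refine propext ?_
    change (ω ∈ E ∧ waitTime U ξ Y i ω ∈ B) ↔ ω ∈ ⋃ m, _
    simp only [Set.mem_iUnion, Set.mem_inter_iff, Set.mem_ofPred_eq]
    constructor
    · rintro ⟨h1, h2⟩
      obtain ⟨m, hm⟩ := exists_mem_gapEvent hω i
      exact ⟨m, ⟨h1, hm⟩, by rwa [← waitTime_of_mem_gapEvent hm]⟩
    · rintro ⟨m, ⟨h1, hm⟩, h2⟩
      exact ⟨h1, by rwa [waitTime_of_mem_gapEvent hm]⟩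
  · intro m n hmn
    refine Set.disjoint_left.2 fun ω h1 h2 => ?_
    exact Set.disjoint_left.1 (pairwise_disjoint_gapEvent U Y i hmn) h1.1.2 h2.1.2
  · intro m
    exact (hE.inter (measurableSet_gapEvent h.measurable_jump hU i m)).inter
      (Finset.measurable_sum _ (fun l _ => h.measurable_interarrival (i + l)) hB)

/-- The waiting time is a geometric sum of interarrival times. -/
lemma measure_waitTime (h : IsCompoundRenewalModel μ F ξ Y) (hU : MeasurableSet U)
    (hq : 0 < F.real U) (i : ℕ) {B : Set ℝ} (hB : MeasurableSet B) :
    μ (waitTime U ξ Y i ⁻¹' B) =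
      ∑' m, F Uᶜ ^ m * F U * μ (renewalEpoch ξ (m + 1) ⁻¹' B) := by
  have h1 := h.measure_inter_waitTime hU hq i MeasurableSet.univ hB
  rw [Set.univ_inter] at h1
  rw [h1]
  refine tsum_congr fun m => ?_
  -- A gap of length `m` prescribes `m` jumps outside `U` followed by one in `U`, which gives the
  -- geometric weights.
  have h2 := h.measure_jump_inter_interarrival i (m + 1) i (m + 1)
    (s := fun l => if l < m then Uᶜ else U) (fun l => by split_ifs; exacts [hU.compl, hU]) hB
  rw [Finset.prod_range_succ, Finset.prod_congr rfl (g := fun _ => F Uᶜ)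
    (fun l hl => by rw [if_pos (Finset.mem_range.1 hl)]), Finset.prod_const, Finset.card_range,
    if_neg (lt_irrefl m)] at h2
  rw [← h2, Set.univ_inter]
  congr 2
  ext ω
  simp only [gapEvent, Set.mem_ofPred_eq]
  constructor
  · rintro ⟨h3, h4⟩ l hl
    split_ifs with hlm
    · exact h4 l hlm
    · obtain rfl : l = m := by omega
      exact h3
  · intro h3
    refine ⟨by simpa using h3 m m.lt_succ_self, fun l hl => ?_⟩
    have := h3 l (hl.trans m.lt_succ_self)
    rwa [if_pos hl] at this

/-- A jump and the waiting time after it are independent. -/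
lemma measure_jump_inter_waitTime (h : IsCompoundRenewalModel μ F ξ Y) (hU : MeasurableSet U)
    (hq : 0 < F.real U) (i : ℕ) {A B : Set ℝ} (hA : MeasurableSet A) (hB : MeasurableSet B) :
    μ (Y i ⁻¹' A ∩ waitTime U ξ Y (i + 1) ⁻¹' B) = F A * μ (waitTime U ξ Y 0 ⁻¹' B) := by
  rw [h.measure_inter_waitTime hU hq _ (h.measurable_jump i hA) hB, h.measure_waitTime hU hq 0 hB,
    ← ENNReal.tsum_mul_left]
  refine tsum_congr fun m => ?_
  have h2 := h.measure_jump_inter_interarrival i (m + 1 + 1) (i + 1) (m + 1)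
    (s := fun l => if l = 0 then A else if l < m + 1 then Uᶜ else U)
    (fun l => by split_ifs; exacts [hA, hU.compl, hU]) hB
  rw [Finset.prod_range_succ, Finset.prod_range_succ', Finset.prod_congr rfl (g := fun _ => F Uᶜ)
    (fun l hl => by
      rw [if_neg l.succ_ne_zero, if_pos (Nat.succ_lt_succ (Finset.mem_range.1 hl))]),
    Finset.prod_const, Finset.card_range, if_pos rfl, if_neg m.succ_ne_zero,
    if_neg (lt_irrefl _)] at h2
  have h3 : F A * (F Uᶜ ^ m * F U * μ (renewalEpoch ξ (m + 1) ⁻¹' B)) =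
      F Uᶜ ^ m * F A * F U * μ (renewalEpoch ξ (m + 1) ⁻¹' B) := by ring
  rw [h3, ← h2]
  congr 2
  ext ω
  simp only [gapEvent, Set.mem_ofPred_eq, Set.mem_inter_iff, Set.mem_preimage]
  constructor
  · rintro ⟨h0, h3, h4⟩ l hl
    split_ifs with hl0 hlm
    · rw [hl0]; exact h0
    · obtain ⟨l, rfl⟩ := Nat.exists_eq_succ_of_ne_zero hl0
      have := h4 l (by omega)
      rwa [show i + 1 + l = i + l.succ by omega] at this
    · obtain rfl : l = m + 1 := by omega
      rwa [show i + 1 + m = i + (m + 1) by omega] at h3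
  · intro h3
    refine ⟨by simpa using h3 0 (by omega), ?_, fun l hl => ?_⟩
    · have := h3 (m + 1) (by omega)
      rwa [if_neg m.succ_ne_zero, if_neg (lt_irrefl _),
        show i + (m + 1) = i + 1 + m by omega] at this
    · have := h3 (l + 1) (by omega)
      rwa [if_neg l.succ_ne_zero, if_pos (by omega),
        show i + (l + 1) = i + 1 + l by omega] at this

lemma map_jump_waitTime (h : IsCompoundRenewalModel μ F ξ Y) (hU : MeasurableSet U)
    (hq : 0 < F.real U) (i : ℕ) :
    μ.map (fun ω => (Y i ω, waitTime U ξ Y (i + 1) ω)) = F.prod (μ.map (waitTime U ξ Y 0)) := by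
  have := h.isProbabilityMeasure
  have hw := measurable_waitTime h.measurable_interarrival h.measurable_jump hU
  have : IsProbabilityMeasure (μ.map (waitTime U ξ Y 0)) :=
    Measure.isProbabilityMeasure_map (hw 0).aemeasurable
  refine (Measure.prod_eq fun A B hA hB => ?_).symm
  rw [Measure.map_apply ((h.measurable_jump i).prodMk (hw _)) (hA.prod hB),
    Measure.map_apply (hw 0) hB, ← h.measure_jump_inter_waitTime hU hq i hA hB]
  rfl

end IsCompoundRenewalModel

/-! ### The mean waiting time and the law of a mark -/

namespace IsCompoundRenewalModel

variable {Ω : Type*} [MeasurableSpace Ω] {μ : Measure Ω} [IsProbabilityMeasure μ] {F : Measure ℝ}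
  {ξ Y : ℕ → Ω → ℝ} {U : Set ℝ}

lemma waitTime_zero_nonneg (h : IsCompoundRenewalModel μ F ξ Y) :
    ∀ᵐ ω ∂μ, ∀ i, (∃ᶠ i in atTop, Y i ω ∈ U) → 0 ≤ waitTime U ξ Y i ω := by
  filter_upwards [h.ae_isRegularPath] with ω hω i hf
  obtain ⟨m, hm⟩ := exists_mem_gapEvent hf i
  rw [waitTime_of_mem_gapEvent hm]
  exact Finset.sum_nonneg fun l _ => (hω.pos _).le

/-- Wald's identity: `ξ l` belongs to the wait exactly when none of the first `l` jumps lies in `U`.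
This event is independent of the interarrival times, and the geometric series of its probabilities
sums to `1 / F U`. -/
lemma lintegral_waitTime (h : IsCompoundRenewalModel μ F ξ Y) (hU : MeasurableSet U)
    (hq : 0 < F.real U) : ∫⁻ ω, ENNReal.ofReal (waitTime U ξ Y 0 ω) ∂μ =
      (∫⁻ ω, ENNReal.ofReal (ξ 0 ω) ∂μ) * (F U)⁻¹ := by
  classical
  have := h.isProbabilityMeasure
  have hset : ∀ l : ℕ, MeasurableSet {v : ℕ → ℝ | ∀ k < l, v k ∉ U} := fun l => by
    have : {v : ℕ → ℝ | ∀ k < l, v k ∉ U} =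
        ⋂ k : ℕ, ⋂ _ : k < l, (fun v : ℕ → ℝ => v k) ⁻¹' Uᶜ := by
      ext v; simp
    rw [this]
    exact MeasurableSet.iInter fun l => MeasurableSet.iInter fun _ =>
      measurable_pi_apply _ hU.compl
  have hY : Measurable fun ω n => Y n ω := measurable_pi_lambda _ h.measurable_jump
  have h1 : ∀ᵐ ω ∂μ, ENNReal.ofReal (waitTime U ξ Y 0 ω) =
      ∑' l, ENNReal.ofReal (ξ l ω) *
        {v : ℕ → ℝ | ∀ k < l, v k ∉ U}.indicator 1 (fun n => Y n ω) := by
    filter_upwards [h.ae_isRegularPath, h.ae_frequently_mem hU hq] with ω hω hf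
    obtain ⟨m, hm⟩ := exists_mem_gapEvent hf 0
    rw [waitTime_of_mem_gapEvent hm, ENNReal.ofReal_sum_of_nonneg fun l _ => (hω.pos _).le,
      tsum_eq_sum (s := Finset.range (m + 1))]
    · refine Finset.sum_congr rfl fun l hl => ?_
      rw [Set.indicator_of_mem, Pi.one_apply, mul_one, zero_add]
      intro k hk
      have := hm.2 k (by have := Finset.mem_range.1 hl; omega)
      rwa [zero_add] at this
    · intro l hl
      rw [Set.indicator_of_notMem, mul_zero]
      intro hcon
      have := hm.1
      rw [zero_add] at this
      exact hcon m (by rw [Finset.mem_range] at hl; omega) this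
  rw [lintegral_congr_ae h1, lintegral_tsum]
  · have h2 : ∀ l : ℕ, ∫⁻ ω, ENNReal.ofReal (ξ l ω) *
        {v : ℕ → ℝ | ∀ k < l, v k ∉ U}.indicator 1 (fun n => Y n ω) ∂μ =
        (∫⁻ ω, ENNReal.ofReal (ξ 0 ω) ∂μ) * F Uᶜ ^ l := fun l => by
      have hind : IndepFun (fun ω => ENNReal.ofReal (ξ l ω))
          (fun ω => {v : ℕ → ℝ | ∀ k < l, v k ∉ U}.indicator (1 : (ℕ → ℝ) → ℝ≥0∞)
            (fun n => Y n ω)) μ :=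
        h.indep_interarrival_jump.comp (φ := fun v : ℕ → ℝ => ENNReal.ofReal (v l))
          (measurable_pi_apply l).ennreal_ofReal (measurable_one.indicator (hset l))
      have h3 := lintegral_mul_eq_lintegral_mul_lintegral_of_indepFun
        (h.measurable_interarrival l).ennreal_ofReal
        ((measurable_one.indicator (hset l)).comp hY) hind
      refine h3.trans ?_
      congr 1
      · exact ((h.identDistrib_interarrival l).comp ENNReal.measurable_ofReal).lintegral_eq
      · have h4 : (fun ω => {v : ℕ → ℝ | ∀ k < l, v k ∉ U}.indicator (1 : (ℕ → ℝ) → ℝ≥0∞)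
            (fun n => Y n ω)) = {ω | ∀ k < l, Y (0 + k) ω ∈ Uᶜ}.indicator 1 := by
          funext ω
          simp [Set.indicator]
        have h5 := h.measure_forall_jump 0 l (s := fun _ => Uᶜ) fun _ => hU.compl
        rw [Finset.prod_const, Finset.card_range] at h5
        rw [← h5, ← lintegral_indicator_one]
        · exact congrArg (lintegral μ) h4
        · have : {ω | ∀ k < l, Y (0 + k) ω ∈ Uᶜ} = (fun ω n => Y n ω) ⁻¹'
              {v : ℕ → ℝ | ∀ k < l, v k ∉ U} := by
            ext ω; simp
          rw [this]
          exact hY (hset l)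
    simp_rw [h2]
    rw [ENNReal.tsum_mul_left, ENNReal.tsum_geometric, prob_compl_eq_one_sub hU,
      ENNReal.sub_sub_cancel ENNReal.one_ne_top prob_le_one]
  · intro l
    exact ((h.measurable_interarrival l).ennreal_ofReal.mul
      ((measurable_one.indicator (hset l)).comp hY)).aemeasurable

lemma integrable_waitTime (h : IsCompoundRenewalModel μ F ξ Y) (hU : MeasurableSet U)
    (hq : 0 < F.real U) : Integrable (waitTime U ξ Y 0) μ ∧
      ∫ ω, waitTime U ξ Y 0 ω ∂μ = (∫ ω, ξ 0 ω ∂μ) / F.real U := by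
  have := h.isProbabilityMeasure
  have hw := measurable_waitTime h.measurable_interarrival h.measurable_jump hU 0
  have hnn : 0 ≤ᵐ[μ] waitTime U ξ Y 0 := by
    filter_upwards [h.waitTime_zero_nonneg (U := U), h.ae_frequently_mem hU hq] with ω h1 h2
    exact h1 0 h2
  have hξ0 : 0 ≤ᵐ[μ] ξ 0 := (h.pos_interarrival 0).mono fun ω hω => hω.le
  have hqne : F U ≠ 0 := fun h0 => by simp [Measure.real, h0] at hq
  have hξ : ∫⁻ ω, ENNReal.ofReal (ξ 0 ω) ∂μ ≠ ∞ :=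
    ((hasFiniteIntegral_iff_ofReal hξ0).1 h.integrable_interarrival.2).ne
  have h1 := h.lintegral_waitTime hU hq
  have hfin : ∫⁻ ω, ENNReal.ofReal (waitTime U ξ Y 0 ω) ∂μ ≠ ∞ := by
    rw [h1]
    exact ENNReal.mul_ne_top hξ (ENNReal.inv_ne_top.2 hqne)
  have hint : Integrable (waitTime U ξ Y 0) μ :=
    ⟨hw.aestronglyMeasurable, (hasFiniteIntegral_iff_ofReal hnn).2 hfin.lt_top⟩
  refine ⟨hint, ?_⟩
  rw [integral_eq_lintegral_of_nonneg_ae hnn hw.aestronglyMeasurable,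
    integral_eq_lintegral_of_nonneg_ae hξ0 (h.measurable_interarrival 0).aestronglyMeasurable,
    h1, ENNReal.toReal_mul, ENNReal.toReal_inv]
  rfl

end IsCompoundRenewalModel

/-- The joint law of a jump with value in `U` and the waiting time to the next such jump. -/
noncomputable def markLaw {Ω : Type*} [MeasurableSpace Ω] (μ : Measure Ω) (F : Measure ℝ)
    (U : Set ℝ) (ξ Y : ℕ → Ω → ℝ) : Measure (ℝ × ℝ) :=
  (ProbabilityTheory.cond F U).prod (μ.map (waitTime U ξ Y 0))

namespace IsCompoundRenewalModel

variable {Ω : Type*} [MeasurableSpace Ω] {μ : Measure Ω} [IsProbabilityMeasure μ] {F : Measure ℝ}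
  {ξ Y : ℕ → Ω → ℝ} {U : Set ℝ}

lemma isProbabilityMeasure_map_waitTime (h : IsCompoundRenewalModel μ F ξ Y)
    (hU : MeasurableSet U) : IsProbabilityMeasure (μ.map (waitTime U ξ Y 0)) :=
  Measure.isProbabilityMeasure_map
    (measurable_waitTime h.measurable_interarrival h.measurable_jump hU 0).aemeasurable

lemma isProbabilityMeasure_cond (hq : 0 < F.real U) [IsProbabilityMeasure F] :
    IsProbabilityMeasure (ProbabilityTheory.cond F U) :=
  cond_isProbabilityMeasure fun h0 => by simp [Measure.real, h0] at hq

lemma isProbabilityMeasure_markLaw (h : IsCompoundRenewalModel μ F ξ Y) (hU : MeasurableSet U)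
    (hq : 0 < F.real U) : IsProbabilityMeasure (markLaw μ F U ξ Y) := by
  have := h.isProbabilityMeasure
  have := h.isProbabilityMeasure_map_waitTime hU
  have := isProbabilityMeasure_cond (F := F) hq
  unfold markLaw
  infer_instance

lemma measure_mul_markLaw (h : IsCompoundRenewalModel μ F ξ Y) (hU : MeasurableSet U)
    (hq : 0 < F.real U) {t : Set (ℝ × ℝ)} (ht : MeasurableSet t) :
    F U * markLaw μ F U ξ Y t =
      (F.prod (μ.map (waitTime U ξ Y 0))) (t ∩ U ×ˢ Set.univ) := by
  have := h.isProbabilityMeasure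
  have := h.isProbabilityMeasure_map_waitTime hU
  have hqne : F U ≠ 0 := fun h0 => by simp [Measure.real, h0] at hq
  have h1 : markLaw μ F U ξ Y = (F U)⁻¹ •
      (F.prod (μ.map (waitTime U ξ Y 0))).restrict (U ×ˢ Set.univ) := by
    rw [markLaw, ProbabilityTheory.cond, ← Measure.prod_restrict, Measure.restrict_univ,
      Measure.prod_smul_left]
  rw [h1, Measure.smul_apply, smul_eq_mul, Measure.restrict_apply ht, ← mul_assoc,
    ENNReal.mul_inv_cancel hqne (measure_ne_top F U), one_mul]

lemma ae_markLaw_nonneg (h : IsCompoundRenewalModel μ F ξ Y) (hU : MeasurableSet U)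
    (hq : 0 < F.real U) : ∀ᵐ w ∂(markLaw μ F U ξ Y), 0 ≤ w.2 := by
  have := h.isProbabilityMeasure
  have := h.isProbabilityMeasure_map_waitTime hU
  have := isProbabilityMeasure_cond (F := F) hq
  have hw := measurable_waitTime h.measurable_interarrival h.measurable_jump hU 0
  have h1 : ∀ᵐ g ∂(μ.map (waitTime U ξ Y 0)), 0 ≤ g := by
    rw [ae_map_iff hw.aemeasurable measurableSet_Ici]
    filter_upwards [h.waitTime_zero_nonneg (U := U), h.ae_frequently_mem hU hq] with ω h1 h2
    exact h1 0 h2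
  unfold markLaw
  exact Measure.quasiMeasurePreserving_snd.ae h1

lemma integrable_cond_id (h : IsCompoundRenewalModel μ F ξ Y)
    (hq : 0 < F.real U) (hU0 : ∀ y ∉ U, y = 0) :
    Integrable (fun y : ℝ => y) (ProbabilityTheory.cond F U) ∧
      ∫ y, y ∂(ProbabilityTheory.cond F U) = (∫ ω, Y 0 ω ∂μ) / F.real U := by
  have hF : Integrable (fun y : ℝ => y) F := by
    rw [← h.law_jump 0]
    exact (integrable_map_measure measurable_id.aestronglyMeasurable
      (h.measurable_jump 0).aemeasurable).2 h.integrable_jump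
  have hqne : F U ≠ 0 := fun h0 => by simp [Measure.real, h0] at hq
  refine ⟨hF.restrict.smul_measure (ENNReal.inv_ne_top.2 hqne), ?_⟩
  rw [ProbabilityTheory.cond, integral_smul_measure,
    setIntegral_eq_integral_of_forall_compl_eq_zero hU0, ← h.law_jump 0,
    integral_map (f := fun y : ℝ => y) (h.measurable_jump 0).aemeasurable
      measurable_id.aestronglyMeasurable, ENNReal.toReal_inv, smul_eq_mul, div_eq_inv_mul]
  rfl

/-- The drift of the increments between jumps with values in `U`. -/
lemma integrable_markLaw (h : IsCompoundRenewalModel μ F ξ Y) (hU : MeasurableSet U)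
    (hq : 0 < F.real U) (hU0 : ∀ y ∉ U, y = 0) {c a : ℝ}
    (hdrift : ∫ ω, (c * ξ 0 ω + Y 0 ω) ∂μ = -a) :
    Integrable (fun w : ℝ × ℝ => w.1 + c * w.2) (markLaw μ F U ξ Y) ∧
      ∫ w, (w.1 + c * w.2) ∂(markLaw μ F U ξ Y) = -(a / F.real U) := by
  have := h.isProbabilityMeasure
  have := h.isProbabilityMeasure_map_waitTime hU
  have := isProbabilityMeasure_cond (F := F) hq
  have hw := measurable_waitTime h.measurable_interarrival h.measurable_jump hU 0
  obtain ⟨h1, h2⟩ := h.integrable_cond_id hq hU0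
  obtain ⟨h3, h4⟩ := h.integrable_waitTime hU hq
  have h3' : Integrable (fun g : ℝ => g) (μ.map (waitTime U ξ Y 0)) :=
    (integrable_map_measure measurable_id.aestronglyMeasurable hw.aemeasurable).2 h3
  have h4' : ∫ g, g ∂(μ.map (waitTime U ξ Y 0)) = (∫ ω, ξ 0 ω ∂μ) / F.real U := by
    rw [integral_map (f := fun y : ℝ => y) hw.aemeasurable measurable_id.aestronglyMeasurable, h4]
  have h5 : Integrable (fun w : ℝ × ℝ => w.1) (markLaw μ F U ξ Y) := h1.comp_fst _
  have h6 : Integrable (fun w : ℝ × ℝ => c * w.2) (markLaw μ F U ξ Y) :=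
    (h3'.comp_snd _).const_mul c
  refine ⟨h5.add h6, ?_⟩
  rw [integral_add h5 h6, integral_const_mul]
  unfold markLaw
  rw [integral_fun_fst (fun y : ℝ => y), integral_fun_snd (fun y : ℝ => y), h2, h4']
  rw [integral_add (h.integrable_interarrival.const_mul c) h.integrable_jump,
    integral_const_mul] at hdrift
  simp only [probReal_univ, one_smul]
  rw [← neg_div, ← hdrift]
  ring

end IsCompoundRenewalModel

/-! ### The past and the future of an epoch -/

/-- The path moves along a line of slope `c` exactly until the next nonzero jump, so this waiting
time can be read off the increments. A single interarrival time cannot, because zero jumps are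
invisible. -/
lemma IsRegularPath.le_waitTime_iff {Ω : Type*} {ξ Y : ℕ → Ω → ℝ} {ω : Ω} {c : ℝ}
    (h : IsRegularPath ξ ω) (hf : ∃ᶠ i in atTop, Y i ω ∈ ({0}ᶜ : Set ℝ)) (i : ℕ) (s : ℝ) :
    s ≤ waitTime {0}ᶜ ξ Y i ω ↔ ∀ r : ℚ, 0 ≤ r → (r : ℝ) < s →
      compoundRenewal c ξ Y (renewalEpoch ξ i ω + r) ω -
        compoundRenewal c ξ Y (renewalEpoch ξ i ω) ω = c * r := by
  obtain ⟨m, hm⟩ := exists_mem_gapEvent hf i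
  have hg : waitTime {0}ᶜ ξ Y i ω = renewalEpoch ξ (i + m + 1) ω - renewalEpoch ξ i ω := by
    rw [waitTime_of_mem_gapEvent hm, add_assoc, renewalEpoch_add, add_sub_cancel_left]
  have hsum : ∀ l ≤ m, jumpSum Y (i + l) ω = jumpSum Y i ω := by
    intro l hl
    induction l with
    | zero => rfl
    | succ l ih =>
      have h0 : Y (i + l) ω = 0 := by simpa using hm.2 l hl
      rw [← add_assoc, jumpSum_succ, ih (by omega), h0, add_zero]
  have hXi := h.compoundRenewal_eq (c := c) (Y := Y) (n := i) le_rfl (h.strictMono i.lt_succ_self)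
  rw [hg, hXi]
  constructor
  · intro hs r hr hrs
    have hr' : (0 : ℝ) ≤ r := by exact_mod_cast hr
    obtain ⟨n, hn1, hn2⟩ := h.exists_mem_Ico (add_nonneg (h.nonneg i) hr')
    have h1 : i < n + 1 :=
      h.strictMono.lt_iff_lt.1 ((le_add_of_nonneg_right hr').trans_lt hn2)
    have h2 : n < i + m + 1 := h.strictMono.lt_iff_lt.1 (hn1.trans_lt (by linarith))
    obtain ⟨l, rfl⟩ := Nat.exists_eq_add_of_le (Nat.le_of_lt_succ h1)
    rw [h.compoundRenewal_eq hn1 hn2, hsum l (by omega)]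
    ring
  · intro hs
    by_contra hlt
    rw [not_le] at hlt
    have h1 : renewalEpoch ξ (i + m + 1) ω < renewalEpoch ξ (i + m + 2) ω :=
      h.strictMono (by omega)
    have h0 : renewalEpoch ξ i ω ≤ renewalEpoch ξ (i + m + 1) ω := h.strictMono.monotone (by omega)
    obtain ⟨r, hr1, hr2⟩ := exists_rat_btwn
      (lt_min hlt (sub_lt_sub_right h1 (renewalEpoch ξ i ω)))
    have hr0 : (0 : ℝ) ≤ r := by linarith
    have h3 := hs r (by exact_mod_cast hr0) (hr2.trans_le (min_le_left _ _))
    have h4 := hr2.trans_le (min_le_right _ _)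
    rw [h.compoundRenewal_eq (n := i + m + 1) (by linarith) (by linarith), jumpSum_succ,
      hsum m le_rfl] at h3
    exact hm.1 (Set.mem_singleton_iff.2 (by linarith))

/-! ### What the path before and after an epoch determines -/

section PathMeasurability

variable {Ω : Type*} {X : ℝ → Ω → ℝ} {T : Ω → ℝ}

lemma measurableSet_sigmaBefore {s : ℝ} (hs : 0 ≤ s) {B : Set ℝ} (hB : MeasurableSet B) :
    MeasurableSet[sigmaBefore X T] {ω | s < T ω ∧ X s ω ∈ B} :=
  MeasurableSpace.measurableSet_generateFrom ⟨s, hs, B, hB, rfl⟩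

lemma measurableSet_sigmaBefore_lt {s : ℝ} (hs : 0 ≤ s) :
    MeasurableSet[sigmaBefore X T] {ω | s < T ω} := by
  have h1 := measurableSet_sigmaBefore (X := X) (T := T) hs MeasurableSet.univ
  simpa using h1

open Classical in
lemma measurable_sigmaBefore {s : ℝ} (hs : 0 ≤ s) :
    Measurable[sigmaBefore X T] fun ω => if s < T ω then X s ω else 0 := by
  intro B hB
  have h1 : (fun ω => if s < T ω then X s ω else 0) ⁻¹' B =
      {ω | s < T ω ∧ X s ω ∈ B} ∪ ({ω | s < T ω}ᶜ ∩ {_ω | (0 : ℝ) ∈ B}) := by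
    ext ω
    by_cases h : s < T ω <;> simp [h]
  rw [h1]
  exact (measurableSet_sigmaBefore hs hB).union
    ((measurableSet_sigmaBefore_lt hs).compl.inter (MeasurableSet.const _))

lemma measurableSet_sigmaBefore_forall_rat (x : ℝ) :
    MeasurableSet[sigmaBefore X T]
      {ω | ∀ s : ℚ, 0 ≤ s → (s : ℝ) < T ω → X s ω ≤ x} := by
  have h1 : {ω | ∀ s : ℚ, 0 ≤ s → (s : ℝ) < T ω → X s ω ≤ x} =
      ⋂ s : ℚ, ⋂ _ : 0 ≤ s, {ω | (s : ℝ) < T ω ∧ X s ω ∈ Set.Ioi x}ᶜ := by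
    ext ω
    simp
  rw [h1]
  exact MeasurableSet.iInter fun s => MeasurableSet.iInter fun hs =>
    (measurableSet_sigmaBefore (by exact_mod_cast hs) measurableSet_Ioi).compl

open Classical in
lemma measurable_sigmaBefore_grid (c : ℝ) {φ : ℝ → ℝ} (hφ : Measurable φ) (m : ℕ) :
    Measurable[sigmaBefore X T] fun ω => ∑ k ∈ Finset.range (4 ^ m),
      (if ((k : ℝ) + 1) / 2 ^ m < T ω then
        φ ((X (((k : ℝ) + 1) / 2 ^ m) ω - c * (((k : ℝ) + 1) / 2 ^ m)) -
          (X ((k : ℝ) / 2 ^ m) ω - c * ((k : ℝ) / 2 ^ m))) else 0) := by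
  refine Finset.measurable_sum _ fun k _ => ?_
  set s : ℝ := ((k : ℝ) + 1) / 2 ^ m
  set r : ℝ := (k : ℝ) / 2 ^ m
  have hr : 0 ≤ r := by positivity
  have hrs : r ≤ s := by
    change (k : ℝ) / 2 ^ m ≤ ((k : ℝ) + 1) / 2 ^ m
    gcongr
    linarith
  have h1 : (fun ω => if s < T ω then φ ((X s ω - c * s) - (X r ω - c * r)) else 0) =
      fun ω => if s < T ω then φ (((if s < T ω then X s ω else 0) - c * s) -
        ((if r < T ω then X r ω else 0) - c * r)) else 0 := by
    funext ω
    by_cases h : s < T ω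
    · simp only [h, hrs.trans_lt h, if_true]
    · simp only [h, if_false]
  rw [h1]
  exact Measurable.ite (measurableSet_sigmaBefore_lt (hr.trans hrs))
    (hφ.comp (((measurable_sigmaBefore (hr.trans hrs)).sub_const _).sub
      ((measurable_sigmaBefore hr).sub_const _))) measurable_const

lemma measurable_sigmaIncrementsFrom {u : ℝ} (hu : 0 ≤ u) :
    Measurable[sigmaIncrementsFrom X T]
      fun ω => X (T ω + u) ω - Function.leftLim (fun t => X t ω) (T ω) := by
  have h1 : @Measurable Ω ℝ (MeasurableSpace.comap
      (fun ω => X (T ω + u) ω - Function.leftLim (fun t => X t ω) (T ω)) (borel ℝ)) (borel ℝ)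
      fun ω => X (T ω + u) ω - Function.leftLim (fun t => X t ω) (T ω) := comap_measurable _
  rw [← BorelSpace.measurable_eq (α := ℝ)] at h1
  refine h1.mono ?_ le_rfl
  exact le_iSup (fun u : {u : ℝ // 0 ≤ u} => MeasurableSpace.comap
    (fun ω => X (T ω + u) ω - Function.leftLim (fun t => X t ω) (T ω)) (borel ℝ)) ⟨u, hu⟩

/-- Null sets do not affect independence. Hence it is enough to recover states, counts and marks
from the path almost surely. -/
lemma indep_eventuallyMeasurableSpace [MeasurableSpace Ω] {μ : Measure Ω}
    {m₁ m₂ : MeasurableSpace Ω} (h : Indep m₁ m₂ μ) :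
    Indep (eventuallyMeasurableSpace m₁ (ae μ)) (eventuallyMeasurableSpace m₂ (ae μ)) μ := by
  rw [Indep_iff] at h ⊢
  rintro s t ⟨s', hs', hss'⟩ ⟨t', ht', htt'⟩
  rw [measure_congr hss', measure_congr htt', measure_congr (hss'.inter htt'), h _ _ hs' ht']

end PathMeasurability

/-- The completed sigma-algebra of the path before an epoch and of the comparison of the epoch with
a random time. -/
@[reducible] def pastSpace {Ω : Type*} [MeasurableSpace Ω] (μ : Measure Ω) (X : ℝ → Ω → ℝ)
    (T : Ω → ℝ) (τ : Ω → ℝ≥0∞) : MeasurableSpace Ω :=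
  eventuallyMeasurableSpace (sigmaBefore X T ⊔
    MeasurableSpace.generateFrom {{ω | τ ω < ENNReal.ofReal (T ω)}}) (ae μ)

namespace IsCompoundRenewalModel

variable {Ω : Type*} [MeasurableSpace Ω] {μ : Measure Ω} [IsProbabilityMeasure μ] {F : Measure ℝ}
  {ξ Y : ℕ → Ω → ℝ} {U : Set ℝ}

lemma measurableSet_past_of_ae {X : ℝ → Ω → ℝ} {T : Ω → ℝ} {τ : Ω → ℝ≥0∞} {s t : Set Ω}
    (hs : MeasurableSet[sigmaBefore X T] s) (hts : t =ᵐ[μ] s) :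
    MeasurableSet[pastSpace μ X T τ] t :=
  ⟨s, le_sup_left (a := sigmaBefore X T) _ hs, hts⟩

lemma measurable_past_of_ae {X : ℝ → Ω → ℝ} {T : Ω → ℝ} {τ : Ω → ℝ≥0∞} {f g : Ω → ℝ}
    (hf : Measurable[sigmaBefore X T] f) (hgf : g =ᵐ[μ] f) :
    Measurable[pastSpace μ X T τ] g :=
  Measurable.eventuallyMeasurable_of_eventuallyEq
    (hf.mono (le_sup_left (a := sigmaBefore X T)) le_rfl) hgf

lemma measurableSet_past_le {X : ℝ → Ω → ℝ} {T : Ω → ℝ} {τ : Ω → ℝ≥0∞} :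
    MeasurableSet[pastSpace μ X T τ] {ω | ENNReal.ofReal (T ω) ≤ τ ω} := by
  have h1 : MeasurableSet[sigmaBefore X T ⊔
      MeasurableSpace.generateFrom {{ω | τ ω < ENNReal.ofReal (T ω)}}]
      {ω | τ ω < ENNReal.ofReal (T ω)} :=
    le_sup_right (a := sigmaBefore X T) _
      (MeasurableSpace.measurableSet_generateFrom (Set.mem_singleton _))
  refine ⟨_, h1.compl, ?_⟩
  refine Eventually.of_forall fun ω => propext ?_
  change ENNReal.ofReal (T ω) ≤ τ ω ↔ ¬ τ ω < ENNReal.ofReal (T ω)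
  rw [not_lt]

lemma measurable_past_epoch (h : IsCompoundRenewalModel μ F ξ Y) (c : ℝ)
    (τ : Ω → ℝ≥0∞) (i : ℕ) :
    Measurable[pastSpace μ (compoundRenewal c ξ Y) (renewalEpoch ξ (i + 1)) τ]
      (renewalEpoch ξ (i + 1)) := by
  refine measurable_of_Ioi fun s => ?_
  rcases le_or_gt 0 s with hs | hs
  · exact measurableSet_past_of_ae (measurableSet_sigmaBefore_lt hs) (ae_eq_refl _)
  · refine measurableSet_past_of_ae MeasurableSet.univ ?_
    rw [eventuallyEq_univ]
    filter_upwards [h.ae_isRegularPath] with ω hω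
    exact hs.trans_le (hω.nonneg _)

/-- The sum over the jumps is almost surely the eventual value of the grid sums, each of which
depends only on the path before the epoch. -/
lemma measurable_past_sum (h : IsCompoundRenewalModel μ F ξ Y) (c : ℝ)
    (τ : Ω → ℝ≥0∞) (i : ℕ) {φ : ℝ → ℝ} (hφ : Measurable φ) (hφ0 : φ 0 = 0) :
    Measurable[pastSpace μ (compoundRenewal c ξ Y) (renewalEpoch ξ (i + 1)) τ]
      fun ω => ∑ l ∈ Finset.range i, φ (Y l ω) := by
  have h1 := fun m => measurable_sigmaBefore_grid (X := compoundRenewal c ξ Y)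
    (T := renewalEpoch ξ (i + 1)) c hφ m
  refine measurable_past_of_ae (Measurable.limsup h1) ?_
  filter_upwards [h.ae_isRegularPath] with ω hω
  have h2 := hω.eventually_grid_sum_eq (c := c) (Y := Y) hφ0 i
  exact ((limsup_congr h2).trans (limsup_const _)).symm

lemma measurable_past_state (h : IsCompoundRenewalModel μ F ξ Y) (c : ℝ)
    (τ : Ω → ℝ≥0∞) (i : ℕ) :
    Measurable[pastSpace μ (compoundRenewal c ξ Y) (renewalEpoch ξ (i + 1)) τ]
      fun ω => jumpSum Y i ω + c * renewalEpoch ξ (i + 1) ω :=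
  (h.measurable_past_sum c τ i measurable_id rfl).add ((h.measurable_past_epoch c τ i).const_mul c)

lemma measurableSet_past_jumpCount (h : IsCompoundRenewalModel μ F ξ Y) (c : ℝ)
    (τ : Ω → ℝ≥0∞) (i : ℕ) (hU : MeasurableSet U) (hU0 : (0 : ℝ) ∉ U) (j : ℕ) :
    MeasurableSet[pastSpace μ (compoundRenewal c ξ Y) (renewalEpoch ξ (i + 1)) τ]
      {ω | jumpCount U Y i ω = j} := by
  have h1 := h.measurable_past_sum c τ i (φ := U.indicator 1) (measurable_one.indicator hU)
    (Set.indicator_of_notMem hU0 _)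
  have h2 : {ω | jumpCount U Y i ω = j} =
      (fun ω => ∑ l ∈ Finset.range i, U.indicator 1 (Y l ω)) ⁻¹' {(j : ℝ)} := by
    ext ω
    simp only [Set.mem_ofPred_eq, Set.mem_preimage, Set.mem_singleton_iff, ← jumpCount_eq_sum]
    exact Nat.cast_inj.symm
  rw [h2]
  exact h1 (measurableSet_singleton _)

lemma measurableSet_past_noCross (h : IsCompoundRenewalModel μ F ξ Y) (c : ℝ)
    (τ : Ω → ℝ≥0∞) (i : ℕ) (x : ℝ) :
    MeasurableSet[pastSpace μ (compoundRenewal c ξ Y) (renewalEpoch ξ (i + 1)) τ]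
      {ω | ∀ l ≤ i, jumpSum Y l ω +
        max (c * renewalEpoch ξ l ω) (c * renewalEpoch ξ (l + 1) ω) ≤ x} := by
  refine measurableSet_past_of_ae (measurableSet_sigmaBefore_forall_rat x) ?_
  filter_upwards [h.ae_isRegularPath] with ω hω
  exact propext (hω.forall_rat_le_iff x i).symm

/-- The jump is the increment at `u = 0`; the waiting time is recognised by the linear motion after
it at rational times. -/
lemma measurable_future (h : IsCompoundRenewalModel μ F ξ Y) (c : ℝ) (i : ℕ) (hq : 0 < F.real {0}ᶜ) :
    Measurable[eventuallyMeasurableSpace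
      (sigmaIncrementsFrom (compoundRenewal c ξ Y) (renewalEpoch ξ (i + 1))) (ae μ)]
      fun ω => (Y i ω, waitTime {0}ᶜ ξ Y (i + 1) ω) := by
  have hinc := fun (u : ℝ) (hu : 0 ≤ u) => measurable_sigmaIncrementsFrom
    (X := compoundRenewal c ξ Y) (T := renewalEpoch ξ (i + 1)) hu
  refine Measurable.prodMk ?_ ?_
  · refine Measurable.eventuallyMeasurable_of_eventuallyEq (hinc 0 le_rfl) ?_
    filter_upwards [h.ae_isRegularPath] with ω hω
    rw [hω.leftLim_eq, add_zero,
      hω.compoundRenewal_eq (n := i + 1) le_rfl (hω.strictMono (i + 1).lt_succ_self), jumpSum_succ]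
    ring
  · refine measurable_of_Ici fun s => ?_
    refine ⟨⋂ r : ℚ, ⋂ hr : 0 ≤ r, ⋂ _ : (r : ℝ) < s,
      (fun ω => (compoundRenewal c ξ Y (renewalEpoch ξ (i + 1) ω + r) ω - Function.leftLim
          (fun t => compoundRenewal c ξ Y t ω) (renewalEpoch ξ (i + 1) ω)) -
        (compoundRenewal c ξ Y (renewalEpoch ξ (i + 1) ω + 0) ω - Function.leftLim
          (fun t => compoundRenewal c ξ Y t ω) (renewalEpoch ξ (i + 1) ω))) ⁻¹' {c * r}, ?_, ?_⟩
    · exact MeasurableSet.iInter fun r => MeasurableSet.iInter fun hr =>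
        MeasurableSet.iInter fun _ => ((hinc r (by exact_mod_cast hr)).sub (hinc 0 le_rfl))
          (measurableSet_singleton _)
    · filter_upwards [h.ae_isRegularPath,
        h.ae_frequently_mem (measurableSet_singleton (0 : ℝ)).compl hq] with ω hω hf
      refine propext ?_
      have h1 := hω.le_waitTime_iff (c := c) hf (i + 1) s
      change s ≤ waitTime {0}ᶜ ξ Y (i + 1) ω ↔ ω ∈ ⋂ r : ℚ, _
      rw [h1]
      simp

/-- A jump and the waiting time after it are independent of the past of its epoch. -/
theorem measure_past_inter_mark (h : IsCompoundRenewalModel μ F ξ Y) {c : ℝ} {τ : Ω → ℝ≥0∞}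
    (i : ℕ)
    (hτ : IndepFutureIncrements μ (compoundRenewal c ξ Y) (renewalEpoch ξ) τ)
    (hq : 0 < F.real {0}ᶜ) {E : Set Ω}
    (hE : MeasurableSet[pastSpace μ (compoundRenewal c ξ Y) (renewalEpoch ξ (i + 1)) τ] E)
    {t : Set (ℝ × ℝ)} (ht : MeasurableSet t) :
    μ (E ∩ {ω | (Y i ω, waitTime {0}ᶜ ξ Y (i + 1) ω) ∈ t}) =
      μ E * F.prod (μ.map (waitTime {0}ᶜ ξ Y 0)) t := by
  have hU : MeasurableSet ({0}ᶜ : Set ℝ) := (measurableSet_singleton 0).compl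
  have h1 := (Indep_iff _ _ _).1 (indep_eventuallyMeasurableSpace (hτ (i + 1) (by omega))) E
    _ hE (h.measurable_future c i hq ht)
  have h2 := (h.measurable_jump i).prodMk
    (measurable_waitTime h.measurable_interarrival h.measurable_jump hU (i + 1))
  rw [← h.map_jump_waitTime hU hq i, Measure.map_apply h2 ht]
  exact h1

end IsCompoundRenewalModel

/-! ### The chain of the states before the nonzero jumps -/

section Chain

variable {Ω : Type*} {ξ Y : ℕ → Ω → ℝ} {ω : Ω} {U : Set ℝ} {c x : ℝ}

/-- The event that `E i` occurs for the index `i` of the jump with value in `U` that is preceded by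
exactly `j` such jumps. -/
def markSet (U : Set ℝ) (Y : ℕ → Ω → ℝ) (E : ℕ → Set Ω) (j : ℕ) : Set Ω :=
  ⋃ i, E i ∩ {ω | Y i ω ∈ U ∧ jumpCount U Y i ω = j}

/-- The epochs up to the one with index `i + 1` occur before `τ`. -/
def survivalSet (ξ : ℕ → Ω → ℝ) (τ : Ω → ℝ≥0∞) (i : ℕ) : Set Ω :=
  {ω | ∀ l ≤ i, ENNReal.ofReal (renewalEpoch ξ (l + 1) ω) ≤ τ ω}

/-- The epochs up to the one with index `i + 1` occur before `τ`, and the level `x` is not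
exceeded before the last of them. -/
def activeSet (c : ℝ) (ξ Y : ℕ → Ω → ℝ) (τ : Ω → ℝ≥0∞) (x : ℝ) (i : ℕ) : Set Ω :=
  survivalSet ξ τ i ∩ {ω | ∀ l ≤ i, jumpSum Y l ω +
    max (c * renewalEpoch ξ l ω) (c * renewalEpoch ξ (l + 1) ω) ≤ x}

/-- The state just before the nonzero jump that is preceded by exactly `j` nonzero jumps. -/
noncomputable def chainState (c : ℝ) (ξ Y : ℕ → Ω → ℝ) (j : ℕ) (ω : Ω) : ℝ :=
  jumpSum Y (markIndex {0}ᶜ Y j ω) ω + c * renewalEpoch ξ (markIndex {0}ᶜ Y j ω + 1) ω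

/-- A nonzero jump together with the waiting time to the next one. -/
noncomputable def chainMark (ξ Y : ℕ → Ω → ℝ) (j : ℕ) (ω : Ω) : ℝ × ℝ :=
  (Y (markIndex {0}ᶜ Y j ω) ω, waitTime {0}ᶜ ξ Y (markIndex {0}ᶜ Y j ω + 1) ω)

lemma survivalSet_anti (ξ : ℕ → Ω → ℝ) (τ : Ω → ℝ≥0∞) : Antitone (survivalSet ξ τ) :=
  fun _ _ hik _ hω l hl => hω l (hl.trans hik)

lemma activeSet_anti (c : ℝ) (ξ Y : ℕ → Ω → ℝ) (τ : Ω → ℝ≥0∞) (x : ℝ) :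
    Antitone (activeSet c ξ Y τ x) :=
  fun _ _ hik _ hω => ⟨survivalSet_anti ξ τ hik hω.1, fun l hl => hω.2 l (hl.trans hik)⟩

lemma IsRegularPath.mem_survivalSet_iff (h : IsRegularPath ξ ω) {τ : Ω → ℝ≥0∞} {i : ℕ} :
    ω ∈ survivalSet ξ τ i ↔ ENNReal.ofReal (renewalEpoch ξ (i + 1) ω) ≤ τ ω :=
  ⟨fun h1 => h1 i le_rfl, fun h1 _ hl =>
    (ENNReal.ofReal_le_ofReal (h.strictMono.monotone (Nat.succ_le_succ hl))).trans h1⟩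

lemma mem_markSet_iff {E : ℕ → Set Ω} {j : ℕ} :
    ω ∈ markSet U Y E j ↔ ∃ i, ω ∈ E i ∧ Y i ω ∈ U ∧ jumpCount U Y i ω = j := by
  simp [markSet]

lemma markSet_mono {E E' : ℕ → Set Ω} (hE : ∀ i, E i ⊆ E' i) (j : ℕ) :
    markSet U Y E j ⊆ markSet U Y E' j :=
  Set.iUnion_mono fun i => Set.inter_subset_inter_left _ (hE i)

lemma exists_lt_of_jumpCount_eq_succ {i j : ℕ} (h : jumpCount U Y i ω = j + 1) :
    ∃ k < i, Y k ω ∈ U ∧ jumpCount U Y k ω = j := by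
  induction i with
  | zero => simp [jumpCount_zero] at h
  | succ i ih =>
    by_cases hi : Y i ω ∈ U
    · rw [jumpCount_succ_of_mem hi] at h
      exact ⟨i, i.lt_succ_self, hi, by omega⟩
    · rw [jumpCount_succ_of_notMem hi] at h
      obtain ⟨k, hk, hk'⟩ := ih h
      exact ⟨k, hk.trans i.lt_succ_self, hk'⟩

lemma markSet_succ_subset {E : ℕ → Set Ω} (hE : Antitone E) (j : ℕ) :
    markSet U Y E (j + 1) ⊆ markSet U Y E j := fun ω hω => by
  obtain ⟨i, h1, _, h3⟩ := mem_markSet_iff.1 hω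
  obtain ⟨k, hk, h4, h5⟩ := exists_lt_of_jumpCount_eq_succ h3
  exact mem_markSet_iff.2 ⟨k, hE hk.le h1, h4, h5⟩

lemma pairwise_disjoint_mark (U : Set ℝ) (Y : ℕ → Ω → ℝ) (j : ℕ) :
    Pairwise (Function.onFun Disjoint fun i => {ω | Y i ω ∈ U ∧ jumpCount U Y i ω = j}) := by
  intro i k hik
  refine Set.disjoint_left.2 fun ω h1 h2 => hik ?_
  exact eq_of_jumpCount_eq h1.1 h2.1 (h1.2.trans h2.2.symm)

lemma chainState_eq {i j : ℕ} (h1 : Y i ω ∈ ({0}ᶜ : Set ℝ)) (h2 : jumpCount {0}ᶜ Y i ω = j) :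
    chainState c ξ Y j ω = jumpSum Y i ω + c * renewalEpoch ξ (i + 1) ω := by
  rw [chainState, markIndex_eq h1 h2]

lemma chainMark_eq {i j : ℕ} (h1 : Y i ω ∈ ({0}ᶜ : Set ℝ)) (h2 : jumpCount {0}ᶜ Y i ω = j) :
    chainMark ξ Y j ω = (Y i ω, waitTime {0}ᶜ ξ Y (i + 1) ω) := by
  rw [chainMark, markIndex_eq h1 h2]

lemma jumpSum_add_of_forall {i m : ℕ} (h : ∀ l < m, Y (i + l) ω ∉ ({0}ᶜ : Set ℝ)) :
    jumpSum Y (i + m) ω = jumpSum Y i ω := by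
  induction m with
  | zero => rfl
  | succ m ih =>
    have h0 : Y (i + m) ω = 0 := by simpa using h m m.lt_succ_self
    rw [← add_assoc, jumpSum_succ, h0, add_zero, ih fun l hl => h l (hl.trans m.lt_succ_self)]

lemma chainState_of_mem_gapEvent {i m j : ℕ} (hm : ω ∈ gapEvent {0}ᶜ Y i m)
    (hj : jumpCount {0}ᶜ Y i ω = j) : chainState c ξ Y j ω =
      jumpSum Y i ω + c * renewalEpoch ξ i ω + c * waitTime {0}ᶜ ξ Y i ω := by
  have h1 := jumpCount_add_of_forall hm.2
  rw [chainState_eq hm.1 (h1.trans hj), jumpSum_add_of_forall hm.2, waitTime_of_mem_gapEvent hm,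
    add_assoc i m 1, renewalEpoch_add]
  ring

lemma chainState_zero (hf : ∃ᶠ i in atTop, Y i ω ∈ ({0}ᶜ : Set ℝ)) :
    chainState c ξ Y 0 ω = c * waitTime {0}ᶜ ξ Y 0 ω := by
  obtain ⟨m, hm⟩ := exists_mem_gapEvent hf 0
  rw [chainState_of_mem_gapEvent hm jumpCount_zero]
  simp [jumpSum, renewalEpoch]

lemma chainState_succ (hf : ∃ᶠ i in atTop, Y i ω ∈ ({0}ᶜ : Set ℝ)) (j : ℕ) :
    chainState c ξ Y (j + 1) ω =
      chainState c ξ Y j ω + ((chainMark ξ Y j ω).1 + c * (chainMark ξ Y j ω).2) := by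
  obtain ⟨h1, h2⟩ := exists_markIndex hf j
  obtain ⟨m, hm⟩ := exists_mem_gapEvent hf (markIndex {0}ᶜ Y j ω + 1)
  rw [chainState_of_mem_gapEvent hm ((jumpCount_succ_of_mem h1).trans (by rw [h2])),
    chainState, chainMark, jumpSum_succ]
  ring

/-- The level is not exceeded before an epoch at which the chain is still active. -/
lemma chainState_add_le_of_mem_activeSet
    (hf : ∃ᶠ i in atTop, Y i ω ∈ ({0}ᶜ : Set ℝ)) {τ : Ω → ℝ≥0∞} {j : ℕ}
    (hω : ω ∈ markSet {0}ᶜ Y (activeSet c ξ Y τ x) (j + 1)) :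
    chainState c ξ Y j ω + ((chainMark ξ Y j ω).1 + max c 0 * (chainMark ξ Y j ω).2) ≤ x := by
  obtain ⟨i, h1, h2, h3⟩ := mem_markSet_iff.1 hω
  rcases le_total c 0 with hc | hc
  -- For `c ≤ 0` the highest point between two nonzero jumps is reached right after the first of
  -- them; for `c ≥ 0` it is the limit just before the second.
  · obtain ⟨k, hk, h4, h5⟩ := exists_lt_of_jumpCount_eq_succ h3
    have h6 := h1.2 (k + 1) hk
    rw [max_eq_right hc, chainState_eq h4 h5, chainMark_eq h4 h5]
    rw [jumpSum_succ] at h6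
    have := le_max_left (c * renewalEpoch ξ (k + 1) ω) (c * renewalEpoch ξ (k + 1 + 1) ω)
    simp only
    linarith
  · have h6 := h1.2 i le_rfl
    rw [max_eq_left hc, ← chainState_succ hf, chainState_eq h2 h3]
    have := le_max_right (c * renewalEpoch ξ i ω) (c * renewalEpoch ξ (i + 1) ω)
    linarith

lemma chainState_le_of_mem_activeSet {τ : Ω → ℝ≥0∞} {j : ℕ}
    (hω : ω ∈ markSet {0}ᶜ Y (activeSet c ξ Y τ x) j) : chainState c ξ Y j ω ≤ x := by
  obtain ⟨i, h1, h2, h3⟩ := mem_markSet_iff.1 hω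
  have h6 := h1.2 i le_rfl
  rw [chainState_eq h2 h3]
  have := le_max_right (c * renewalEpoch ξ i ω) (c * renewalEpoch ξ (i + 1) ω)
  linarith

/-- A path that exceeds the level does so before the first nonzero jump, or between two successive
nonzero jumps while the chain is active. -/
lemma IsRegularPath.exists_cross (h : IsRegularPath ξ ω)
    (hf : ∃ᶠ i in atTop, Y i ω ∈ ({0}ᶜ : Set ℝ)) {τ : Ω → ℝ≥0∞}
    (hx : (x : EReal) < pathSup (compoundRenewal c ξ Y) (τ ω) ω) :
    x < max c 0 * waitTime {0}ᶜ ξ Y 0 ω ∨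
      ∃ j, ω ∈ markSet {0}ᶜ Y (activeSet c ξ Y τ x) j ∧ x < chainState c ξ Y j ω +
        ((chainMark ξ Y j ω).1 + max c 0 * (chainMark ξ Y j ω).2) := by
  classical
  have hex := h.exists_of_lt_pathSup hx
  -- The first interval between epochs in which the level is exceeded; minimality provides the
  -- no-crossing part of the active event.
  set l := Nat.find hex with hl
  obtain ⟨hlτ, hlx⟩ := Nat.find_spec hex
  rw [← hl] at hlτ hlx
  have hmin : ∀ k < l, jumpSum Y k ω +
      max (c * renewalEpoch ξ k ω) (c * renewalEpoch ξ (k + 1) ω) ≤ x := by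
    intro k hk
    have h1 := Nat.find_min hex hk
    by_contra h2
    exact h1 ⟨(ENNReal.ofReal_le_ofReal (h.strictMono.monotone hk.le)).trans hlτ, not_le.1 h2⟩
  -- Over a stretch without nonzero jumps the path rises by at most the positive part of `c` times
  -- the length of the stretch.
  have hbound : ∀ i m, ω ∈ gapEvent {0}ᶜ Y i m → i ≤ l → l ≤ i + m →
      jumpSum Y l ω + max (c * renewalEpoch ξ l ω) (c * renewalEpoch ξ (l + 1) ω) ≤
        jumpSum Y i ω + c * renewalEpoch ξ i ω + max c 0 * waitTime {0}ᶜ ξ Y i ω := by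
    intro i m hm hil hlm
    obtain ⟨d, hd⟩ := Nat.exists_eq_add_of_le hil
    have h1 : jumpSum Y l ω = jumpSum Y i ω := by
      rw [hd]
      exact jumpSum_add_of_forall fun k hk => hm.2 k (by omega)
    have h2 : waitTime {0}ᶜ ξ Y i ω = renewalEpoch ξ (i + m + 1) ω - renewalEpoch ξ i ω := by
      rw [waitTime_of_mem_gapEvent hm, add_assoc, renewalEpoch_add, add_sub_cancel_left]
    have h3 : renewalEpoch ξ i ω ≤ renewalEpoch ξ l ω := h.strictMono.monotone hil
    have h4 : renewalEpoch ξ l ω ≤ renewalEpoch ξ (l + 1) ω := h.strictMono.monotone (by omega)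
    have h5 : renewalEpoch ξ (l + 1) ω ≤ renewalEpoch ξ (i + m + 1) ω :=
      h.strictMono.monotone (by omega)
    rw [h1, h2, add_assoc]
    refine add_le_add le_rfl (max_le ?_ ?_) <;> rcases le_total c 0 with hc | hc
    · rw [max_eq_right hc]; nlinarith
    · rw [max_eq_left hc]; nlinarith
    · rw [max_eq_right hc]; nlinarith
    · rw [max_eq_left hc]; nlinarith
  -- Without an earlier nonzero jump the crossing takes place in the initial stretch. Otherwise it
  -- falls into the stretch that follows the last nonzero jump before `l`, which is preceded by
  -- exactly `j` others.
  rcases hcount : jumpCount {0}ᶜ Y l ω with _ | j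
  · left
    obtain ⟨m, hm⟩ := exists_mem_gapEvent hf 0
    have hlm : l ≤ 0 + m := by
      by_contra hcon
      have h1 := jumpCount_mono {0}ᶜ Y ω (show 0 + m + 1 ≤ l by omega)
      simp only [jumpCount_succ_of_mem hm.1, hcount] at h1
      omega
    have h1 := hbound 0 m hm (Nat.zero_le l) hlm
    have h2 : jumpSum Y 0 ω + c * renewalEpoch ξ 0 ω = 0 := by simp [jumpSum, renewalEpoch]
    linarith
  · right
    obtain ⟨k, hk, h4, h5⟩ := exists_lt_of_jumpCount_eq_succ hcount
    refine ⟨j, mem_markSet_iff.2 ⟨k, ⟨?_, fun i hi => hmin i (by omega)⟩, h4, h5⟩, ?_⟩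
    · intro i hi
      exact (ENNReal.ofReal_le_ofReal (h.strictMono.monotone (by omega))).trans hlτ
    · obtain ⟨m, hm⟩ := exists_mem_gapEvent hf (k + 1)
      have hlm : l ≤ k + 1 + m := by
        by_contra hcon
        have h1 := jumpCount_mono {0}ᶜ Y ω (show k + 1 + m + 1 ≤ l by omega)
        simp only [jumpCount_succ_of_mem hm.1, hcount, jumpCount_add_of_forall hm.2,
          jumpCount_succ_of_mem h4, h5] at h1
        omega
      have h1 := hbound (k + 1) m hm hk hlm
      rw [chainState_eq h4 h5, chainMark_eq h4 h5]
      rw [jumpSum_succ] at h1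
      simp only
      linarith

/-- The supremum exceeds the level if the process is stopped as inactive before `τ`. -/
lemma IsRegularPath.lt_pathSup_of_notMem_activeSet (h : IsRegularPath ξ ω) {τ : Ω → ℝ≥0∞} {i : ℕ}
    (h1 : ω ∈ survivalSet ξ τ i) (h2 : ω ∉ activeSet c ξ Y τ x i) :
    (x : EReal) < pathSup (compoundRenewal c ξ Y) (τ ω) ω := by
  have h3 : ∃ l ≤ i, x < jumpSum Y l ω +
      max (c * renewalEpoch ξ l ω) (c * renewalEpoch ξ (l + 1) ω) := by
    by_contra! hcon
    exact h2 ⟨h1, hcon⟩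
  obtain ⟨l, hl, hlx⟩ := h3
  exact h.lt_pathSup_of_lt (h1 l hl) hlx

lemma IsRegularPath.lt_pathSup_of_chain (h : IsRegularPath ξ ω) {τ : Ω → ℝ≥0∞} {j : ℕ}
    (h1 : ω ∈ markSet {0}ᶜ Y (activeSet c ξ Y τ x) j)
    (h2 : x < chainState c ξ Y j ω + (chainMark ξ Y j ω).1) :
    (x : EReal) < pathSup (compoundRenewal c ξ Y) (τ ω) ω := by
  obtain ⟨i, h3, h4, h5⟩ := mem_markSet_iff.1 h1
  rw [chainState_eq h4 h5, chainMark_eq h4 h5] at h2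
  refine h.lt_pathSup_of_lt_jump (h3.1 i le_rfl) ?_
  rw [jumpSum_succ]
  simp only at h2
  linarith

variable [MeasurableSpace Ω]

lemma measurable_chainState (hξ : ∀ n, Measurable (ξ n)) (hY : ∀ n, Measurable (Y n)) (c : ℝ)
    (j : ℕ) : Measurable (chainState c ξ Y j) := by
  have hν := measurable_markIndex hY (measurableSet_singleton (0 : ℝ)).compl j
  exact (measurable_comp_index (measurable_jumpSum hY) hν).add
    ((measurable_comp_index (fun n => measurable_renewalEpoch hξ (n + 1)) hν).const_mul c)

lemma measurable_chainMark (hξ : ∀ n, Measurable (ξ n)) (hY : ∀ n, Measurable (Y n)) (j : ℕ) :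
    Measurable (chainMark ξ Y j) := by
  have hU := (measurableSet_singleton (0 : ℝ)).compl
  have hν := measurable_markIndex hY hU j
  exact (measurable_comp_index hY hν).prodMk
    (measurable_comp_index (fun n => measurable_waitTime hξ hY hU (n + 1)) hν)

lemma measurableSet_markSet (hY : ∀ n, Measurable (Y n)) (hU : MeasurableSet U) {E : ℕ → Set Ω}
    (hE : ∀ i, MeasurableSet (E i)) (j : ℕ) : MeasurableSet (markSet U Y E j) :=
  MeasurableSet.iUnion fun i => (hE i).inter (measurableSet_mark hY hU i j)

lemma measurableSet_survivalSet (hξ : ∀ n, Measurable (ξ n)) {τ : Ω → ℝ≥0∞} (hτ : Measurable τ)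
    (i : ℕ) : MeasurableSet (survivalSet ξ τ i) := by
  have h1 : survivalSet ξ τ i =
      ⋂ l : ℕ, ⋂ _ : l ≤ i, {ω | ENNReal.ofReal (renewalEpoch ξ (l + 1) ω) ≤ τ ω} := by
    ext ω; simp [survivalSet]
  rw [h1]
  exact MeasurableSet.iInter fun l => MeasurableSet.iInter fun _ =>
    measurableSet_le (measurable_renewalEpoch hξ _).ennreal_ofReal hτ

lemma measurableSet_activeSet (hξ : ∀ n, Measurable (ξ n)) (hY : ∀ n, Measurable (Y n))
    {τ : Ω → ℝ≥0∞} (hτ : Measurable τ) (c x : ℝ) (i : ℕ) :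
    MeasurableSet (activeSet c ξ Y τ x i) := by
  refine (measurableSet_survivalSet hξ hτ i).inter ?_
  have h1 : {ω | ∀ l ≤ i, jumpSum Y l ω +
      max (c * renewalEpoch ξ l ω) (c * renewalEpoch ξ (l + 1) ω) ≤ x} =
      ⋂ l : ℕ, ⋂ _ : l ≤ i, {ω | jumpSum Y l ω +
        max (c * renewalEpoch ξ l ω) (c * renewalEpoch ξ (l + 1) ω) ≤ x} := by
    ext ω; simp
  rw [h1]
  exact MeasurableSet.iInter fun l => MeasurableSet.iInter fun _ =>
    measurableSet_le ((measurable_jumpSum hY l).add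
      (((measurable_renewalEpoch hξ l).const_mul c).max
        ((measurable_renewalEpoch hξ (l + 1)).const_mul c))) measurable_const

lemma measure_markSet_inter {μ : Measure Ω} (hY : ∀ n, Measurable (Y n)) (hU : MeasurableSet U)
    {E : ℕ → Set Ω} (hE : ∀ i, MeasurableSet (E i)) (j : ℕ) {G : Set Ω} (hG : MeasurableSet G) :
    μ (markSet U Y E j ∩ G) =
      ∑' i, μ (E i ∩ {ω | Y i ω ∈ U ∧ jumpCount U Y i ω = j} ∩ G) := by
  rw [markSet, Set.iUnion_inter, measure_iUnion]
  · intro i k hik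
    exact (pairwise_disjoint_mark U Y j hik).mono
      (Set.inter_subset_left.trans Set.inter_subset_right)
      (Set.inter_subset_left.trans Set.inter_subset_right)
  · exact fun i => ((hE i).inter (measurableSet_mark hY hU i j)).inter hG

end Chain

/-! ### Independence of the states and the marks -/

namespace IsCompoundRenewalModel

variable {Ω : Type*} [MeasurableSpace Ω] {μ : Measure Ω} [IsProbabilityMeasure μ] {F : Measure ℝ}
  {ξ Y : ℕ → Ω → ℝ} {U : Set ℝ} {c x : ℝ} {τ : Ω → ℝ≥0∞}

lemma measurableSet_past_survivalSet (h : IsCompoundRenewalModel μ F ξ Y) (c : ℝ)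
    (τ : Ω → ℝ≥0∞) (i : ℕ) :
    MeasurableSet[pastSpace μ (compoundRenewal c ξ Y) (renewalEpoch ξ (i + 1)) τ]
      (survivalSet ξ τ i) := by
  refine EventuallyMeasurableSet.congr (measurableSet_past_le (μ := μ)) ?_
  filter_upwards [h.ae_isRegularPath] with ω hω
  exact propext hω.mem_survivalSet_iff

lemma measurableSet_past_activeSet (h : IsCompoundRenewalModel μ F ξ Y) (c x : ℝ)
    (τ : Ω → ℝ≥0∞) (i : ℕ) :
    MeasurableSet[pastSpace μ (compoundRenewal c ξ Y) (renewalEpoch ξ (i + 1)) τ]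
      (activeSet c ξ Y τ x i) :=
  (h.measurableSet_past_survivalSet c τ i).inter (h.measurableSet_past_noCross c τ i x)

/-- The event is decomposed by the index `i` of the marked jump. Activity, count and state are
determined by the past of epoch `i + 1`, so the future factor splits off. It is the same for every
`i`, hence leaves the sum; the requirement that the jump be nonzero turns it into `F {0}ᶜ` times the
conditional law. -/
lemma measure_active_inter (h : IsCompoundRenewalModel μ F ξ Y) (hτm : Measurable τ)
    (hτ : IndepFutureIncrements μ (compoundRenewal c ξ Y) (renewalEpoch ξ) τ)
    (hq : 0 < F.real {0}ᶜ) (j : ℕ) {C : Set ℝ} (hC : MeasurableSet C) {t : Set (ℝ × ℝ)}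
    (ht : MeasurableSet t) :
    μ (markSet {0}ᶜ Y (activeSet c ξ Y τ x) j ∩
        {ω | chainState c ξ Y j ω ∈ C ∧ chainMark ξ Y j ω ∈ t}) =
      (∑' i, μ (activeSet c ξ Y τ x i ∩ {ω | jumpCount {0}ᶜ Y i ω = j} ∩
        {ω | jumpSum Y i ω + c * renewalEpoch ξ (i + 1) ω ∈ C})) *
        (F {0}ᶜ * markLaw μ F {0}ᶜ ξ Y t) := by
  have hU : MeasurableSet ({0}ᶜ : Set ℝ) := (measurableSet_singleton 0).compl
  have hm := h.measurable_interarrival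
  have hm' := h.measurable_jump
  have hG : MeasurableSet {ω | chainState c ξ Y j ω ∈ C ∧ chainMark ξ Y j ω ∈ t} :=
    (measurable_chainState hm hm' c j hC).inter (measurable_chainMark hm hm' j ht)
  rw [measure_markSet_inter hm' hU (measurableSet_activeSet hm hm' hτm c x) j hG,
    ← ENNReal.tsum_mul_right]
  refine tsum_congr fun i => ?_
  have hE := ((h.measurableSet_past_activeSet c x τ i).inter
    (h.measurableSet_past_jumpCount c τ i hU (by simp) j)).inter
    (h.measurable_past_state c τ i hC)
  have h1 := h.measure_past_inter_mark i hτ hq hE (ht.inter (hU.prod MeasurableSet.univ))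
  rw [← h.measure_mul_markLaw hU hq ht] at h1
  refine Eq.trans (congrArg μ ?_) h1
  ext ω
  simp only [Set.mem_inter_iff, Set.mem_ofPred_eq, Set.mem_preimage, Set.mem_prod, Set.mem_univ,
    and_true]
  constructor
  · rintro ⟨⟨h2, h3, h4⟩, h5, h6⟩
    rw [chainState_eq h3 h4] at h5
    rw [chainMark_eq h3 h4] at h6
    exact ⟨⟨⟨h2, h4⟩, h5⟩, h6, h3⟩
  · rintro ⟨⟨⟨h2, h4⟩, h5⟩, h6, h3⟩
    rw [chainState_eq h3 h4, chainMark_eq h3 h4]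
    exact ⟨⟨h2, h3, h4⟩, h5, h6⟩

/-- The states before the nonzero jumps form a chain with independent increments. -/
theorem isIncrementChain (h : IsCompoundRenewalModel μ F ξ Y) (hτm : Measurable τ)
    (hτ : IndepFutureIncrements μ (compoundRenewal c ξ Y) (renewalEpoch ξ) τ)
    (hq : 0 < F.real {0}ᶜ) (x : ℝ) :
    IsIncrementChain μ (chainState c ξ Y) (chainMark ξ Y)
      (markSet {0}ᶜ Y (activeSet c ξ Y τ x)) (markLaw μ F {0}ᶜ ξ Y) fun w => w.1 + c * w.2 := by
  have hU : MeasurableSet ({0}ᶜ : Set ℝ) := (measurableSet_singleton 0).compl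
  have hm := h.measurable_interarrival
  have hm' := h.measurable_jump
  have := h.isProbabilityMeasure_markLaw hU hq
  refine ⟨measurable_chainState hm hm' c, measurable_chainMark hm hm',
    measurableSet_markSet hm' hU (measurableSet_activeSet hm hm' hτm c x),
    markSet_succ_subset (activeSet_anti c ξ Y τ x), by fun_prop, fun n => ?_, fun n => ?_⟩
  · filter_upwards [h.ae_frequently_mem hU hq] with ω hf _
    exact chainState_succ hf n
  · have : IsFiniteMeasure ((μ.restrict (markSet {0}ᶜ Y (activeSet c ξ Y τ x) n)).map
        (chainState c ξ Y n)) := Measure.isFiniteMeasure_map _ _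
    refine (Measure.prod_eq fun C t hC ht => ?_).symm
    rw [Measure.map_apply ((measurable_chainState hm hm' c n).prodMk (measurable_chainMark hm hm' n))
        (hC.prod ht), Measure.map_apply (measurable_chainState hm hm' c n) hC,
      Measure.restrict_apply' (measurableSet_markSet hm' hU
        (measurableSet_activeSet hm hm' hτm c x) n), Measure.restrict_apply'
        (measurableSet_markSet hm' hU (measurableSet_activeSet hm hm' hτm c x) n),
      Set.inter_comm, Set.inter_comm (chainState c ξ Y n ⁻¹' C)]
    have h1 := h.measure_active_inter (x := x) hτm hτ hq n hC ht
    -- The trivial condition on the mark identifies the common factor as the law of the state on the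
    -- active event.
    have h2 := h.measure_active_inter (x := x) hτm hτ hq n hC MeasurableSet.univ
    rw [measure_univ, mul_one] at h2
    have h3 : {ω | chainState c ξ Y n ω ∈ C ∧ chainMark ξ Y n ω ∈ Set.univ} =
        chainState c ξ Y n ⁻¹' C := by ext ω; simp
    rw [h3] at h2
    rw [h2, mul_assoc]
    exact h1

end IsCompoundRenewalModel

/-! ### Weighted sums of the tail over consecutive intervals -/

/-- The sum of the integrals of `f` over the first `m` intervals of length `a` to the right of `x`,
with weights `w`. -/
noncomputable def tailSum (f : ℝ → ℝ) (a x : ℝ) (w : ℕ → ℝ) (m : ℕ) : ℝ :=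
  ∑ n ∈ Finset.range m, w n * ∫ u in (x + a * n)..(x + a * (n + 1)), f u

section TailSum

variable {f : ℝ → ℝ} {a x : ℝ} {w : ℕ → ℝ}

lemma tailSum_term_nonneg (hf : IsTail f) (ha : 0 ≤ a) (n : ℕ) :
    0 ≤ ∫ u in (x + a * n)..(x + a * (n + 1)), f u :=
  hf.integral_nonneg (by linarith)

lemma tailSum_one (hf : IsTail f) (m : ℕ) :
    tailSum f a x (fun _ => 1) m = ∫ u in x..(x + a * m), f u := by
  have h1 := intervalIntegral.sum_integral_adjacent_intervals (f := f) (μ := volume)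
    (a := fun k : ℕ => x + a * k) (n := m) fun k _ => hf.intervalIntegrable _ _
  simp only [tailSum, one_mul]
  simpa using h1

lemma tailSum_mono_weight (hf : IsTail f) (ha : 0 ≤ a) {v : ℕ → ℝ} {m : ℕ}
    (h : ∀ n < m, v n ≤ w n) : tailSum f a x v m ≤ tailSum f a x w m :=
  Finset.sum_le_sum fun n hn => mul_le_mul_of_nonneg_right (h n (Finset.mem_range.1 hn))
    (tailSum_term_nonneg hf ha n)

lemma tailSum_nonneg (hf : IsTail f) (ha : 0 ≤ a) (hw : ∀ n, 0 ≤ w n) (m : ℕ) :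
    0 ≤ tailSum f a x w m :=
  Finset.sum_nonneg fun n _ => mul_nonneg (hw n) (tailSum_term_nonneg hf ha n)

lemma tailSum_mono (hf : IsTail f) (ha : 0 ≤ a) (hw : ∀ n, 0 ≤ w n) :
    Monotone (tailSum f a x w) := fun _ _ hmn =>
  Finset.sum_le_sum_of_subset_of_nonneg (Finset.range_mono hmn)
    fun n _ _ => mul_nonneg (hw n) (tailSum_term_nonneg hf ha n)

lemma tailSum_one_le (hf : IsTail f) (m : ℕ) :
    tailSum f a x (fun _ => 1) m ≤ tailInt f x := by
  rw [tailSum_one hf, ← hf.tailInt_sub]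
  linarith [hf.tailInt_nonneg (x + a * m)]

lemma tailSum_sub_le (hf : IsTail f) (ha : 0 ≤ a) (hw : ∀ n, 0 ≤ w n) {R δ : ℝ}
    (h : ∀ y ≥ x, f (y - R) ≤ (1 + δ) * f y) (m : ℕ) :
    tailSum f a (x - R) w m ≤ (1 + δ) * tailSum f a x w m := by
  rw [tailSum, tailSum, Finset.mul_sum]
  refine Finset.sum_le_sum fun n _ => ?_
  have h1 : ∫ u in (x - R + a * n)..(x - R + a * (n + 1)), f u =
      ∫ u in (x + a * n)..(x + a * (n + 1)), f (u - R) := by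
    rw [intervalIntegral.integral_comp_sub_right]
    congr 1 <;> ring
  have h0 : 0 ≤ a * n := by positivity
  have h2 : ∫ u in (x + a * n)..(x + a * (n + 1)), f (u - R) ≤
      ∫ u in (x + a * n)..(x + a * (n + 1)), (1 + δ) * f u := by
    refine intervalIntegral.integral_mono_on (by linarith) ?_
      ((hf.intervalIntegrable _ _).const_mul _) fun u hu => h u (by linarith [hu.1])
    have : Antitone fun u => f (u - R) := fun u v huv => hf.anti (by linarith)
    exact (this.antitoneOn _).intervalIntegrable
  rw [intervalIntegral.integral_const_mul] at h2
  rw [h1]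
  linarith [mul_le_mul_of_nonneg_left h2 (hw n)]

/-- Concavity of the integral of the tail, split into two numbers of steps. -/
lemma tailSum_add_le (hf : IsTail f) {q q' b b' : ℝ} (hq : 0 ≤ q) (hq' : 0 ≤ q') (hqq : q + q' = 1)
    (hb : q * b ≤ a) (hb' : q' * b' ≤ a) (n n' : ℕ) :
    q * tailSum f b x (fun _ => 1) n + q' * tailSum f b' x (fun _ => 1) n' ≤
      tailSum f a x (fun _ => 1) (n + n') := by
  -- The integral as a function of its upper end point is concave, hence lies below its tangent at
  -- `y`.
  have key : ∀ y z, ∫ u in x..z, f u ≤ (∫ u in x..y, f u) + f y * (z - y) := fun y z => by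
    have h1 := hf.mul_le_integral_sub y (y - z)
    rw [sub_sub_cancel] at h1
    have h2 := intervalIntegral.integral_add_adjacent_intervals (hf.intervalIntegrable x z)
      (hf.intervalIntegrable z y)
    linarith [show f y * (z - y) = -(f y * (y - z)) by ring]
  simp only [tailSum_one hf]
  set y := x + a * ((n + n' : ℕ) : ℝ) with hy
  have h1 := mul_le_mul_of_nonneg_left (key y (x + b * n)) hq
  have h2 := mul_le_mul_of_nonneg_left (key y (x + b' * n')) hq'
  -- The average of the two upper end points does not exceed `y`, so the linear terms add up to
  -- something nonpositive.
  have h3 : q * (x + b * n - y) + q' * (x + b' * n' - y) ≤ 0 := by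
    have h4 : q * (x + b * n - y) + q' * (x + b' * n' - y) =
        q * b * n + q' * b' * n' + (q + q') * (x - y) := by ring
    rw [h4, hqq, hy]
    push_cast
    nlinarith [mul_le_mul_of_nonneg_right hb n.cast_nonneg (α := ℝ),
      mul_le_mul_of_nonneg_right hb' n'.cast_nonneg (α := ℝ)]
  have h5 := mul_le_mul_of_nonneg_left h3 (hf.nonneg y)
  have h6 : (q + q') * ∫ u in x..y, f u = ∫ u in x..y, f u := by rw [hqq, one_mul]
  nlinarith

lemma tailSum_indicator_le {E : ℕ → Prop} [DecidablePred E] (hf : IsTail f) (ha : 0 ≤ a) {v : ℕ}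
    (hE : ∀ j, E j → j < v) (m : ℕ) :
    tailSum f a x (fun j => if E j then 1 else 0) m ≤ tailSum f a x (fun _ => 1) v := by
  have h1 : tailSum f a x (fun j => if E j then 1 else 0) m ≤
      tailSum f a x (fun j => if j < v then 1 else 0) (max m v) := by
    refine (tailSum_mono hf ha (fun j => by split_ifs <;> simp) (le_max_left m v)).trans ?_
    refine tailSum_mono_weight hf ha fun j _ => ?_
    split_ifs with h2 h3 h3
    · exact le_rfl
    · exact absurd (hE j h2) h3
    · exact zero_le_one
    · exact le_rfl
  refine h1.trans_eq ?_
  rw [tailSum, tailSum]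
  symm
  rw [← Finset.sum_subset (Finset.range_mono (le_max_right m v))]
  · exact Finset.sum_congr rfl fun j hj => by rw [if_pos (Finset.mem_range.1 hj)]
  · intro j _ hj
    rw [if_neg (by simpa using hj), zero_mul]

lemma tailSum_lt_eq {v m : ℕ} (h : v ≤ m) :
    tailSum f a x (fun j => if j < v then 1 else 0) m = tailSum f a x (fun _ => 1) v := by
  rw [tailSum, tailSum]
  symm
  rw [← Finset.sum_subset (Finset.range_mono h)]
  · exact Finset.sum_congr rfl fun j hj => by rw [if_pos (Finset.mem_range.1 hj)]
  · intro j _ hj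
    rw [if_neg (by simpa using hj), zero_mul]

open Classical in
lemma integral_tailSum {Ω : Type*} [MeasurableSpace Ω] {μ : Measure Ω} [IsProbabilityMeasure μ]
    {E : ℕ → Set Ω} (hE : ∀ i, MeasurableSet (E i)) (m : ℕ) :
    Integrable (fun ω => tailSum f a x (fun j => if ω ∈ E j then 1 else 0) m) μ ∧
    ∫ ω, tailSum f a x (fun j => if ω ∈ E j then 1 else 0) m ∂μ =
      tailSum f a x (fun j => μ.real (E j)) m := by
  have h1 : ∀ j, (fun ω => if ω ∈ E j then (1 : ℝ) else 0) = (E j).indicator 1 := fun j => by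
    funext ω; simp [Set.indicator]
  have h2 : ∀ j, Integrable (fun ω => (if ω ∈ E j then (1 : ℝ) else 0) *
      ∫ u in (x + a * j)..(x + a * (j + 1)), f u) μ := fun j => by
    refine Integrable.mul_const ?_ _
    rw [h1 j]
    exact (integrable_const (1 : ℝ)).indicator (hE j)
  refine ⟨integrable_finsetSum _ fun j _ => h2 j, ?_⟩
  unfold tailSum
  rw [integral_finsetSum _ fun j _ => h2 j]
  refine Finset.sum_congr rfl fun j _ => ?_
  rw [integral_mul_const, h1 j, integral_indicator_one (hE j)]

/-- The truncated sums with indicator weights approximate the integrated tail up to a count. -/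
lemma tendsto_tailSum_lt {F : Measure ℝ} (hf : IsTail (distTail F)) (ha : 0 < a) (N : ℕ∞) :
    Tendsto (fun m => tailSum (distTail F) a x (fun i => if (i : ℕ∞) < N then 1 else 0) m) atTop
      (𝓝 (tailIntegral F a x N)) := by
  induction N using ENat.recTopCoe with
  | top =>
    simp only [ENat.natCast_lt_top, if_true, tailSum_one hf]
    exact intervalIntegral_tendsto_integral_Ioi x (hf.integrableOn x)
      (tendsto_atTop_add_const_left _ _
        (Tendsto.const_mul_atTop ha tendsto_natCast_atTop_atTop))
  | coe n =>
    refine tendsto_const_nhds.congr' ?_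
    filter_upwards [eventually_ge_atTop n] with m hm
    have h1 : (fun i : ℕ => if (i : ℕ∞) < (n : ℕ∞) then (1 : ℝ) else 0) =
        fun i => if i < n then 1 else 0 := by
      funext i; simp
    rw [h1, tailSum_lt_eq hm, tailSum_one hf]
    rfl

end TailSum

/-! ### Counting all epochs and counting only those with a jump in a given set -/

namespace IsCompoundRenewalModel

variable {Ω : Type*} [MeasurableSpace Ω] {μ : Measure Ω} [IsProbabilityMeasure μ] {F : Measure ℝ}
  {ξ Y : ℕ → Ω → ℝ} {U : Set ℝ} {c a x : ℝ} {τ : Ω → ℝ≥0∞}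

lemma isTail (h : IsCompoundRenewalModel μ F ξ Y) : IsTail (distTail F) := by
  have := h.isProbabilityMeasure
  refine isTail_distTail ?_
  rw [← h.law_jump 0]
  exact (integrable_map_measure measurable_id.aestronglyMeasurable
    (h.measurable_jump 0).aemeasurable).2 h.integrable_jump

lemma ae_mem_survivalSet_iff (h : IsCompoundRenewalModel μ F ξ Y) (τ : Ω → ℝ≥0∞) :
    ∀ᵐ ω ∂μ, ∀ i : ℕ, ω ∈ survivalSet ξ τ i ↔ (i : ℕ∞) < renewalCount ξ (τ ω) ω := by
  filter_upwards [h.ae_isRegularPath] with ω hω i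
  rw [hω.mem_survivalSet_iff, hω.lt_renewalCount_iff]

open Classical in
-- The integral up to `a N` is the sum of the integrals over the cells with index below `N`. Taking
-- expectations replaces indicators by probabilities, the integrated tail at `x` being a common
-- bound.
lemma tendsto_tailSum_survivalSet (h : IsCompoundRenewalModel μ F ξ Y) (hτ : Measurable τ)
    (ha : 0 < a) (x : ℝ) :
    Integrable (fun ω => tailIntegral F a x (renewalCount ξ (τ ω) ω)) μ ∧
    Tendsto (tailSum (distTail F) a x fun i => μ.real (survivalSet ξ τ i)) atTop
      (𝓝 (∫ ω, tailIntegral F a x (renewalCount ξ (τ ω) ω) ∂μ)) := by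
  have hf := h.isTail
  have hE := measurableSet_survivalSet h.measurable_interarrival hτ
  have hsum := fun m => integral_tailSum (μ := μ) (f := distTail F) (a := a) (x := x) hE m
  have hlim : ∀ᵐ ω ∂μ, Tendsto (fun m => tailSum (distTail F) a x
      (fun i => if ω ∈ survivalSet ξ τ i then 1 else 0) m) atTop
      (𝓝 (tailIntegral F a x (renewalCount ξ (τ ω) ω))) := by
    filter_upwards [h.ae_mem_survivalSet_iff τ] with ω hω
    simp only [hω]
    convert tendsto_tailSum_lt hf ha (renewalCount ξ (τ ω) ω) using 2
  have hbound : ∀ m ω, ‖tailSum (distTail F) a x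
      (fun i => if ω ∈ survivalSet ξ τ i then 1 else 0) m‖ ≤ tailInt (distTail F) x := by
    intro m ω
    rw [Real.norm_of_nonneg (tailSum_nonneg hf ha.le (fun n => by split_ifs <;> simp) m)]
    refine (tailSum_mono_weight hf ha.le fun n _ => ?_).trans (tailSum_one_le hf m)
    split_ifs <;> simp
  have hmeas : AEStronglyMeasurable (fun ω => tailIntegral F a x (renewalCount ξ (τ ω) ω)) μ :=
    aestronglyMeasurable_of_tendsto_ae atTop (fun m => (hsum m).1.aestronglyMeasurable) hlim
  constructor
  · refine Integrable.of_bound hmeas (tailInt (distTail F) x) ?_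
    filter_upwards [hlim] with ω hω
    exact le_of_tendsto hω.norm (Eventually.of_forall fun m => hbound m ω)
  · have h1 := tendsto_integral_of_dominated_convergence (fun _ => tailInt (distTail F) x)
      (fun m => (hsum m).1.aestronglyMeasurable) (integrable_const _)
      (fun m => Eventually.of_forall fun ω => hbound m ω) hlim
    refine h1.congr fun m => (hsum m).2

open Classical in
/-- Splitting the epochs into those with a jump in `U` and the others. -/
lemma tailSum_markSet_add_le (h : IsCompoundRenewalModel μ F ξ Y) (hτ : Measurable τ)
    (hU : MeasurableSet U) (ha : 0 < a) {q q' b b' : ℝ} (hq : 0 ≤ q) (hq' : 0 ≤ q')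
    (hqq : q + q' = 1) (hb0 : 0 ≤ b) (hb0' : 0 ≤ b') (hb : q * b ≤ a) (hb' : q' * b' ≤ a)
    (x : ℝ) (m : ℕ) :
    q * tailSum (distTail F) b x (fun j => μ.real (markSet U Y (survivalSet ξ τ) j)) m +
      q' * tailSum (distTail F) b' x (fun j => μ.real (markSet Uᶜ Y (survivalSet ξ τ) j)) m ≤
      ∫ ω, tailIntegral F a x (renewalCount ξ (τ ω) ω) ∂μ := by
  have hf := h.isTail
  have hE := measurableSet_survivalSet h.measurable_interarrival hτ
  obtain ⟨i1, e1⟩ := integral_tailSum (μ := μ) (f := distTail F) (a := b) (x := x)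
    (measurableSet_markSet h.measurable_jump hU hE) m
  obtain ⟨i2, e2⟩ := integral_tailSum (μ := μ) (f := distTail F) (a := b') (x := x)
    (measurableSet_markSet h.measurable_jump hU.compl hE) m
  rw [← e1, ← e2, ← integral_const_mul, ← integral_const_mul,
    ← integral_add (i1.const_mul q) (i2.const_mul q')]
  refine integral_mono_ae ((i1.const_mul q).add (i2.const_mul q'))
    (h.tendsto_tailSum_survivalSet hτ ha x).1 ?_
  filter_upwards [h.ae_mem_survivalSet_iff τ] with ω hω
  -- A marked jump that has occurred by `τ` is one of the first `n`, so its rank is below the number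
  -- of such jumps among them.
  have hmark : ∀ (V : Set ℝ) (n : ℕ), (n : ℕ∞) = renewalCount ξ (τ ω) ω → ∀ j,
      ω ∈ markSet V Y (survivalSet ξ τ) j → j < jumpCount V Y n ω := by
    intro V n hn j hj
    obtain ⟨i, h1, h2, h3⟩ := mem_markSet_iff.1 hj
    rw [hω, ← hn] at h1
    have h1' : i < n := by exact_mod_cast h1
    have h4 := jumpCount_mono V Y ω (Nat.succ_le_of_lt h1')
    simp only [Nat.succ_eq_add_one, jumpCount_succ_of_mem h2, h3] at h4
    omega
  -- With infinitely many epochs both sums are at most the full integrated tail; otherwise concavity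
  -- is applied to the two counts, whose sum is `n`.
  rcases eq_or_ne (renewalCount ξ (τ ω) ω) ⊤ with htop | htop
  · rw [htop]
    have key : ∀ (E : ℕ → Set Ω) (b : ℝ), 0 ≤ b → tailSum (distTail F) b x
        (fun j => if ω ∈ E j then 1 else 0) m ≤ tailInt (distTail F) x := fun E b hb => by
      refine (tailSum_mono_weight hf hb fun n _ => ?_).trans (tailSum_one_le hf m)
      split_ifs <;> simp
    have h1 := mul_le_mul_of_nonneg_left (key (markSet U Y (survivalSet ξ τ)) b hb0) hq
    have h2 := mul_le_mul_of_nonneg_left (key (markSet Uᶜ Y (survivalSet ξ τ)) b' hb0') hq'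
    change _ ≤ tailInt (distTail F) x
    calc _ ≤ q * tailInt (distTail F) x + q' * tailInt (distTail F) x := add_le_add h1 h2
      _ = _ := by rw [← add_mul, hqq, one_mul]
  · obtain ⟨n, hn⟩ := ENat.ne_top_iff_exists.1 htop
    have h1 := mul_le_mul_of_nonneg_left (tailSum_indicator_le (x := x) hf hb0 (hmark U n hn) m) hq
    have h2 := mul_le_mul_of_nonneg_left
      (tailSum_indicator_le (x := x) hf hb0' (hmark Uᶜ n hn) m) hq'
    have h3 := tailSum_add_le (x := x) hf hq hq' hqq hb hb' (jumpCount U Y n ω)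
      (jumpCount Uᶜ Y n ω)
    rw [jumpCount_add_compl, tailSum_one hf n] at h3
    rw [← hn]
    change _ ≤ ∫ y in x..(x + a * n), distTail F y
    linarith

lemma measure_past_inter_jump (h : IsCompoundRenewalModel μ F ξ Y) (i : ℕ)
    (hτ : IndepFutureIncrements μ (compoundRenewal c ξ Y) (renewalEpoch ξ) τ)
    (hq : 0 < F.real {0}ᶜ) {E : Set Ω}
    (hE : MeasurableSet[pastSpace μ (compoundRenewal c ξ Y) (renewalEpoch ξ (i + 1)) τ] E)
    {t : Set ℝ} (ht : MeasurableSet t) : μ (E ∩ Y i ⁻¹' t) = μ E * F t := by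
  have := h.isProbabilityMeasure
  have := h.isProbabilityMeasure_map_waitTime (measurableSet_singleton (0 : ℝ)).compl
  have h1 := h.measure_past_inter_mark i hτ hq hE (ht.prod MeasurableSet.univ)
  rw [Measure.prod_prod, measure_univ, mul_one] at h1
  rw [← h1]
  congr 1
  ext ω
  simp

/-- A chain over all epochs that moves down by `b` at each jump in `U`, so its mean increment is
`-(b * F U)`. For `b = a / F U` this drift is `-a`, and the chain inequality then compares the two
ways of counting. -/
lemma isIncrementChain_jumpCount (h : IsCompoundRenewalModel μ F ξ Y) (hτm : Measurable τ)
    (hτ : IndepFutureIncrements μ (compoundRenewal c ξ Y) (renewalEpoch ξ) τ)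
    (hq : 0 < F.real {0}ᶜ) (hU : MeasurableSet U)
    (hpast : ∀ i j, MeasurableSet[pastSpace μ (compoundRenewal c ξ Y) (renewalEpoch ξ (i + 1)) τ]
      {ω | jumpCount U Y i ω = j}) (b : ℝ) :
    IsIncrementChain μ (fun i ω => -(b * jumpCount U Y i ω)) Y (survivalSet ξ τ) F
      (fun y => -(b * U.indicator 1 y)) := by
  have := h.isProbabilityMeasure
  have hSm : ∀ i, Measurable fun ω => -(b * (jumpCount U Y i ω : ℝ)) := fun i =>
    ((measurable_from_nat.comp
      (measurable_jumpCount h.measurable_jump hU i)).const_mul b).neg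
  have hE := measurableSet_survivalSet h.measurable_interarrival hτm
  refine ⟨hSm, h.measurable_jump, hE, fun n => survivalSet_anti ξ τ n.le_succ,
    ((measurable_one.indicator hU).const_mul b).neg, fun n => ?_, fun n => ?_⟩
  · refine Eventually.of_forall fun ω _ => ?_
    by_cases hn : Y n ω ∈ U
    · rw [jumpCount_succ_of_mem hn, Set.indicator_of_mem hn]
      push_cast
      simp only [Pi.one_apply]
      ring
    · rw [jumpCount_succ_of_notMem hn, Set.indicator_of_notMem hn]
      ring
  · have : IsFiniteMeasure ((μ.restrict (survivalSet ξ τ n)).map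
        fun ω => -(b * (jumpCount U Y n ω : ℝ))) := Measure.isFiniteMeasure_map _ _
    refine (Measure.prod_eq fun C t hC ht => ?_).symm
    rw [Measure.map_apply ((hSm n).prodMk (h.measurable_jump n)) (hC.prod ht),
      Measure.map_apply (hSm n) hC, Measure.restrict_apply' (hE n), Measure.restrict_apply' (hE n)]
    have h1 : MeasurableSet[pastSpace μ (compoundRenewal c ξ Y) (renewalEpoch ξ (n + 1)) τ]
        ((fun ω => -(b * (jumpCount U Y n ω : ℝ))) ⁻¹' C) := by
      have h2 : (fun ω => -(b * (jumpCount U Y n ω : ℝ))) ⁻¹' C =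
          ⋃ j : ℕ, {ω | jumpCount U Y n ω = j} ∩ {_ω | -(b * (j : ℝ)) ∈ C} := by
        ext ω; simp
      rw [h2]
      exact MeasurableSet.iUnion fun j => (hpast n j).inter (MeasurableSet.const _)
    have h3 := h.measure_past_inter_jump n hτ hq
      (h1.inter (h.measurableSet_past_survivalSet c τ n)) ht
    rw [← h3]
    congr 1
    ext ω
    simp only [Set.mem_inter_iff, Set.mem_preimage, Set.mem_prod]
    tauto

open Classical in
-- Jumps in `U` are re-indexed by their rank. The rank determines the jump and is at most its index,
-- so ranks below `m` suffice.
lemma sum_setIntegral_jumpCount_le (h : IsCompoundRenewalModel μ F ξ Y) (hτm : Measurable τ)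
    (hU : MeasurableSet U) {φ : ℕ → ℝ} (hφ0 : ∀ j, 0 ≤ φ j) (hφ1 : ∀ j, φ j ≤ 1) (m : ℕ) :
    ∑ i ∈ Finset.range m, ∫ ω in survivalSet ξ τ i,
        φ (jumpCount U Y i ω) * U.indicator 1 (Y i ω) ∂μ ≤
      ∑ j ∈ Finset.range m, μ.real (markSet U Y (survivalSet ξ τ) j) * φ j := by
  have hE := measurableSet_survivalSet h.measurable_interarrival hτm
  have hM := measurableSet_markSet h.measurable_jump hU hE
  have hm1 : ∀ i, Measurable fun ω => φ (jumpCount U Y i ω) * U.indicator 1 (Y i ω) := fun i =>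
    (measurable_from_nat.comp (measurable_jumpCount h.measurable_jump hU i)).mul
      ((measurable_one.indicator hU).comp (h.measurable_jump i))
  have hi1 : ∀ i, Integrable (fun ω => φ (jumpCount U Y i ω) * U.indicator 1 (Y i ω)) μ := fun i => by
    refine Integrable.of_bound (hm1 i).aestronglyMeasurable 1 (Eventually.of_forall fun ω => ?_)
    simp only [Set.indicator, Pi.one_apply]
    split_ifs
    · rw [mul_one, Real.norm_of_nonneg (hφ0 _)]; exact hφ1 _
    · simp
  have hi2 : ∀ i, Integrable ((survivalSet ξ τ i).indicator
      fun ω => φ (jumpCount U Y i ω) * U.indicator 1 (Y i ω)) μ := fun i => (hi1 i).indicator (hE i)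
  have hi3 : ∀ j, Integrable ((markSet U Y (survivalSet ξ τ) j).indicator
      fun _ => φ j) μ := fun j => (integrable_const _).indicator (hM j)
  have e1 : ∀ i, ∫ ω in survivalSet ξ τ i, φ (jumpCount U Y i ω) * U.indicator 1 (Y i ω) ∂μ =
      ∫ ω, (survivalSet ξ τ i).indicator
        (fun ω => φ (jumpCount U Y i ω) * U.indicator 1 (Y i ω)) ω ∂μ := fun i =>
    (integral_indicator (hE i)).symm
  have e2 : ∀ j, μ.real (markSet U Y (survivalSet ξ τ) j) * φ j =
      ∫ ω, (markSet U Y (survivalSet ξ τ) j).indicator (fun _ => φ j) ω ∂μ := fun j => by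
    rw [integral_indicator (hM j), setIntegral_const, smul_eq_mul]
  simp_rw [e1, e2]
  rw [← integral_finsetSum _ fun i _ => hi2 i, ← integral_finsetSum _ fun j _ => hi3 j]
  refine integral_mono (integrable_finsetSum _ fun i _ => hi2 i)
    (integrable_finsetSum _ fun j _ => hi3 j) fun ω => ?_
  simp only
  have h1 : ∀ i ∈ Finset.range m, (survivalSet ξ τ i).indicator
      (fun ω => φ (jumpCount U Y i ω) * U.indicator 1 (Y i ω)) ω =
      if ω ∈ survivalSet ξ τ i ∧ Y i ω ∈ U then φ (jumpCount U Y i ω) else 0 := fun i _ => by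
    by_cases h2 : ω ∈ survivalSet ξ τ i <;> by_cases h3 : Y i ω ∈ U <;> simp [h2, h3]
  rw [Finset.sum_congr rfl h1, ← Finset.sum_filter]
  have hinj : Set.InjOn (fun i => jumpCount U Y i ω)
      ((Finset.range m).filter fun i => ω ∈ survivalSet ξ τ i ∧ Y i ω ∈ U : Finset ℕ) := by
    intro i hi k hk hik
    rw [Finset.mem_coe, Finset.mem_filter] at hi hk
    exact eq_of_jumpCount_eq hi.2.2 hk.2.2 hik
  rw [← Finset.sum_image (f := φ) hinj]
  have h2 : ∑ j ∈ Finset.image (fun i => jumpCount U Y i ω)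
        ((Finset.range m).filter fun i => ω ∈ survivalSet ξ τ i ∧ Y i ω ∈ U), φ j =
      ∑ j ∈ Finset.image (fun i => jumpCount U Y i ω)
        ((Finset.range m).filter fun i => ω ∈ survivalSet ξ τ i ∧ Y i ω ∈ U),
        (markSet U Y (survivalSet ξ τ) j).indicator (fun _ => φ j) ω := by
    refine Finset.sum_congr rfl fun j hj => ?_
    obtain ⟨i, hi, rfl⟩ := Finset.mem_image.1 hj
    rw [Finset.mem_filter] at hi
    rw [Set.indicator_of_mem]
    exact mem_markSet_iff.2 ⟨i, hi.2.1, hi.2.2, rfl⟩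
  rw [h2]
  refine Finset.sum_le_sum_of_subset_of_nonneg (fun j hj => ?_) fun j _ _ =>
    Set.indicator_nonneg (fun _ _ => hφ0 j) _
  obtain ⟨i, hi, rfl⟩ := Finset.mem_image.1 hj
  rw [Finset.mem_filter, Finset.mem_range] at hi
  exact Finset.mem_range.2 ((jumpCount_le i).trans_lt hi.1)

end IsCompoundRenewalModel

namespace IsCompoundRenewalModel

variable {Ω : Type*} [MeasurableSpace Ω] {μ : Measure Ω} [IsProbabilityMeasure μ] {F : Measure ℝ}
  {ξ Y : ℕ → Ω → ℝ} {U : Set ℝ} {c a x : ℝ} {τ : Ω → ℝ≥0∞}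

/-- Counting only the epochs with a jump in `U` does not decrease the weighted tail sums much. -/
lemma eventually_tailSum_survivalSet_le (h : IsCompoundRenewalModel μ F ξ Y) (hF : IsLongTailed F)
    (hq0 : 0 < F.real {0}ᶜ) (hU : MeasurableSet U) (hq : 0 < F.real U) (ha : 0 < a) {δ : ℝ}
    (hδ : 0 < δ) : ∀ᶠ x in atTop, ∀ τ : Ω → ℝ≥0∞, Measurable τ →
      IndepFutureIncrements μ (compoundRenewal c ξ Y) (renewalEpoch ξ) τ →
      (∀ i j, MeasurableSet[pastSpace μ (compoundRenewal c ξ Y) (renewalEpoch ξ (i + 1)) τ]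
        {ω | jumpCount U Y i ω = j}) → ∀ m,
      tailSum (distTail F) a x (fun i => μ.real (survivalSet ξ τ i)) m ≤
        (1 + δ) * tailSum (distTail F) (a / F.real U) x
          (fun j => μ.real (markSet U Y (survivalSet ξ τ) j)) m := by
  have := h.isProbabilityMeasure
  have hf := h.isTail
  have hf1 : ∀ y, distTail F y ≤ 1 := fun y => measureReal_le_one
  set f := distTail F with hfdef
  set q := F.real U with hqdef
  set b := a / q with hb
  have hb0 : 0 < b := by positivity
  have hqb : q * b = a := by rw [hb]; field_simp
  -- One factor `1 + δ'` pays for the Huber error, another for the shift of the tail.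
  set δ' := min 1 (δ / 3) with hδ'
  have hδ'0 : 0 < δ' := by positivity
  have hδ'1 : (1 + δ') * (1 + δ') ≤ 1 + δ := by
    have h1 : δ' ≤ 1 := min_le_left _ _
    have h2 : δ' ≤ δ / 3 := min_le_right _ _
    nlinarith
  set ζ : ℝ → ℝ := fun y => -(b * U.indicator 1 y) with hζdef
  have hindi : Integrable (U.indicator (1 : ℝ → ℝ)) F := (integrable_const (1 : ℝ)).indicator hU
  have hζ : Integrable ζ F := (hindi.const_mul b).neg
  have hζint : ∫ y, ζ y ∂F = -a := by
    rw [hζdef, integral_neg, integral_const_mul, integral_indicator_one hU, mul_comm, hqb]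
  have hζ' : Integrable (fun y => -(ζ y + a)) F := (hζ.add (integrable_const a)).neg
  obtain ⟨L, hL, hL0⟩ := ((eventually_integral_huberErr_le hζ'
    (show 0 < a * δ' by positivity)).and (eventually_gt_atTop 0)).exists
  -- The shift consists of `L / 2` from the chain inequality and of `b` from comparing a value of
  -- the tail with its integral over the cell to the left.
  obtain ⟨x₁, hx₁⟩ := eventually_atTop.1 (hF.eventually_shift_le (L / 2 + b) hδ'0)
  filter_upwards [eventually_ge_atTop x₁] with x hx τ hτm hτ hpast m
  have hC := h.isIncrementChain_jumpCount hτm hτ hq0 hU hpast b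
  have hS0 : (fun ω => -(b * (jumpCount U Y 0 ω : ℝ))) = fun _ => 0 := by
    funext ω; simp [jumpCount_zero]
  have h1 := hC.sum_integral_le hf hf1 hζ hζint ha.le hL0 hL
    (by simp only [hS0]; exact integrable_const _) x m
  have h2 : ∫ ω, huberErr L (- -(b * (jumpCount U Y 0 ω : ℝ))) ∂μ = 0 := by
    simp [jumpCount_zero, huberErr]
  rw [h2, mul_zero, add_zero] at h1
  set w := fun j => μ.real (markSet U Y (survivalSet ξ τ) j) with hw
  have hw0 : ∀ j, 0 ≤ w j := fun j => measureReal_nonneg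
  have h3 : q * ∑ n ∈ Finset.range m, ∫ ω in survivalSet ξ τ n,
      f (x - L / 2 - -(b * (jumpCount U Y n ω : ℝ))) ∂μ ≤
      ∑ j ∈ Finset.range m, w j * f (x - L / 2 - -(b * j)) := by
    refine le_trans (le_of_eq ?_) (h.sum_setIntegral_jumpCount_le hτm hU
      (φ := fun j => f (x - L / 2 - -(b * j))) (fun j => hf.nonneg _) (fun j => hf1 _) m)
    rw [Finset.mul_sum]
    refine Finset.sum_congr rfl fun n _ => ?_
    have h4 := hC.setIntegral_mul n (φ := fun s => f (x - L / 2 - s)) (k := U.indicator 1)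
      (hf.measurable.comp (measurable_const.sub measurable_id)) (measurable_one.indicator hU)
    rw [integral_indicator_one hU, mul_comm] at h4
    exact h4.symm
  have h5 : b * ∑ j ∈ Finset.range m, w j * f (x - L / 2 - -(b * j)) ≤
      tailSum f b (x - (L / 2 + b)) w m := by
    rw [Finset.mul_sum]
    refine Finset.sum_le_sum fun j _ => ?_
    have h6 := hf.mul_le_integral (show x - (L / 2 + b) + b * j ≤ x - (L / 2 + b) + b * (j + 1) by
      linarith)
    rw [show x - (L / 2 + b) + b * (j + 1) - (x - (L / 2 + b) + b * j) = b by ring] at h6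
    rw [show x - L / 2 - -(b * j) = x - (L / 2 + b) + b * ((j : ℝ) + 1) by ring]
    have := mul_le_mul_of_nonneg_left h6 (hw0 j)
    linarith
  have h7 : tailSum f b (x - (L / 2 + b)) w m ≤ (1 + δ') * tailSum f b x w m :=
    tailSum_sub_le hf hb0.le hw0 (fun y hy => hx₁ y (hx.trans hy)) m
  have h8 : 0 ≤ tailSum f b x w m := tailSum_nonneg hf hb0.le hw0 m
  set σ := ∑ n ∈ Finset.range m, ∫ ω in survivalSet ξ τ n,
      f (x - L / 2 - -(b * (jumpCount U Y n ω : ℝ))) ∂μ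
  have h9 : a * σ ≤ (1 + δ') * tailSum f b x w m := by
    rw [← hqb, mul_comm q b, mul_assoc]
    exact ((mul_le_mul_of_nonneg_left h3 hb0.le).trans h5).trans h7
  have h10 := mul_le_mul_of_nonneg_left h9 (show 0 ≤ 1 + δ' by linarith)
  have h11 := mul_le_mul_of_nonneg_right hδ'1 h8
  refine h1.trans ?_
  calc (a + a * δ') * σ = (1 + δ') * (a * σ) := by ring
    _ ≤ (1 + δ') * ((1 + δ') * tailSum f b x w m) := h10
    _ = (1 + δ') * (1 + δ') * tailSum f b x w m := by ring
    _ ≤ _ := h11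

/-- Zero jumps cannot be counted from the path, but among the first `i` jumps they are the ones left
over, and `i` is fixed. -/
lemma measurableSet_past_jumpCount_compl (h : IsCompoundRenewalModel μ F ξ Y) (c : ℝ)
    (τ : Ω → ℝ≥0∞) (i : ℕ) (hU : MeasurableSet U) (hU0 : (0 : ℝ) ∉ U) (j : ℕ) :
    MeasurableSet[pastSpace μ (compoundRenewal c ξ Y) (renewalEpoch ξ (i + 1)) τ]
      {ω | jumpCount Uᶜ Y i ω = j} := by
  have h1 : {ω | jumpCount Uᶜ Y i ω = j} =
      ⋃ k : ℕ, {ω | jumpCount U Y i ω = k} ∩ {_ω | k + j = i} := by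
    ext ω
    have := jumpCount_add_compl (U := U) (Y := Y) (ω := ω) i
    simp only [Set.mem_ofPred_eq, Set.mem_iUnion, Set.mem_inter_iff, exists_eq_left']
    omega
  rw [h1]
  exact MeasurableSet.iUnion fun k =>
    (h.measurableSet_past_jumpCount c τ i hU hU0 k).inter (MeasurableSet.const _)

lemma eventually_integral_tailIntegral_le (h : IsCompoundRenewalModel μ F ξ Y)
    (hF : IsLongTailed F) (hq : 0 < F.real {0}ᶜ) (ha : 0 < a) {δ : ℝ} (hδ : 0 < δ) :
    ∀ᶠ x in atTop, ∀ τ : Ω → ℝ≥0∞, Measurable τ →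
      IndepFutureIncrements μ (compoundRenewal c ξ Y) (renewalEpoch ξ) τ → ∀ R : ℝ,
      (∀ m, tailSum (distTail F) (a / F.real {0}ᶜ) x
        (fun j => μ.real (markSet {0}ᶜ Y (survivalSet ξ τ) j)) m ≤ R) →
      ∫ ω, tailIntegral F a x (renewalCount ξ (τ ω) ω) ∂μ ≤ (1 + δ) * R := by
  have hU : MeasurableSet ({0}ᶜ : Set ℝ) := (measurableSet_singleton 0).compl
  filter_upwards [h.eventually_tailSum_survivalSet_le (c := c) hF hq hU hq ha hδ]
    with x hx τ hτm hτ R hR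
  refine le_of_tendsto (h.tendsto_tailSum_survivalSet hτm ha x).2 (Eventually.of_forall fun m => ?_)
  exact (hx τ hτm hτ (fun i j => h.measurableSet_past_jumpCount c τ i hU (by simp) j) m).trans
    (mul_le_mul_of_nonneg_left (hR m) (by linarith))

/-- Let `V` and `V'` be the sums over nonzero and zero jumps and `I` the target. Concavity gives `q
V + q' V' ≤ I`, while the counting chain for zero jumps gives `I ≤ (1 + δ q) V'` in the limit. With
`q' = 1 - q` these combine to `V ≤ (1 + δ) I`. -/
lemma eventually_tailSum_markSet_le (h : IsCompoundRenewalModel μ F ξ Y)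
    (hF : IsLongTailed F) (hq : 0 < F.real {0}ᶜ) (ha : 0 < a) {δ : ℝ} (hδ : 0 < δ) :
    ∀ᶠ x in atTop, ∀ τ : Ω → ℝ≥0∞, Measurable τ →
      IndepFutureIncrements μ (compoundRenewal c ξ Y) (renewalEpoch ξ) τ → ∀ m,
      tailSum (distTail F) (a / F.real {0}ᶜ) x
        (fun j => μ.real (markSet {0}ᶜ Y (survivalSet ξ τ) j)) m ≤
      (1 + δ) * ∫ ω, tailIntegral F a x (renewalCount ξ (τ ω) ω) ∂μ := by
  have := h.isProbabilityMeasure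
  have hU : MeasurableSet ({0}ᶜ : Set ℝ) := (measurableSet_singleton 0).compl
  have hf := h.isTail
  set q := F.real {0}ᶜ with hqdef
  set q' := F.real ({0}ᶜᶜ : Set ℝ) with hq'def
  have hqq : q + q' = 1 := by
    rw [hqdef, hq'def, measureReal_add_measureReal_compl hU, probReal_univ]
  have hq'0 : 0 ≤ q' := measureReal_nonneg
  have hqb : q * (a / q) = a := by field_simp
  -- If zero jumps have probability zero, concavity alone is enough, and `a / q'` would be
  -- meaningless.
  rcases hq'0.eq_or_lt with hq' | hq'
  · refine Eventually.of_forall fun x τ hτm hτ m => ?_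
    have hq1 : q = 1 := by linarith
    have h1 := h.tailSum_markSet_add_le (b := a / q) (b' := 0) hτm hU ha zero_le_one le_rfl
      (by norm_num) (by positivity) le_rfl (by rw [hq1]; simp) (by simpa using ha.le) x m
    rw [one_mul, zero_mul, add_zero] at h1
    have h2 : 0 ≤ tailSum (distTail F) (a / q) x
        (fun j => μ.real (markSet {0}ᶜ Y (survivalSet ξ τ) j)) m :=
      tailSum_nonneg hf (by positivity) (fun _ => measureReal_nonneg) m
    nlinarith
  · filter_upwards [h.eventually_tailSum_survivalSet_le (c := c) hF hq hU.compl hq' ha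
      (show 0 < δ * q by positivity)] with x hx τ hτm hτ m
    set I := ∫ ω, tailIntegral F a x (renewalCount ξ (τ ω) ω) ∂μ with hI
    obtain ⟨-, hlim⟩ := h.tendsto_tailSum_survivalSet (F := F) hτm ha x
    have hq'b : q' * (a / q') = a := by field_simp
    set V := tailSum (distTail F) (a / q) x
      (fun j => μ.real (markSet {0}ᶜ Y (survivalSet ξ τ) j)) with hV
    have h1 : ∀ᶠ M in atTop, tailSum (distTail F) a x (fun i => μ.real (survivalSet ξ τ i)) M ≤
        (1 + δ * q) / q' * (I - q * V m) := by
      filter_upwards [eventually_ge_atTop m] with M hM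
      have h2 := h.tailSum_markSet_add_le (b := a / q) (b' := a / q') hτm hU ha hq.le hq'0 hqq
        (by positivity) (by positivity) hqb.le hq'b.le x M
      have h3 := hx τ hτm hτ
        (fun i j => h.measurableSet_past_jumpCount_compl c τ i hU (by simp) j) M
      have h4 : V m ≤ V M := tailSum_mono hf (by positivity) (fun _ => measureReal_nonneg) hM
      set V' := tailSum (distTail F) (a / q') x
        (fun j => μ.real (markSet {0}ᶜᶜ Y (survivalSet ξ τ) j)) M with hV'
      have h5 : q' * V' ≤ I - q * V m := by
        have := mul_le_mul_of_nonneg_left h4 hq.le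
        linarith
      refine h3.trans ?_
      rw [div_mul_eq_mul_div, le_div_iff₀ hq']
      calc (1 + δ * q) * V' * q' = (1 + δ * q) * (q' * V') := by ring
        _ ≤ _ := mul_le_mul_of_nonneg_left h5 (by positivity)
    have h2 := le_of_tendsto hlim h1
    have hI0 : 0 ≤ I := ge_of_tendsto hlim (Eventually.of_forall fun M =>
      tailSum_nonneg hf ha.le (fun _ => measureReal_nonneg) M)
    rw [div_mul_eq_mul_div, le_div_iff₀ hq'] at h2
    have hq1 : q' ≤ 1 := by linarith
    have h6 : (1 + δ * q) * q * V m ≤ ((1 + δ * q) - q') * I := by nlinarith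
    have h7 : ((1 + δ * q) - q') * I = q * ((1 + δ) * I) := by
      have : q' = 1 - q := by linarith
      rw [this]; ring
    have hV0 : 0 ≤ V m := tailSum_nonneg hf (by positivity) (fun _ => measureReal_nonneg) m
    have h8 : q * V m ≤ q * ((1 + δ) * I) := by
      refine le_trans ?_ (h6.trans_eq h7)
      nlinarith [mul_nonneg (mul_nonneg (mul_nonneg hδ.le hq.le) hq.le) hV0]
    exact le_of_mul_le_mul_left h8 hq

end IsCompoundRenewalModel

/-! ### The maximum of the process -/

lemma chainState_add_fst_le_of_mem_activeSet {Ω : Type*} {ξ Y : ℕ → Ω → ℝ} {ω : Ω} {c x : ℝ}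
    {τ : Ω → ℝ≥0∞} {j : ℕ} (hω : ω ∈ markSet {0}ᶜ Y (activeSet c ξ Y τ x) (j + 1)) :
    chainState c ξ Y j ω + (chainMark ξ Y j ω).1 ≤ x := by
  obtain ⟨i, h1, h2, h3⟩ := mem_markSet_iff.1 hω
  obtain ⟨k, hk, h4, h5⟩ := exists_lt_of_jumpCount_eq_succ h3
  have h6 := h1.2 (k + 1) hk
  rw [chainState_eq h4 h5, chainMark_eq h4 h5]
  rw [jumpSum_succ] at h6
  have := le_max_left (c * renewalEpoch ξ (k + 1) ω) (c * renewalEpoch ξ (k + 1 + 1) ω)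
  simp only
  linarith

lemma measureReal_iUnion_le_of_sum_le {Ω : Type*} [MeasurableSpace Ω] {μ : Measure Ω}
    [IsFiniteMeasure μ] {D : ℕ → Set Ω} {R : ℝ}
    (h : ∀ m, ∑ j ∈ Finset.range m, μ.real (D j) ≤ R) : μ.real (⋃ j, D j) ≤ R := by
  have hR : 0 ≤ R := by simpa using h 0
  refine ENNReal.toReal_le_of_le_ofReal hR ((measure_iUnion_le D).trans ?_)
  refine ENNReal.tsum_le_of_sum_range_le fun m => ?_
  rw [← ENNReal.ofReal_toReal (a := ∑ j ∈ Finset.range m, μ (D j))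
    (ENNReal.sum_ne_top.2 fun j _ => measure_ne_top μ _),
    ENNReal.toReal_sum fun j _ => measure_ne_top μ _]
  exact ENNReal.ofReal_le_ofReal (h m)

lemma IsStrongTail.isLongTailed {F : Measure ℝ} (hf : IsStrongTail (distTail F)) :
    IsLongTailed F := by
  refine ⟨hf.pos, ?_⟩
  rw [tendsto_order]
  constructor
  · intro r hr
    have hε : 0 < (1 - r) / 2 := by linarith
    have hsh := (tendsto_atTop_add_const_right atTop (1 : ℝ) tendsto_id).eventually
      (hf.shift 1 _ hε)
    filter_upwards [hsh] with x hx
    simp only [id, add_sub_cancel_right] at hx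
    rw [lt_div_iff₀ (hf.pos x)]
    have h1 := hf.pos x
    have h2 := hf.pos (x + 1)
    by_contra hcon
    rw [not_lt] at hcon
    rcases le_or_gt r 0 with h0 | h0
    · nlinarith
    · have h3 := mul_le_mul_of_nonneg_left hcon (show 0 ≤ 1 + (1 - r) / 2 by linarith)
      nlinarith [mul_pos h1 (mul_pos (sub_pos.2 hr) (sub_pos.2 hr))]
  · intro r hr
    refine Eventually.of_forall fun x => lt_of_le_of_lt ?_ hr
    rw [div_le_one (hf.pos x)]
    exact hf.anti (by linarith)

/-! ### The lower bound for the maximum -/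

namespace IsCompoundRenewalModel

variable {Ω : Type*} [MeasurableSpace Ω] {μ : Measure Ω} [IsProbabilityMeasure μ] {F : Measure ℝ}
  {ξ Y : ℕ → Ω → ℝ} {c a x : ℝ} {τ : Ω → ℝ≥0∞}

lemma measureReal_compl_zero_pos (h : IsCompoundRenewalModel μ F ξ Y)
    (hpos : ∀ x, 0 < distTail F x) : 0 < F.real {0}ᶜ := by
  have := h.isProbabilityMeasure
  refine (hpos 0).trans_le (measureReal_mono fun y hy => ?_)
  exact (ne_of_gt hy : y ≠ 0)

lemma markLaw_real_lt_fst (h : IsCompoundRenewalModel μ F ξ Y) {u : ℝ} (hu : 0 ≤ u) :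
    (markLaw μ F {0}ᶜ ξ Y).real {w | u < w.1} = distTail F u / F.real {0}ᶜ := by
  have := h.isProbabilityMeasure
  have hU : MeasurableSet ({0}ᶜ : Set ℝ) := (measurableSet_singleton 0).compl
  have := h.isProbabilityMeasure_map_waitTime hU
  have h1 : {w : ℝ × ℝ | u < w.1} = Set.Ioi u ×ˢ Set.univ := by ext w; simp
  have h2 : ({0}ᶜ : Set ℝ) ∩ Set.Ioi u = Set.Ioi u := by
    refine Set.inter_eq_right.2 fun y hy => ?_
    exact (ne_of_gt (hu.trans_lt hy) : y ≠ 0)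
  rw [Measure.real, h1, markLaw, Measure.prod_prod, measure_univ, mul_one, cond_apply hU, h2,
    ENNReal.toReal_mul, ENNReal.toReal_inv, div_eq_inv_mul]
  rfl

open Classical in
-- An active state is at most `x`. Given it, the independent nonzero jump crosses with conditional
-- probability equal to the tail at `x` minus the state, divided by `F {0}ᶜ`.
lemma setIntegral_distTail_le (h : IsCompoundRenewalModel μ F ξ Y) (hτm : Measurable τ)
    (hτ : IndepFutureIncrements μ (compoundRenewal c ξ Y) (renewalEpoch ξ) τ)
    (hq : 0 < F.real {0}ᶜ) (x : ℝ) (j : ℕ) :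
    ∫ ω in markSet {0}ᶜ Y (activeSet c ξ Y τ x) j, distTail F (x - chainState c ξ Y j ω) ∂μ ≤
      F.real {0}ᶜ * μ.real (markSet {0}ᶜ Y (activeSet c ξ Y τ x) j ∩
        {ω | x < chainState c ξ Y j ω + (chainMark ξ Y j ω).1}) := by
  have := h.isProbabilityMeasure
  have hU : MeasurableSet ({0}ᶜ : Set ℝ) := (measurableSet_singleton 0).compl
  have := h.isProbabilityMeasure_markLaw hU hq
  have hf := h.isTail
  have hf1 : ∀ y, distTail F y ≤ 1 := fun y => measureReal_le_one
  have hC := h.isIncrementChain hτm hτ hq x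
  set q := F.real {0}ᶜ with hqdef
  have hq1 : q ≤ 1 := measureReal_le_one
  have hq1' : 1 ≤ 1 / q := by rw [le_div_iff₀ hq]; linarith
  have hms : MeasurableSet {p : ℝ × (ℝ × ℝ) | p.1 ≤ x ∧ x < p.1 + p.2.1} :=
    (measurableSet_le measurable_fst measurable_const).inter
      (measurableSet_lt measurable_const (measurable_fst.add measurable_snd.fst))
  have hDm : MeasurableSet {ω | x < chainState c ξ Y j ω + (chainMark ξ Y j ω).1} :=
    measurableSet_lt measurable_const
      ((hC.measurable_state j).add (hC.measurable_mark j).fst)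
  -- The condition `s ≤ x`, automatic on the active event, is inserted so that the kernel inequality
  -- holds for every real `s`. The signs are reversed because that comparison bounds from above.
  have h1 := hC.setIntegral_le_of_forall j
    (h := fun s w => -(if s ≤ x ∧ x < s + w.1 then 1 else 0))
    (φ := fun s => -(if s ≤ x then distTail F (x - s) / q else 0)) (M := 1 / q)
    (Measurable.ite hms measurable_const measurable_const).neg
    (fun s w => by
      rw [abs_neg]
      split_ifs
      · rw [abs_one]; exact hq1'
      · rw [abs_zero]; positivity)
    (Measurable.ite measurableSet_Iic
      ((hf.measurable.comp (measurable_const.sub measurable_id)).div_const q) measurable_const).neg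
    (fun s => by
      rw [abs_neg]
      split_ifs
      · rw [abs_of_nonneg (div_nonneg (hf.nonneg _) hq.le)]
        exact div_le_div_of_nonneg_right (hf1 _) hq.le
      · rw [abs_zero]; positivity)
    (fun s => by
      rw [integral_neg, neg_le_neg_iff]
      by_cases hs : s ≤ x
      · simp only [hs, true_and, if_true]
        rw [← h.markLaw_real_lt_fst (sub_nonneg.2 hs), ← integral_indicator_one]
        · refine le_of_eq (integral_congr_ae (Eventually.of_forall fun w => ?_))
          simp only [Set.indicator, Set.mem_ofPred_eq, Pi.one_apply, sub_lt_iff_lt_add']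
        · exact measurableSet_lt measurable_const measurable_fst
      · simp [hs])
  rw [integral_neg, integral_neg, neg_le_neg_iff] at h1
  have hB := hC.measurableSet j
  have e1 : ∫ ω in markSet {0}ᶜ Y (activeSet c ξ Y τ x) j,
      (if chainState c ξ Y j ω ≤ x then distTail F (x - chainState c ξ Y j ω) / q else 0) ∂μ =
      (∫ ω in markSet {0}ᶜ Y (activeSet c ξ Y τ x) j,
        distTail F (x - chainState c ξ Y j ω) ∂μ) / q := by
    rw [← integral_div]
    refine setIntegral_congr_fun hB fun ω hω => ?_
    simp only [chainState_le_of_mem_activeSet hω, if_true]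
  have e2 : ∫ ω in markSet {0}ᶜ Y (activeSet c ξ Y τ x) j, (if chainState c ξ Y j ω ≤ x ∧
      x < chainState c ξ Y j ω + (chainMark ξ Y j ω).1 then (1 : ℝ) else 0) ∂μ =
      μ.real (markSet {0}ᶜ Y (activeSet c ξ Y τ x) j ∩
        {ω | x < chainState c ξ Y j ω + (chainMark ξ Y j ω).1}) := by
    rw [Set.inter_comm, ← measureReal_restrict_apply hDm, ← integral_indicator_one hDm]
    refine setIntegral_congr_fun hB fun ω hω => ?_
    simp only [chainState_le_of_mem_activeSet hω, true_and, Set.indicator, Set.mem_ofPred_eq,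
      Pi.one_apply]
  rw [e1, e2, div_le_iff₀ hq] at h1
  linarith

/-- Being active at a later nonzero jump means that no earlier one crossed, so these events are
disjoint; each of them implies that the maximum exceeds `x`. -/
lemma sum_measureReal_cross_le (h : IsCompoundRenewalModel μ F ξ Y) (hτm : Measurable τ)
    (x : ℝ) (m : ℕ) :
    ∑ j ∈ Finset.range m, μ.real (markSet {0}ᶜ Y (activeSet c ξ Y τ x) j ∩
        {ω | x < chainState c ξ Y j ω + (chainMark ξ Y j ω).1}) ≤
      μ.real {ω | (x : EReal) < pathSup (compoundRenewal c ξ Y) (τ ω) ω} := by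
  have hU : MeasurableSet ({0}ᶜ : Set ℝ) := (measurableSet_singleton 0).compl
  have hm := h.measurable_interarrival
  have hm' := h.measurable_jump
  rw [← measureReal_biUnion_finset]
  · refine ENNReal.toReal_mono (measure_ne_top μ _) (measure_mono_ae ?_)
    filter_upwards [h.ae_isRegularPath] with ω hω hmem
    obtain ⟨j, hj⟩ := Set.mem_iUnion.1 hmem
    obtain ⟨_, hj⟩ := Set.mem_iUnion.1 hj
    exact hω.lt_pathSup_of_chain hj.1 hj.2
  · have key : ∀ i j, i < j → Disjoint
        (markSet {0}ᶜ Y (activeSet c ξ Y τ x) i ∩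
          {ω | x < chainState c ξ Y i ω + (chainMark ξ Y i ω).1})
        (markSet {0}ᶜ Y (activeSet c ξ Y τ x) j ∩
          {ω | x < chainState c ξ Y j ω + (chainMark ξ Y j ω).1}) := by
      intro i j hij
      refine Set.disjoint_left.2 fun ω h1 h2 => ?_
      have hanti : Antitone (markSet {0}ᶜ Y (activeSet c ξ Y τ x)) :=
        antitone_nat_of_succ_le (markSet_succ_subset (activeSet_anti c ξ Y τ x))
      have h3 := chainState_add_fst_le_of_mem_activeSet (hanti (Nat.succ_le_of_lt hij) h2.1)
      exact absurd h1.2 (not_lt.2 h3)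
    intro i _ j _ hij
    rcases lt_or_gt_of_ne hij with h1 | h1
    · exact key i j h1
    · exact (key j i h1).symm
  · exact fun j _ => (measurableSet_markSet hm' hU (measurableSet_activeSet hm hm' hτm c x) j).inter
      (measurableSet_lt measurable_const
        ((measurable_chainState hm hm' c j).add (measurable_chainMark hm hm' j).fst))

/-- An epoch that comes before `τ` but is not active must follow a crossing. The extra probability
will be multiplied by an integrated tail, which is small. -/
lemma measureReal_survival_le (h : IsCompoundRenewalModel μ F ξ Y) (c x : ℝ) (τ : Ω → ℝ≥0∞) (j : ℕ) :
    μ.real (markSet {0}ᶜ Y (survivalSet ξ τ) j) ≤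
      μ.real (markSet {0}ᶜ Y (activeSet c ξ Y τ x) j) +
        μ.real {ω | (x : EReal) < pathSup (compoundRenewal c ξ Y) (τ ω) ω} := by
  refine le_trans (ENNReal.toReal_mono (measure_ne_top μ _) (measure_mono_ae ?_))
    (measureReal_union_le _ _)
  filter_upwards [h.ae_isRegularPath] with ω hω hmem
  obtain ⟨i, h1, h2, h3⟩ := mem_markSet_iff.1 hmem
  by_cases h4 : ω ∈ activeSet c ξ Y τ x i
  · exact Or.inl (mem_markSet_iff.2 ⟨i, h4, h2, h3⟩)
  · exact Or.inr (hω.lt_pathSup_of_notMem_activeSet h1 h4)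

/-- The lower bound for the tail of the maximum. -/
theorem eventually_le_measureReal_pathSup (h : IsCompoundRenewalModel μ F ξ Y)
    (hF : IsLongTailed F) (ha : 0 < a) (hdrift : ∫ ω, (c * ξ 0 ω + Y 0 ω) ∂μ = -a)
    {ε : ℝ} (hε : 0 < ε) : ∀ᶠ x in atTop, ∀ τ : Ω → ℝ≥0∞, Measurable τ →
      IndepFutureIncrements μ (compoundRenewal c ξ Y) (renewalEpoch ξ) τ →
      (1 - ε) / a * (∫ ω, tailIntegral F a x (renewalCount ξ (τ ω) ω) ∂μ) - ε * distTail F x ≤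
        μ.real {ω | (x : EReal) < pathSup (compoundRenewal c ξ Y) (τ ω) ω} := by
  have := h.isProbabilityMeasure
  have hU : MeasurableSet ({0}ᶜ : Set ℝ) := (measurableSet_singleton 0).compl
  have hq := h.measureReal_compl_zero_pos hF.1
  have := h.isProbabilityMeasure_markLaw hU hq
  have hf := h.isTail
  have hf1 : ∀ y, distTail F y ≤ 1 := fun y => measureReal_le_one
  set f := distTail F with hfdef
  set q := F.real {0}ᶜ with hqdef
  set b := a / q with hb
  have hb0 : 0 < b := by positivity
  have hbq : b * q = a := by rw [hb]; field_simp
  -- The accumulated factor `(1 + e)² (1 + 2 e)` is at most `1 + 8 e ≤ 1 + ε`, and `e / a ≤ ε / 2`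
  -- controls the coefficient of `f x`.
  set e := min (min (1 / 4) (ε / 8)) (a * ε / 2) with he
  have he0 : 0 < e := by positivity
  have he1 : e ≤ 1 / 4 := (min_le_left _ _).trans (min_le_left _ _)
  have he2 : e ≤ ε / 8 := (min_le_left _ _).trans (min_le_right _ _)
  have he3 : e ≤ a * ε / 2 := min_le_right _ _
  obtain ⟨hζ, hζb⟩ := h.integrable_markLaw hU hq (by simp) hdrift
  have hζ' : Integrable (fun w : ℝ × ℝ => -(w.1 + c * w.2 + b)) (markLaw μ F {0}ᶜ ξ Y) :=
    (hζ.add (integrable_const b)).neg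
  have hS : chainState c ξ Y 0 =ᵐ[μ] fun ω => c * waitTime {0}ᶜ ξ Y 0 ω := by
    filter_upwards [h.ae_frequently_mem hU hq] with ω hω
    exact chainState_zero hω
  have hSi : Integrable (chainState c ξ Y 0) μ :=
    ((h.integrable_waitTime hU hq).1.const_mul c).congr hS.symm
  obtain ⟨L, ⟨hL1, hL2⟩, hL0⟩ := (((eventually_integral_huberErr_le hζ'
    (show 0 < b * e by positivity)).and (eventually_integral_huberErr_le hSi.neg he0)).and
    (eventually_gt_atTop 0)).exists
  have hshift : Tendsto (fun x : ℝ => x + L / 2) atTop atTop :=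
    tendsto_atTop_add_const_right _ _ tendsto_id
  obtain ⟨x₁, hx₁⟩ := eventually_atTop.1 (hF.eventually_shift_le (L / 2) he0)
  have hsmall := (hf.tendsto_tailInt.comp hshift).eventually_le_const
    (show 0 < a * e by positivity)
  filter_upwards [h.eventually_integral_tailIntegral_le (c := c) hF hq ha he0,
    eventually_ge_atTop x₁, hsmall] with x hx hxx₁ hxs τ hτm hτ
  simp only [Function.comp] at hxs
  set I := ∫ ω, tailIntegral F a x (renewalCount ξ (τ ω) ω) ∂μ with hI
  set P := μ.real {ω | (x : EReal) < pathSup (compoundRenewal c ξ Y) (τ ω) ω} with hP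
  have hP0 : 0 ≤ P := measureReal_nonneg
  have hfx : 0 < f x := hF.1 x
  have hC := h.isIncrementChain hτm hτ hq x
  -- The chain inequality is applied at this raised level, so that the tails on its right side are
  -- evaluated at exactly `x - S n`; long-tailedness brings the left side back to `x`.
  set y := x + L / 2 with hy
  have key : ∀ m, tailSum f b x (fun j => μ.real (markSet {0}ᶜ Y (survivalSet ξ τ) j)) m ≤
      (1 + e) * (a * (1 + 2 * e) * P + e * f x) := by
    intro m
    have h1 := hC.sum_integral_le hf hf1 hζ hζb hb0.le hL0 hL1 hSi y m
    rw [show y - L / 2 = x by rw [hy]; ring] at h1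
    have h2 : ∑ n ∈ Finset.range m, ∫ ω in markSet {0}ᶜ Y (activeSet c ξ Y τ x) n,
        f (x - chainState c ξ Y n ω) ∂μ ≤ q * P := by
      refine (Finset.sum_le_sum fun n _ => h.setIntegral_distTail_le hτm hτ hq x n).trans ?_
      rw [← Finset.mul_sum]
      exact mul_le_mul_of_nonneg_left (h.sum_measureReal_cross_le hτm x m) hq.le
    have h3 : f y * ∫ ω, huberErr L (-chainState c ξ Y 0 ω) ∂μ ≤ f x * e := by
      have h4 : f y ≤ f x := hf.anti (by rw [hy]; linarith)
      exact mul_le_mul h4 hL2 (MeasureTheory.integral_nonneg fun ω => huberErr_nonneg hL0 _) hfx.le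
    have h4 : tailSum f b y (fun j => μ.real (markSet {0}ᶜ Y (activeSet c ξ Y τ x) j)) m ≤
        a * (1 + e) * P + e * f x := by
      refine h1.trans ?_
      have h5 := mul_le_mul_of_nonneg_left h2 (show 0 ≤ b + b * e by positivity)
      have h6 : (b + b * e) * (q * P) = a * (1 + e) * P := by rw [← hbq]; ring
      linarith
    have h5 : tailSum f b y (fun j => μ.real (markSet {0}ᶜ Y (survivalSet ξ τ) j)) m ≤
        tailSum f b y (fun j => μ.real (markSet {0}ᶜ Y (activeSet c ξ Y τ x) j)) m +
          P * tailSum f b y (fun _ => 1) m := by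
      have h6 : tailSum f b y (fun j => μ.real (markSet {0}ᶜ Y (survivalSet ξ τ) j)) m ≤
          tailSum f b y (fun j => μ.real (markSet {0}ᶜ Y (activeSet c ξ Y τ x) j) + P) m :=
        tailSum_mono_weight hf hb0.le fun j _ => h.measureReal_survival_le c x τ j
      refine h6.trans_eq ?_
      simp only [tailSum, one_mul, add_mul, Finset.sum_add_distrib, Finset.mul_sum]
    have h6 : P * tailSum f b y (fun _ => 1) m ≤ P * (a * e) :=
      mul_le_mul_of_nonneg_left ((tailSum_one_le hf m).trans hxs) hP0
    have h7 := tailSum_sub_le (x := y) (R := L / 2) (δ := e) hf hb0.le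
      (w := fun j => μ.real (markSet {0}ᶜ Y (survivalSet ξ τ) j)) (fun j => measureReal_nonneg)
      (fun z hz => hx₁ z (by rw [hy] at hz; linarith)) m
    rw [show y - L / 2 = x by rw [hy]; ring] at h7
    refine h7.trans (mul_le_mul_of_nonneg_left ?_ (by linarith))
    linarith
  have h1 := hx τ hτm hτ _ key
  -- For `ε ≥ 1` the claimed lower bound is nonpositive.
  rcases le_or_gt 1 ε with hε1 | hε1
  · have hI0 : 0 ≤ I := ge_of_tendsto (h.tendsto_tailSum_survivalSet hτm ha x).2
      (Eventually.of_forall fun M => tailSum_nonneg hf ha.le (fun _ => measureReal_nonneg) M)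
    have h2 : (1 - ε) / a * I ≤ 0 :=
      mul_nonpos_of_nonpos_of_nonneg (div_nonpos_of_nonpos_of_nonneg (by linarith) ha.le) hI0
    have h3 : 0 ≤ ε * f x := by positivity
    linarith
  · have h2 : (1 - ε) / a * I ≤
        (1 - ε) / a * ((1 + e) * ((1 + e) * (a * (1 + 2 * e) * P + e * f x))) :=
      mul_le_mul_of_nonneg_left h1 (div_nonneg (by linarith) ha.le)
    have h3 : (1 - ε) / a * ((1 + e) * ((1 + e) * (a * (1 + 2 * e) * P + e * f x))) =
        (1 - ε) * ((1 + e) ^ 2 * (1 + 2 * e)) * P + (1 - ε) * (1 + e) ^ 2 * (e / a) * f x := by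
      field_simp
    have h4 : (1 + e) ^ 2 * (1 + 2 * e) ≤ 1 + 8 * e := by
      have e2 : e * e ≤ e * (1 / 4) := mul_le_mul_of_nonneg_left he1 he0.le
      have e3 : e * (e * e) ≤ e * (e * (1 / 4)) := mul_le_mul_of_nonneg_left e2 he0.le
      linarith [show (1 + e) ^ 2 * (1 + 2 * e) = 1 + 4 * e + 5 * (e * e) + 2 * (e * (e * e)) by ring]
    have h5 : (1 - ε) * ((1 + e) ^ 2 * (1 + 2 * e)) ≤ 1 := by
      have := mul_le_mul_of_nonneg_left h4 (show 0 ≤ 1 - ε by linarith)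
      nlinarith
    have h6 : e / a ≤ ε / 2 := by rw [div_le_iff₀ ha]; linarith
    have h7 : (1 - ε) * (1 + e) ^ 2 ≤ 2 := by nlinarith
    have h8 : (1 - ε) * (1 + e) ^ 2 * (e / a) ≤ ε := by
      have := mul_le_mul h7 h6 (by positivity) (by norm_num)
      linarith
    have h9 := mul_le_mul_of_nonneg_right h5 hP0
    have h10 := mul_le_mul_of_nonneg_right h8 hfx.le
    linarith

end IsCompoundRenewalModel

/-! ### The upper bound for the maximum -/

namespace IsCompoundRenewalModel

variable {Ω : Type*} [MeasurableSpace Ω] {μ : Measure Ω} [IsProbabilityMeasure μ] {F : Measure ℝ}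
  {ξ Y : ℕ → Ω → ℝ} {c a : ℝ}

lemma measureReal_waitTime (h : IsCompoundRenewalModel μ F ξ Y) {U : Set ℝ}
    (hU : MeasurableSet U) (hq : 0 < F.real U) {B : Set ℝ} (hB : MeasurableSet B) :
    μ.real (waitTime U ξ Y 0 ⁻¹' B) =
      ∑' m, F.real U * (1 - F.real U) ^ m * μ.real (renewalEpoch ξ (m + 1) ⁻¹' B) := by
  have := h.isProbabilityMeasure
  rw [Measure.real, h.measure_waitTime hU hq 0 hB, ENNReal.tsum_toReal_eq fun m =>
    ENNReal.mul_ne_top (ENNReal.mul_ne_top (ENNReal.pow_ne_top (measure_ne_top F _))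
      (measure_ne_top F _)) (measure_ne_top μ _)]
  refine tsum_congr fun m => ?_
  rw [ENNReal.toReal_mul, ENNReal.toReal_mul, ENNReal.toReal_pow]
  change F.real Uᶜ ^ m * F.real U * _ = _
  rw [probReal_compl_eq_one_sub hU, mul_comm (F.real U)]
  rfl

/-- The upward linear drift until the first nonzero jump has a negligible tail. -/
lemma negligibleTail_waitTime (h : IsCompoundRenewalModel μ F ξ Y)
    (hf : IsStrongTail (distTail F)) (hq : 0 < F.real {0}ᶜ)
    (hc : c ≤ 0 ∨ (0 < c ∧ (fun x : ℝ => μ.real {ω | x < c * ξ 0 ω}) =o[atTop] distTail F)) :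
    NegligibleTail μ (distTail F) fun ω => max c 0 * waitTime {0}ᶜ ξ Y 0 ω := by
  have := h.isProbabilityMeasure
  have hU : MeasurableSet ({0}ᶜ : Set ℝ) := (measurableSet_singleton 0).compl
  rcases hc with hc | ⟨hc, ho⟩
  · intro δ hδ
    filter_upwards [eventually_ge_atTop 0] with u hu
    have h1 : {ω | u < max c 0 * waitTime {0}ᶜ ξ Y 0 ω} = ∅ := by
      ext ω
      simp [max_eq_right hc, hu]
    rw [h1, measureReal_empty]
    exact mul_nonneg hδ.le (hf.nonneg u)
  · rw [max_eq_left hc.le]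
    have hmul : Measurable fun y : ℝ => c * y := measurable_const_mul c
    refine negligibleTail_of_geometric hf (W := fun i ω => c * ξ i ω)
      (fun i => (h.measurable_interarrival i).const_mul c)
      (h.indep_interarrival.comp (fun _ y => c * y) fun _ => hmul)
      (fun i => (h.identDistrib_interarrival i).comp hmul) (fun i => ?_) ?_ hq measureReal_le_one
      fun t => ?_
    · filter_upwards [h.pos_interarrival i] with ω hω
      positivity
    · intro δ hδ
      filter_upwards [ho.bound hδ] with u hu
      rwa [Real.norm_of_nonneg measureReal_nonneg, Real.norm_of_nonneg (hf.nonneg u)] at hu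
    · have h1 := h.measureReal_waitTime hU hq (hmul (measurableSet_Ioi (a := t)))
      refine Eq.trans ?_ (h1.trans (tsum_congr fun m => ?_))
      · rfl
      · congr 2
        ext ω
        simp [renewalEpoch, Finset.mul_sum]

/-- Conditioning on a nonzero jump divides the tail by `F {0}ᶜ`; the independent upward drift until
the next one is negligible and adds only `e`. -/
lemma eventually_markLaw_le (h : IsCompoundRenewalModel μ F ξ Y)
    (hf : IsStrongTail (distTail F)) (hq : 0 < F.real {0}ᶜ)
    (hneg : NegligibleTail μ (distTail F) fun ω => max c 0 * waitTime {0}ᶜ ξ Y 0 ω)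
    {e : ℝ} (he : 0 < e) : ∀ᶠ u in atTop,
      (markLaw μ F {0}ᶜ ξ Y).real {w | u < w.1 + max c 0 * w.2} ≤
        (1 / F.real {0}ᶜ + e) * distTail F u := by
  have := h.isProbabilityMeasure
  have hU : MeasurableSet ({0}ᶜ : Set ℝ) := (measurableSet_singleton 0).compl
  have := h.isProbabilityMeasure_markLaw hU hq
  have := h.isProbabilityMeasure_map_waitTime hU
  have := isProbabilityMeasure_cond (F := F) hq
  have hw := measurable_waitTime h.measurable_interarrival h.measurable_jump hU 0
  refine NegligibleTail.eventually_add_le hf measurable_fst (measurable_snd.const_mul _)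
    ?_ ?_ ?_ (by positivity) ?_ he
  · exact indepFun_prod measurable_id (measurable_const_mul (max c 0))
  · filter_upwards [h.ae_markLaw_nonneg hU hq] with w hw0
    exact mul_nonneg (le_max_right _ _) hw0
  · intro δ hδ
    filter_upwards [hneg δ hδ] with u hu
    refine le_trans (le_of_eq ?_) hu
    have hs : MeasurableSet {g : ℝ | u < max c 0 * g} :=
      measurableSet_lt measurable_const (measurable_const_mul _)
    have h1 : {w : ℝ × ℝ | u < max c 0 * w.2} = Set.univ ×ˢ {g : ℝ | u < max c 0 * g} := by
      ext w; simp
    rw [Measure.real, h1, markLaw, Measure.prod_prod, measure_univ, one_mul,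
      Measure.map_apply hw hs]
    rfl
  · filter_upwards [eventually_ge_atTop 0] with u hu
    rw [h.markLaw_real_lt_fst hu, div_eq_mul_one_div, mul_comm]

/-- The upper bound for the tail of the maximum. -/
theorem eventually_measureReal_pathSup_le (h : IsCompoundRenewalModel μ F ξ Y)
    (hf : IsStrongTail (distTail F)) (ha : 0 < a)
    (hdrift : ∫ ω, (c * ξ 0 ω + Y 0 ω) ∂μ = -a)
    (hc : c ≤ 0 ∨ (0 < c ∧ (fun x : ℝ => μ.real {ω | x < c * ξ 0 ω}) =o[atTop] distTail F))
    {ε : ℝ} (hε : 0 < ε) : ∀ᶠ x : ℝ in atTop, ∀ τ : Ω → ℝ≥0∞, Measurable τ →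
      IndepFutureIncrements μ (compoundRenewal c ξ Y) (renewalEpoch ξ) τ →
      μ.real {ω | (x : EReal) < pathSup (compoundRenewal c ξ Y) (τ ω) ω} ≤
        (1 + ε) / a * (∫ ω, tailIntegral F a x (renewalCount ξ (τ ω) ω) ∂μ) +
          ε * distTail F x := by
  have := h.isProbabilityMeasure
  have hU : MeasurableSet ({0}ᶜ : Set ℝ) := (measurableSet_singleton 0).compl
  have hF := hf.isLongTailed
  have hq := h.measureReal_compl_zero_pos hF.1
  have := h.isProbabilityMeasure_markLaw hU hq
  have hneg := h.negligibleTail_waitTime hf hq hc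
  have hwm := measurable_waitTime h.measurable_interarrival h.measurable_jump hU 0
  set q := F.real {0}ᶜ with hqdef
  set b := a / q with hb
  have hb0 : 0 < b := by positivity
  set e := min (1 / 4) (ε / 12) with he
  have he0 : 0 < e := by positivity
  have he1 : e ≤ 1 / 4 := min_le_left _ _
  have he2 : e ≤ ε / 12 := min_le_right _ _
  -- With this value `κ * b = (1 + 2 * e) / q` strictly exceeds the jump rate `(1 + e) / q`, as
  -- excessivity requires, while `κ` stays close to `1 / a`.
  set κ := (1 + 2 * e) / a with hκdef
  have hκ0 : 0 < κ := by positivity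
  have htail := h.eventually_markLaw_le hf hq hneg (show 0 < e / q by positivity)
  have hκb : 1 / q + e / q < κ * b := by
    have h1 : κ * b = (1 + 2 * e) / q := by rw [hκdef, hb]; field_simp
    rw [h1, ← add_div]
    exact div_lt_div_of_pos_right (by linarith) hq
  obtain ⟨hζ, hζb⟩ := h.integrable_markLaw hU hq (by simp) hdrift
  have hWi : Integrable (fun ω => max c 0 * waitTime {0}ᶜ ξ Y 0 ω) μ :=
    (h.integrable_waitTime hU hq).1.const_mul _
  have hW := hwm.const_mul (max c 0)
  obtain ⟨L₀, hL₀⟩ := eventually_atTop.1 (eventually_integral_huberErr_le hWi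
    (show 0 < e / 4 / κ by positivity))
  have hpm : Measurable fun w : ℝ × ℝ => w.1 + max c 0 * w.2 := by fun_prop
  have hζm : Measurable fun w : ℝ × ℝ => w.1 + c * w.2 := by fun_prop
  have hζp : ∀ᵐ w ∂(markLaw μ F {0}ᶜ ξ Y), w.1 + c * w.2 ≤ w.1 + max c 0 * w.2 := by
    filter_upwards [h.ae_markLaw_nonneg hU hq] with w hw0
    have := mul_le_mul_of_nonneg_right (le_max_left c 0) hw0
    linarith
  obtain ⟨L, hLL₀, hL, t, s, C, hs, _, hsκ, hexc⟩ := hf.exists_excessive hpm hζm hζp hζ hζb hb0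
    (by positivity) htail hκb L₀
  have herr : κ * ∫ ω, huberErr L (max c 0 * waitTime {0}ᶜ ξ Y 0 ω) ∂μ ≤ e / 4 := by
    have := hL₀ L hLL₀
    rw [le_div_iff₀ hκ0] at this
    linarith
  -- The crossing bound started from `x - R` has threshold exactly `x`; the shift by `R` is absorbed
  -- by long-tailedness.
  set R := L / 2 + C with hR
  have hsh : Tendsto (fun x : ℝ => x - R) atTop atTop :=
    tendsto_atTop_add_const_right _ _ tendsto_id
  have hinit := hsh.eventually
    (hf.eventually_lyapunov_init_le hW hWi hneg hκ0 hs hL he0 herr (t := t))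
  have hsmall := (hf.tendsto_tailInt.comp hsh).eventually_le_const
    (show 0 < e / κ by positivity)
  obtain ⟨x₁, hx₁⟩ := eventually_atTop.1 (hf.shift R e he0)
  filter_upwards [hinit, hsmall, hsh.eventually_ge_atTop t, hsh.eventually_ge_atTop s,
    eventually_ge_atTop x₁, hneg e he0,
    h.eventually_tailSum_markSet_le (c := c) hF hq ha he0] with x hx hxs hxt hxss hxx₁ hxn hxI τ hτm hτ
  simp only [Function.comp] at hxs
  set f := distTail F with hfdef
  set I := ∫ ω, tailIntegral F a x (renewalCount ξ (τ ω) ω) ∂μ with hI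
  have hI0 : 0 ≤ I := ge_of_tendsto (h.tendsto_tailSum_survivalSet hτm ha x).2
    (Eventually.of_forall fun M => tailSum_nonneg hf.toIsTail ha.le (fun _ => measureReal_nonneg) M)
  have hfx : 0 < f x := hf.pos x
  have hC := h.isIncrementChain hτm hτ hq x
  set B := markSet {0}ᶜ Y (activeSet c ξ Y τ x) with hB
  set D : ℕ → Set Ω := fun j => B j ∩ {ω | x < chainState c ξ Y j ω +
    ((chainMark ξ Y j ω).1 + max c 0 * (chainMark ξ Y j ω).2)} with hD
  have hxR : x - R + L / 2 + C = x := by rw [hR]; ring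
  have hsum : ∀ m, ∑ j ∈ Finset.range m, μ.real (D j) ≤
      (e * (1 + e) * f x + κ * ((1 + e) * ((1 + e) * I))) / (1 - e) := by
    intro m
    have h1 := hC.crossing_le hpm hf.toIsTail hκ0.le hL hb0.le hsκ hexc (x := x - R) (fun n => by
      rw [hxR]
      filter_upwards [h.ae_frequently_mem hU hq] with ω hω hmem
      exact chainState_add_le_of_mem_activeSet hω hmem) hxt hxss m
    rw [hxR] at h1
    have h2 : ∫ ω in B 0, (lyapunov f κ t s (x - R - huber L (chainState c ξ Y 0 ω)) -
        lyapunov f κ t s (x - R)) ∂μ ≤ e * f (x - R) := by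
      refine le_trans (le_of_eq (integral_congr_ae (ae_restrict_of_ae ?_)))
        (hx (B 0) (hC.measurableSet 0))
      filter_upwards [h.waitTime_zero_nonneg (U := {0}ᶜ), h.ae_frequently_mem hU hq] with ω h3 h4
      -- For `c ≤ 0` the first state is nonpositive and the Huber function vanishes there, so `c`
      -- may be replaced by its positive part.
      have h5 : huber L (chainState c ξ Y 0 ω) = huber L (max c 0 * waitTime {0}ᶜ ξ Y 0 ω) := by
        rw [chainState_zero h4]
        rcases le_total c 0 with hc0 | hc0
        · rw [max_eq_right hc0, zero_mul, huber_of_nonpos hL le_rfl,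
            huber_of_nonpos hL (mul_nonpos_of_nonpos_of_nonneg hc0 (h3 0 h4))]
        · rw [max_eq_left hc0]
      simp only [h5]
    have h3 : tailSum f b (x - R) (fun j => μ.real (B j)) m ≤ (1 + e) * ((1 + e) * I) := by
      refine (tailSum_mono_weight (w := fun j => μ.real (markSet {0}ᶜ Y (survivalSet ξ τ) j))
        hf.toIsTail hb0.le fun j _ => measureReal_mono
          (markSet_mono (fun i => Set.inter_subset_left) j)).trans ?_
      refine (tailSum_sub_le hf.toIsTail hb0.le (fun j => measureReal_nonneg)
        (fun y hy => hx₁ y (hxx₁.trans hy)) m).trans ?_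
      exact mul_le_mul_of_nonneg_left (hxI τ hτm hτ m) (by linarith)
    have h4 : f (x - R) ≤ (1 + e) * f x := hx₁ x hxx₁
    have h5 : κ * tailInt f (x - R) ≤ e := by
      rw [le_div_iff₀ hκ0] at hxs
      linarith
    have h6 : 0 ≤ ∑ j ∈ Finset.range m, μ.real (D j) :=
      Finset.sum_nonneg fun j _ => measureReal_nonneg
    rw [le_div_iff₀ (by linarith)]
    have h7 := mul_le_mul_of_nonneg_right (show 1 - e ≤ 1 - κ * tailInt f (x - R) by linarith) h6
    have h8 := mul_le_mul_of_nonneg_left h3 hκ0.le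
    have h9 := mul_le_mul_of_nonneg_left h4 he0.le
    have h10 : (1 - κ * tailInt f (x - R)) * ∑ j ∈ Finset.range m, μ.real (D j) ≤
      ∫ ω in B 0, (lyapunov f κ t s (x - R - huber L (chainState c ξ Y 0 ω)) -
        lyapunov f κ t s (x - R)) ∂μ + κ * tailSum f b (x - R) (fun j => μ.real (B j)) m := h1
    linarith
  have hP : μ.real {ω | (x : EReal) < pathSup (compoundRenewal c ξ Y) (τ ω) ω} ≤
      e * f x + (e * (1 + e) * f x + κ * ((1 + e) * ((1 + e) * I))) / (1 - e) := by
    have h1 : μ.real {ω | (x : EReal) < pathSup (compoundRenewal c ξ Y) (τ ω) ω} ≤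
        μ.real ({ω | x < max c 0 * waitTime {0}ᶜ ξ Y 0 ω} ∪ ⋃ j, D j) := by
      refine ENNReal.toReal_mono (measure_ne_top μ _) (measure_mono_ae ?_)
      filter_upwards [h.ae_isRegularPath, h.ae_frequently_mem hU hq] with ω hω hf hmem
      rcases hω.exists_cross hf hmem with h2 | ⟨j, h2, h3⟩
      · exact Or.inl h2
      · exact Or.inr (Set.mem_iUnion.2 ⟨j, h2, h3⟩)
    exact h1.trans ((measureReal_union_le _ _).trans
      (add_le_add hxn (measureReal_iUnion_le_of_sum_le hsum)))
  refine hP.trans ?_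
  have e1 : 0 < 1 - e := by linarith
  have e2 : e * e ≤ e * (1 / 4) := mul_le_mul_of_nonneg_left he1 he0.le
  have e3 : e * (e * e) ≤ e * (e * (1 / 4)) := mul_le_mul_of_nonneg_left e2 he0.le
  -- One factor comes from `κ`, two from the level shift and the change of counting, and `1 - e`
  -- from the value of the Lyapunov function at the start. The bound `e ≤ ε / 12` absorbs them all.
  have h1 : (1 + 2 * e) * (1 + e) ^ 2 ≤ (1 + ε) * (1 - e) := by
    have h2 : (1 + 2 * e) * (1 + e) ^ 2 ≤ (1 + 12 * e) * (1 - e) := by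
      linarith [show (1 + 2 * e) * (1 + e) ^ 2 = 1 + 4 * e + 5 * (e * e) + 2 * (e * (e * e)) by ring,
        show (1 + 12 * e) * (1 - e) = 1 + 11 * e - 12 * (e * e) by ring]
    exact h2.trans (mul_le_mul_of_nonneg_right (by linarith) e1.le)
  have h2 : e * (1 + e) ≤ 2 * e * (1 - e) := by nlinarith
  have h3 : (e * (1 + e) * f x + κ * ((1 + e) * ((1 + e) * I))) / (1 - e) ≤
      2 * e * f x + (1 + ε) / a * I := by
    rw [div_le_iff₀ e1]
    have h4 := mul_le_mul_of_nonneg_right h2 hfx.le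
    have h5 := mul_le_mul_of_nonneg_right h1 (div_nonneg hI0 ha.le)
    have h6 : κ * ((1 + e) * ((1 + e) * I)) = (1 + 2 * e) * (1 + e) ^ 2 * (I / a) := by
      rw [hκdef]; ring
    have h7 : (2 * e * f x + (1 + ε) / a * I) * (1 - e) =
        2 * e * (1 - e) * f x + (1 + ε) * (1 - e) * (I / a) := by ring
    rw [h6, h7]
    exact add_le_add h4 h5
  have h4 : 3 * e * f x ≤ ε * f x := mul_le_mul_of_nonneg_right (by linarith) hfx.le
  linarith

end IsCompoundRenewalModel

theorem mainTheorem1 {Ω : Type*} [MeasurableSpace Ω] (μ : Measure Ω) [IsProbabilityMeasure μ]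
    (F : Measure ℝ) (ξ Y : ℕ → Ω → ℝ) (hmodel : IsCompoundRenewalModel μ F ξ Y)
    (c a : ℝ) (ha : 0 < a) (hdrift : ∫ ω, (c * ξ 0 ω + Y 0 ω) ∂μ = -a) :
    -- the two-sided asymptotics, uniformly in `τ`
    ((c ≤ 0 ∨ (0 < c ∧ (fun x : ℝ => μ.real {ω | x < c * ξ 0 ω}) =o[atTop] distTail F)) →
      IsStrongSubexponential F →
      ∀ ε : ℝ, 0 < ε → ∃ x₀ : ℝ, ∀ x : ℝ, x₀ ≤ x →
        ∀ τ : Ω → ℝ≥0∞, Measurable τ →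
          IndepFutureIncrements μ (compoundRenewal c ξ Y) (renewalEpoch ξ) τ →
          |μ.real {ω | (x : EReal) < pathSup (compoundRenewal c ξ Y) (τ ω) ω}
              - 1 / a * ∫ ω, tailIntegral F a x (renewalCount ξ (τ ω) ω) ∂μ|
            ≤ ε / a * (∫ ω, tailIntegral F a x (renewalCount ξ (τ ω) ω) ∂μ)
              + ε * distTail F x) ∧
    -- the lower bound, uniformly in `τ`
    (IsLongTailed F →
      ∀ ε : ℝ, 0 < ε → ∃ x₀ : ℝ, ∀ x : ℝ, x₀ ≤ x →
        ∀ τ : Ω → ℝ≥0∞, Measurable τ →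
          IndepFutureIncrements μ (compoundRenewal c ξ Y) (renewalEpoch ξ) τ →
          (1 - ε) / a * (∫ ω, tailIntegral F a x (renewalCount ξ (τ ω) ω) ∂μ)
              - ε * distTail F x
            ≤ μ.real {ω | (x : EReal) < pathSup (compoundRenewal c ξ Y) (τ ω) ω}) := by
  have hF := hmodel.isProbabilityMeasure
  have hlower : IsLongTailed F → ∀ ε : ℝ, 0 < ε → _ := fun hlt ε hε =>
    eventually_atTop.1 (hmodel.eventually_le_measureReal_pathSup hlt ha hdrift hε)
  refine ⟨fun hc hS ε hε => ?_, hlower⟩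
  have hf := hS.isStrongTail
  -- Strong subexponential tails are long, so the lower half of the two-sided estimate is already
  -- available.
  obtain ⟨x₁, hx₁⟩ := hlower hf.isLongTailed ε hε
  obtain ⟨x₂, hx₂⟩ := eventually_atTop.1
    (hmodel.eventually_measureReal_pathSup_le hf ha hdrift hc hε)
  refine ⟨max x₁ x₂, fun x hx τ hτm hτ => ?_⟩
  have h1 := hx₁ x ((le_max_left _ _).trans hx) τ hτm hτ
  have h2 := hx₂ x ((le_max_right _ _).trans hx) τ hτm hτ
  set I := ∫ ω, tailIntegral F a x (renewalCount ξ (τ ω) ω) ∂μ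
  have e1 : (1 - ε) / a * I = 1 / a * I - ε / a * I := by ring
  have e2 : (1 + ε) / a * I = 1 / a * I + ε / a * I := by ring
  rw [abs_le]
  constructor <;> linarith
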